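/- Let $M$ be a smooth oriented 3-manifold and $\pi:P\to M$ a smooth principal $\mathrm{SU}(2)$-bundle (right action); orient the 6-manifold $P$. Let $W$ be a smooth principal connection on $P$, regarded as an $\mathfrak{su}(2)$-valued 1-form on $P$ (trace-free skew-Hermitian $2\times2$ matrices), with curvature $F(W)=dW+W\wedge W$, and let $$\Omega=CS(W)=\mathrm{Tr}\Big(W\wedge dW+\tfrac23 W\wedge W\wedge W\Big).$$ For a volume form $v$ on $P$ in the orientation class, let $K_\Omega$ be the endomorphism of $T^*P$ with $i_\xi(K_\Omega\alpha)=\alpha\wedge i_\xi\Omega\wedge\Omega/v$ for all tangent vectors $\xi$, and $\lambda(\Omega)=\frac16\mathrm{Tr}(K_\Omega^2)$. Assume that $W$ is negative definite, i.e. $\lambda(\Omega)<0$ everywhere. Let $J_\Omega=K_\Omega/\sqrt{-\lambda(\Omega)}$ be the almost complex structure defined by $\Omega$ and $\hat\Omega=-J_\Omega(\Omega)$, where $J_\Omega$ acts on all three indices of $\Omega$. Then there is a unique smooth horizontal $\mathrm{SU}(2)$-equivariant $\mathfrak{su}(2)$-valued 1-form $E_W$ on $P$ such that $F(W)=E_W\wedge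 E_W$ and the 3-form $-\frac23\mathrm{Tr}(E_W\wedge E_W\wedge E_W)$ is a positive multiple of the pullback of the orientation of $M$; and $$d\hat\Omega=0\iff \nabla_WE_W:=dE_W+W\wedge E_W+E_W\wedge W=0,$$ the right-hand side being the statement that $W$ is torsion-free. Moreover $-2\,\mathrm{Tr}(E_W\otimes E_W)$ is the pullback to $P$ of a smooth Riemannian metric on $M$, and if these equivalent conditions hold, then this metric has constant sectional curvature $-1$. -/

import Mathlib

open scoped Manifold ContDiff Matrix

/-! ### Differential forms on manifolds -/

/-- The real algebra of complex `2 × 2` matrices. It is a type synonym, so that the (submultiplicative)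
norm below is its only topological structure; any other norm would do as well. -/
def Mat2 : Type := Matrix (Fin 2) (Fin 2) ℂ

/-- The ring structure of `Mat2` is that of matrices. -/
noncomputable def Mat2.normedRing : NormedRing Mat2 :=
  (Matrix.linftyOpNormedRing : NormedRing (Matrix (Fin 2) (Fin 2) ℂ))

attribute [instance] Mat2.normedRing

/-- The real vector space structure of `Mat2` is that of matrices. -/
noncomputable def Mat2.normedAlgebra : NormedAlgebra ℝ Mat2 :=
  letI : NormedRing (Matrix (Fin 2) (Fin 2) ℂ) := Matrix.linftyOpNormedRing
  (Matrix.linftyOpNormedAlgebra : NormedAlgebra ℝ (Matrix (Fin 2) (Fin 2) ℂ))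

attribute [instance] Mat2.normedAlgebra

/-- An element of `Mat2` as a matrix. -/
def Mat2.toMatrix (X : Mat2) : Matrix (Fin 2) (Fin 2) ℂ := X

/-- (Not necessarily smooth) differential `k`-forms, with values in `F`, on a manifold modelled
on `ℝⁿ`. -/
abbrev DForm (n : ℕ) (X : Type*) [TopologicalSpace X]
    [ChartedSpace (EuclideanSpace ℝ (Fin n)) X] (k : ℕ) (F : Type*)
    [NormedAddCommGroup F] [NormedSpace ℝ F] :=
  ∀ p : X, TangentSpace (𝓡 n) p [⋀^Fin k]→L[ℝ] F

section Forms

variable {n : ℕ} {X : Type*} [TopologicalSpace X] [ChartedSpace (EuclideanSpace ℝ (Fin n)) X]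
variable {m : ℕ} {Y : Type*} [TopologicalSpace Y] [ChartedSpace (EuclideanSpace ℝ (Fin m)) Y]
variable {F : Type*} [NormedAddCommGroup F] [NormedSpace ℝ F]

/-- The expression of a form in the preferred chart around `p`. It is meaningful on the (open)
target of the chart. -/
noncomputable def DForm.inChart {k : ℕ} (a : DForm n X k F) (p : X) :
    EuclideanSpace ℝ (Fin n) → EuclideanSpace ℝ (Fin n) [⋀^Fin k]→L[ℝ] F :=
  fun y => (a ((extChartAt (𝓡 n) p).symm y)).compContinuousLinearMap
    (mfderiv (𝓡 n) (𝓡 n) (extChartAt (𝓡 n) p).symm y)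

/-- A form is smooth if all its expressions in charts are. -/
def DForm.IsSmooth {k : ℕ} (a : DForm n X k F) : Prop :=
  ∀ p : X, ContDiffOn ℝ ∞ (a.inChart p) (extChartAt (𝓡 n) p).target

/-- The exterior derivative: at `p`, it is computed in the chart around `p`. -/
noncomputable def DForm.d {k : ℕ} (a : DForm n X k F) : DForm n X (k + 1) F :=
  fun p => (extDeriv (a.inChart p) (extChartAt (𝓡 n) p p)).compContinuousLinearMap
    (mfderiv (𝓡 n) (𝓡 n) (extChartAt (𝓡 n) p) p)

/-- Pullback of forms. -/
noncomputable def DForm.pullback {k : ℕ} (f : X → Y) (a : DForm m Y k F) : DForm n X k F :=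
  fun p => (a (f p)).compContinuousLinearMap (mfderiv (𝓡 n) (𝓡 m) f p)

/-- A volume form: a smooth nowhere vanishing form of top degree. It is used to fix an
orientation. -/
def DForm.IsVolumeForm (v : DForm n X n ℝ) : Prop :=
  v.IsSmooth ∧ ∀ p, v p ≠ 0

end Forms

section Wedge

variable {V : Type*} [AddCommGroup V] [Module ℝ V] [TopologicalSpace V]
variable {A : Type*} [NormedRing A] [NormedAlgebra ℝ A]

/-- The multilinear map `(v₁, …, v_{k+l}) ↦ α (v₁, …, v_k) * β (v_{k+1}, …, v_{k+l})`. -/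
noncomputable def tensorMul {k l : ℕ} (α : V [⋀^Fin k]→L[ℝ] A) (β : V [⋀^Fin l]→L[ℝ] A) :
    ContinuousMultilinearMap ℝ (fun _ : Fin (k + l) => V) A where
  toFun v := α (fun i => v (Fin.castAdd l i)) * β (fun j => v (Fin.natAdd k j))
  map_update_add' := by
    intro inst v i x y
    obtain rfl : inst = instDecidableEqFin (k + l) := Subsingleton.elim _ _
    induction i using Fin.addCases with
    | left i =>
      have h1 : ∀ z, (fun j => Function.update v (Fin.castAdd l i) z (Fin.castAdd l j)) =
          Function.update (fun j => v (Fin.castAdd l j)) i z := fun z =>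
        Function.update_comp_eq_of_injective v (Fin.castAdd_injective k l) i z
      have h2 : ∀ z, (fun j => Function.update v (Fin.castAdd l i) z (Fin.natAdd k j)) =
          (fun j => v (Fin.natAdd k j)) := fun z => by
        funext j
        rw [Function.update_of_ne]
        intro h
        have := congrArg Fin.val h
        simp at this
        omega
      simp only [h1, h2, ContinuousAlternatingMap.map_update_add, add_mul]
    | right i =>
      have h1 : ∀ z, (fun j => Function.update v (Fin.natAdd k i) z (Fin.natAdd k j)) =
          Function.update (fun j => v (Fin.natAdd k j)) i z := fun z =>
        Function.update_comp_eq_of_injective v (Fin.natAdd_injective l k) i z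
      have h2 : ∀ z, (fun j => Function.update v (Fin.natAdd k i) z (Fin.castAdd l j)) =
          (fun j => v (Fin.castAdd l j)) := fun z => by
        funext j
        rw [Function.update_of_ne]
        intro h
        have := congrArg Fin.val h
        simp at this
        omega
      simp only [h1, h2, ContinuousAlternatingMap.map_update_add, mul_add]
  map_update_smul' := by
    intro inst v i c x
    obtain rfl : inst = instDecidableEqFin (k + l) := Subsingleton.elim _ _
    induction i using Fin.addCases with
    | left i =>
      have h1 : ∀ z, (fun j => Function.update v (Fin.castAdd l i) z (Fin.castAdd l j)) =
          Function.update (fun j => v (Fin.castAdd l j)) i z := fun z =>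
        Function.update_comp_eq_of_injective v (Fin.castAdd_injective k l) i z
      have h2 : ∀ z, (fun j => Function.update v (Fin.castAdd l i) z (Fin.natAdd k j)) =
          (fun j => v (Fin.natAdd k j)) := fun z => by
        funext j
        rw [Function.update_of_ne]
        intro h
        have := congrArg Fin.val h
        simp at this
        omega
      simp only [h1, h2, ContinuousAlternatingMap.map_update_smul, smul_mul_assoc]
    | right i =>
      have h1 : ∀ z, (fun j => Function.update v (Fin.natAdd k i) z (Fin.natAdd k j)) =
          Function.update (fun j => v (Fin.natAdd k j)) i z := fun z =>
        Function.update_comp_eq_of_injective v (Fin.natAdd_injective l k) i z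
      have h2 : ∀ z, (fun j => Function.update v (Fin.natAdd k i) z (Fin.castAdd l j)) =
          (fun j => v (Fin.castAdd l j)) := fun z => by
        funext j
        rw [Function.update_of_ne]
        intro h
        have := congrArg Fin.val h
        simp at this
        omega
      simp only [h1, h2, ContinuousAlternatingMap.map_update_smul, mul_smul_comm]
  cont := by
    refine Continuous.mul ?_ ?_
    · exact α.cont.comp (continuous_pi fun i => continuous_apply _)
    · exact β.cont.comp (continuous_pi fun i => continuous_apply _)

/-- The wedge product of alternating maps with values in an algebra,
`(α ∧ β)(v) = 1 / (k! l!) ∑_σ sign σ • α (v_σ(1), …, v_σ(k)) * β (v_σ(k+1), …, v_σ(k+l))`. -/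
noncomputable def wedge {k l : ℕ} (α : V [⋀^Fin k]→L[ℝ] A) (β : V [⋀^Fin l]→L[ℝ] A) :
    V [⋀^Fin (k + l)]→L[ℝ] A :=
  ((k.factorial * l.factorial : ℝ)⁻¹) •
    ContinuousMultilinearMap.alternatization (tensorMul α β)

end Wedge

/-- The real part of the trace, as a real linear map. (The traces considered below are traces of
products of two skew-Hermitian matrices, or antisymmetrised traces of products of three such
matrices, and are automatically real.) -/
noncomputable def reTrace : Mat2 →L[ℝ] ℝ :=
  haveI : FiniteDimensional ℝ Mat2 :=
    inferInstanceAs (FiniteDimensional ℝ (Matrix (Fin 2) (Fin 2) ℂ))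
  LinearMap.toContinuousLinearMap
    { toFun := fun X => X.toMatrix.trace.re
      map_add' := fun X Y => by
        change (Matrix.trace (X.toMatrix + Y.toMatrix)).re = _
        rw [Matrix.trace_add, Complex.add_re]
      map_smul' := fun c X => by
        change (Matrix.trace (c • X.toMatrix)).re = _
        rw [Matrix.trace_smul, Complex.smul_re, RingHom.id_apply] }

/-! ### Three-forms in six dimensions -/

section Hitchin

/-- The model six-dimensional vector space. -/
abbrev V6 : Type := EuclideanSpace ℝ (Fin 6)

/-- The covector `e^i` of the standard dual basis, as an alternating `1`-form. -/
noncomputable def stdCoform (i : Fin 6) : V6 [⋀^Fin 1]→L[ℝ] ℝ :=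
  ContinuousAlternatingMap.ofSubsingleton ℝ V6 ℝ (0 : Fin 1) (EuclideanSpace.proj i)

/-- The quotient `θ / v` of a top degree form `θ` by a nonzero top degree form `v`. -/
noncomputable def topRatio (θ v : V6 [⋀^Fin 6]→L[ℝ] ℝ) : ℝ :=
  θ (EuclideanSpace.basisFun (Fin 6) ℝ) / v (EuclideanSpace.basisFun (Fin 6) ℝ)

/-- Hitchin's endomorphism `K_Ω`, defined on covectors by `i_ξ (K_Ω α) = α ∧ i_ξ Ω ∧ Ω / v`.
This is its matrix: the entry `(i, j)` is `i_ξ (K_Ω α)` for `α = e^i` and `ξ = e_j`. Thus the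
matrix acts on vectors (by `*ᵥ`) as the transpose of the endomorphism `K_Ω` of covectors. -/
noncomputable def hitchinK (v : V6 [⋀^Fin 6]→L[ℝ] ℝ) (Ω : V6 [⋀^Fin 3]→L[ℝ] ℝ) :
    Matrix (Fin 6) (Fin 6) ℝ :=
  Matrix.of fun i j =>
    topRatio (wedge (stdCoform i)
      (wedge (Ω.curryLeft (EuclideanSpace.basisFun (Fin 6) ℝ j)) Ω)) v

/-- The invariant `λ(Ω) = Tr (K_Ω²) / 6`. -/
noncomputable def hitchinLambda (v : V6 [⋀^Fin 6]→L[ℝ] ℝ) (Ω : V6 [⋀^Fin 3]→L[ℝ] ℝ) : ℝ :=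
  (1 / 6) * (hitchinK v Ω * hitchinK v Ω).trace

/-- The matrix of `J_Ω = K_Ω / √(-λ(Ω))`, an almost complex structure if `λ(Ω) < 0`. -/
noncomputable def hitchinJ (v : V6 [⋀^Fin 6]→L[ℝ] ℝ) (Ω : V6 [⋀^Fin 3]→L[ℝ] ℝ) :
    Matrix (Fin 6) (Fin 6) ℝ :=
  (√(-hitchinLambda v Ω))⁻¹ • hitchinK v Ω

/-- `Ω̂ = - J_Ω (Ω)`, where `J_Ω` acts on all three indices of `Ω`. -/
noncomputable def hitchinHat (v : V6 [⋀^Fin 6]→L[ℝ] ℝ) (Ω : V6 [⋀^Fin 3]→L[ℝ] ℝ) :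
    V6 [⋀^Fin 3]→L[ℝ] ℝ :=
  -Ω.compContinuousLinearMap (Matrix.toEuclideanCLM (n := Fin 6) (𝕜 := ℝ) (hitchinJ v Ω))

variable {P : Type*} [TopologicalSpace P] [ChartedSpace (EuclideanSpace ℝ (Fin 6)) P]

/-- A `3`-form on a `6`-manifold is stable of negative type if `λ(Ω) < 0` at every point. (The
sign does not depend on the volume form `v`.) -/
def DForm.IsNegativeType (v : DForm 6 P 6 ℝ) (Ω : DForm 6 P 3 ℝ) : Prop :=
  ∀ p, hitchinLambda (v p) (Ω p) < 0

/-- The form `Ω̂` on a `6`-manifold oriented by `v`. -/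
noncomputable def DForm.hat (v : DForm 6 P 6 ℝ) (Ω : DForm 6 P 3 ℝ) : DForm 6 P 3 ℝ :=
  fun p => hitchinHat (v p) (Ω p)

end Hitchin

/-! ### Principal `SU(2)`-bundles and connections -/

/-- The group `SU(2)`. -/
abbrev SU2 : Type := Matrix.specialUnitaryGroup (Fin 2) ℂ

/-- Membership in the Lie algebra `su(2)`: trace-free skew-Hermitian matrices. -/
def IsSu2 (X : Mat2) : Prop := X.toMatrixᴴ = -X.toMatrix ∧ X.toMatrix.trace = 0

/-- An element of `SU(2)` as a matrix. -/
def SU2.mat (g : SU2) : Mat2 := (g : Matrix (Fin 2) (Fin 2) ℂ)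

/-- The standard identification of the unit sphere `S³` with `SU(2)`, which gives `SU(2)` its
structure of a smooth manifold. -/
noncomputable def su2OfSphere (q : Metric.sphere (0 : EuclideanSpace ℝ (Fin (3 + 1))) 1) : SU2 :=
  ⟨!![⟨q.1 0, q.1 3⟩, ⟨q.1 2, q.1 1⟩; ⟨-q.1 2, q.1 1⟩, ⟨q.1 0, -q.1 3⟩], by
    have h : q.1 0 ^ 2 + q.1 1 ^ 2 + q.1 2 ^ 2 + q.1 3 ^ 2 = 1 := by
      have h1 : ‖q.1‖ = 1 := by simp
      have h2 := EuclideanSpace.norm_sq_eq q.1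
      rw [h1] at h2
      simpa [Fin.sum_univ_four] using h2.symm
    rw [Matrix.mem_specialUnitaryGroup_iff, Matrix.mem_unitaryGroup_iff]
    constructor
    · ext i j
      fin_cases i <;> fin_cases j <;>
        simp [Matrix.mul_apply, Matrix.star_apply, Complex.ext_iff, Fin.sum_univ_two] <;>
        constructor <;> linarith
    · simp [Matrix.det_fin_two, Complex.ext_iff]
      constructor <;> linarith⟩

section Bundle

variable {M : Type*} [TopologicalSpace M] [ChartedSpace (EuclideanSpace ℝ (Fin 3)) M]
variable {P : Type*} [TopologicalSpace P] [ChartedSpace (EuclideanSpace ℝ (Fin 6)) P]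
variable [MulAction SU2ᵐᵒᵖ P]

/-- The right action of `SU(2)`. -/
def ract (g : SU2) (p : P) : P := MulOpposite.op g • p

/-- `π : P → M` is a smooth principal `SU(2)`-bundle: the right action on `P` and the projection
are smooth, the action preserves the fibres, and around every point of `M` there is a smooth
section `s`, over an open set `U`, such that `U × SU(2) → π⁻¹(U)`, `(y, g) ↦ s(y) g` is a
diffeomorphism; its inverse is `p ↦ (π(p), h(p))`. -/
structure IsPrincipalSU2Bundle (π : P → M) : Prop where
  smooth_act : ContMDiff ((𝓡 6).prod (𝓡 3)) (𝓡 6) ∞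
    (fun q : P × Metric.sphere (0 : EuclideanSpace ℝ (Fin (3 + 1))) 1 =>
      ract (su2OfSphere q.2) q.1)
  smooth_proj : ContMDiff (𝓡 6) (𝓡 3) ∞ π
  proj_act : ∀ (g : SU2) (p : P), π (ract g p) = π p
  locally_trivial : ∀ x : M, ∃ U : Set M, IsOpen U ∧ x ∈ U ∧ ∃ (s : M → P) (h : P → SU2),
    ContMDiffOn (𝓡 3) (𝓡 6) ∞ s U ∧
    ContMDiffOn (𝓡 6) 𝓘(ℝ, Mat2) ∞ (fun p => SU2.mat (h p)) (π ⁻¹' U) ∧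
    (∀ y ∈ U, π (s y) = y) ∧
    (∀ p ∈ π ⁻¹' U, ract (h p) (s (π p)) = p) ∧
    (∀ y ∈ U, ∀ g : SU2, h (ract g (s y)) = g)

/-- A matrix-valued `1`-form on `P` has values in `su(2)` and is equivariant:
`R_g^* a = g⁻¹ a g`. -/
structure IsEquivariantSu2Form (a : DForm 6 P 1 Mat2) : Prop where
  mem_su2 : ∀ p u, IsSu2 (a p u)
  equivariant : ∀ (g : SU2) (p : P) (u : TangentSpace (𝓡 6) p),
    a (ract g p) (fun _ => mfderiv (𝓡 6) (𝓡 6) (ract g) p u) =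
      SU2.mat g⁻¹ * a p (fun _ => u) * SU2.mat g

/-- A (smooth, principal) connection `W` on `P`: an equivariant `su(2)`-valued `1`-form that sends
the velocity at `0` of a curve `t ↦ p γ(t)`, where `γ` is a smooth curve in `SU(2)` with
`γ(0) = 1`, to `γ'(0)`. -/
structure IsConnectionForm (W : DForm 6 P 1 Mat2) : Prop extends IsEquivariantSu2Form W where
  smooth : W.IsSmooth
  vertical : ∀ (p : P) (γ : ℝ → SU2), ContDiff ℝ ∞ (fun t => SU2.mat (γ t)) → γ 0 = 1 →
    W (ract (γ 0) p)
        (fun _ => mfderiv 𝓘(ℝ, ℝ) (𝓡 6) (fun t : ℝ => ract (γ t) p) 0 (1 : ℝ)) =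
      deriv (fun t => SU2.mat (γ t)) 0

/-- The curvature `F = dW + W ∧ W`. -/
noncomputable def curvature (W : DForm 6 P 1 Mat2) : DForm 6 P 2 Mat2 :=
  fun p => W.d p + wedge (W p) (W p)

/-- The Chern-Simons form `Tr (W ∧ dW + (2/3) W ∧ W ∧ W)`. -/
noncomputable def chernSimons (W : DForm 6 P 1 Mat2) : DForm 6 P 3 ℝ :=
  fun p => reTrace.compContinuousAlternatingMap
    (wedge (W p) (W.d p) + (2 / 3 : ℝ) • wedge (W p) (wedge (W p) (W p)))

/-- The covariant exterior derivative `∇_W E = dE + W ∧ E + E ∧ W` of a `1`-form. -/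
noncomputable def covExtDeriv (W E : DForm 6 P 1 Mat2) : DForm 6 P 2 Mat2 :=
  fun p => E.d p + wedge (W p) (E p) + wedge (E p) (W p)

/-- `E` is a smooth basic (that is, horizontal and equivariant) `su(2)`-valued `1`-form with
`F(W) = E ∧ E` and it is positively oriented: its volume form `-(2/3) Tr (E ∧ E ∧ E)` is a
positive multiple of (the pullback of) the volume form `v` of `M`. -/
structure IsFrameOf (π : P → M) (v : DForm 3 M 3 ℝ) (W E : DForm 6 P 1 Mat2) : Prop
    extends IsEquivariantSu2Form E where
  smooth : E.IsSmooth
  horizontal : ∀ (p : P) (u : TangentSpace (𝓡 6) p), mfderiv (𝓡 6) (𝓡 3) π p u = 0 →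
    E p (fun _ => u) = 0
  curvature_eq : ∀ p, curvature W p = wedge (E p) (E p)
  oriented : ∀ p, ∃ c : ℝ, 0 < c ∧
    (-(2 / 3) : ℝ) • reTrace.compContinuousAlternatingMap (wedge (E p) (wedge (E p) (E p))) =
      c • v.pullback π p

end Bundle

/-! ### Curvature of Riemannian metrics -/

section Riemannian

/-- The model three-dimensional vector space. -/
abbrev V3 : Type := EuclideanSpace ℝ (Fin 3)

/-- Partial derivatives in coordinates. -/
noncomputable def pderiv3 (i : Fin 3) (f : V3 → ℝ) (y : V3) : ℝ :=
  fderiv ℝ f y (EuclideanSpace.basisFun (Fin 3) ℝ i)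

/-- Christoffel symbols
`Γ^l_{ij} = (1/2) ∑_m g^{lm} (∂_i g_{mj} + ∂_j g_{mi} - ∂_m g_{ij})` of a metric given by its
matrix `G` in coordinates. -/
noncomputable def christoffel (G : V3 → Matrix (Fin 3) (Fin 3) ℝ) (l i j : Fin 3) (y : V3) : ℝ :=
  (1 / 2) * ∑ m, (G y)⁻¹ l m *
    (pderiv3 i (fun z => G z m j) y + pderiv3 j (fun z => G z m i) y
      - pderiv3 m (fun z => G z i j) y)

/-- Components `R^l_{kij}` of the curvature of the Levi-Civita connection:
`R(∂_i, ∂_j) ∂_k = ∑_l R^l_{kij} ∂_l`, where `R(X, Y) = [∇_X, ∇_Y] - ∇_{[X, Y]}`. -/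
noncomputable def riemannTensor (G : V3 → Matrix (Fin 3) (Fin 3) ℝ) (l k i j : Fin 3) (y : V3) :
    ℝ :=
  pderiv3 i (christoffel G l j k) y - pderiv3 j (christoffel G l i k) y
    + ∑ m, (christoffel G l i m y * christoffel G m j k y
      - christoffel G l j m y * christoffel G m i k y)

variable {M : Type*} [TopologicalSpace M] [ChartedSpace (EuclideanSpace ℝ (Fin 3)) M]
  [IsManifold (𝓡 3) ∞ M]

/-- Smooth Riemannian metrics on `M`. -/
abbrev RMetric (M : Type*) [TopologicalSpace M] [ChartedSpace (EuclideanSpace ℝ (Fin 3)) M]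
    [IsManifold (𝓡 3) ∞ M] :=
  Bundle.ContMDiffRiemannianMetric (𝓡 3) ∞ V3 (fun x : M => TangentSpace (𝓡 3) x)

/-- The matrix `g_{ij}` of the metric in the preferred chart around `x`. -/
noncomputable def RMetric.gram (g : RMetric M) (x : M) (y : V3) : Matrix (Fin 3) (Fin 3) ℝ :=
  Matrix.of fun i j => g.inner ((extChartAt (𝓡 3) x).symm y)
    (mfderiv (𝓡 3) (𝓡 3) (extChartAt (𝓡 3) x).symm y (EuclideanSpace.basisFun (Fin 3) ℝ i))
    (mfderiv (𝓡 3) (𝓡 3) (extChartAt (𝓡 3) x).symm y (EuclideanSpace.basisFun (Fin 3) ℝ j))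

/-- `g` has constant sectional curvature `κ`: in every chart, and for all tangent vectors
`a`, `b`, `g(R(a, b) b, a) = κ (g(a, a) g(b, b) - g(a, b)²)`. -/
def RMetric.HasConstantCurvature (g : RMetric M) (κ : ℝ) : Prop :=
  ∀ x : M, ∀ y ∈ (extChartAt (𝓡 3) x).target, ∀ a b : Fin 3 → ℝ,
    ∑ l, ∑ k, ∑ i, ∑ j, ∑ n,
        g.gram x y l n * riemannTensor (g.gram x) l k i j y * b k * a i * b j * a n =
      κ * ((a ⬝ᵥ g.gram x y *ᵥ a) * (b ⬝ᵥ g.gram x y *ᵥ b) - (a ⬝ᵥ g.gram x y *ᵥ b) ^ 2)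

end Riemannian

/-!
Everything is computed in a coframe `(w, x)` of the six-dimensional space `P`, where `w` consists of
the three `su(2)`-components of the connection `W` and `x` of three horizontal `1`-forms. Since the
bracket of `su(2)` is the cross product, the curvature is `F = C (x × x)` for a `3 × 3` matrix `C`, and
the Chern-Simons form is `½ w₀ ∧ w₁ ∧ w₂ - ½ ∑ C a i • wₐ ∧ ⋆ xᵢ` (`reTrace_chernSimons`). For a form
`c w₀ ∧ w₁ ∧ w₂ + ∑ B a i • wₐ ∧ ⋆ xᵢ`, Hitchin's endomorphism exchanges the `w`- and the `x`-part and
its invariant is `λ = 4 c det B` in the volume of the coframe (`hitchinLambda_adapted`). So `W` is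
negative definite exactly if `det C > 0`.

*The square root of the curvature.* If `E` has the matrix `N` in the coframe `x`, the equation
`F = E ∧ E` says that the cofactor matrix of `N` is `C`. For `det C > 0` this has exactly two solutions
`± (det C)^(-1/2) adj(C)ᵀ`, and the orientation selects one of them (`frameMatrix`). In a local
trivialization this is done on the base, with the curvature of the pullback of `W` by the local
section; `W`, `E` and the curvature at the other points of the fibres are gauge transforms of the
expressions on the base (`IsConnectionForm.along_eq`, `curv_gauge`). This gives existence,
uniqueness, smoothness and equivariance of `E` (`IsConnectionForm.isFrameAt_iff`,
`IsConnectionForm.existsUnique_isFrameOf`).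

*The dual form.* With `x = E` the matrix `C` is the identity, so that `Ω` is half the real part of
the cube of the complex coframe `w + i x`, and `Ω̂` is half its imaginary part up to a sign, which
compares orientations and is locally constant (`hitchinHat_adapted`). By the structure equations
`dW = E ∧ E - W ∧ W` and `dE = τ - W ∧ E - E ∧ W`, with `τ` the torsion, the exterior derivative of `Ω̂`
is linear in `τ` (`imForm_structure_eq`), and contracting it with two vertical vectors recovers all
components of `τ`, because the torsion is horizontal. So `dΩ̂ = 0` if and only if `τ = 0`
(`IsConnectionForm.hat_d_eq_zero_iff`).

*The metric.* The form `-2 Tr (E ⊗ E)` is the Euclidean product of the components of `E`. It is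
invariant under conjugation and horizontal, so it descends to the base, where it is `NᵀN` for the
matrix `N` of `E` in coordinates (`IsConnectionForm.baseMetric_symm_eq`). If the torsion vanishes, the
Levi-Civita connection of this metric is `W` read in the coframe `E` (`christoffel_eq`), so the
Riemann tensor is `F = E ∧ E` acting on the frame by the cross product
(`sum_riemannTensor_smul`). The operator `w ↦ (u × v) × w` is the curvature of a space of constant
curvature `-1` (`cross3_cross3_dotProduct`, `sectional_eq_of_curvature_eq`).
-/

open scoped Topology

/-! ### Evaluation of wedge products -/

/-- The permutation of `Fin (n + 1)` that sends `0` to `i` and `j + 1` to `i.succAbove (e j)`. -/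
def consPerm {n : ℕ} (i : Fin (n + 1)) (e : Equiv.Perm (Fin n)) : Equiv.Perm (Fin (n + 1)) :=
  i.cycleRange.symm * Equiv.Perm.decomposeFin.symm (0, e)

theorem consPerm_zero {n : ℕ} (i : Fin (n + 1)) (e : Equiv.Perm (Fin n)) :
    consPerm i e 0 = i := by
  simp [consPerm]

theorem consPerm_succ {n : ℕ} (i : Fin (n + 1)) (e : Equiv.Perm (Fin n)) (j : Fin n) :
    consPerm i e j.succ = i.succAbove (e j) := by
  simp [consPerm]

theorem sign_consPerm {n : ℕ} (i : Fin (n + 1)) (e : Equiv.Perm (Fin n)) :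
    Equiv.Perm.sign (consPerm i e) = (-1) ^ (i : ℕ) * Equiv.Perm.sign e := by
  simp [consPerm, Equiv.Perm.sign_mul, Fin.sign_cycleRange]

theorem consPerm_bijective (n : ℕ) :
    Function.Bijective (fun q : Fin (n + 1) × Equiv.Perm (Fin n) => consPerm q.1 q.2) := by
  rw [Fintype.bijective_iff_injective_and_card]
  refine ⟨?_, by simp [Fintype.card_perm, Nat.factorial_succ]⟩
  rintro ⟨i, e⟩ ⟨i', e'⟩ h
  have h0 : i = i' := by
    have := congrArg (fun σ : Equiv.Perm (Fin (n + 1)) => σ 0) h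
    simpa [consPerm_zero] using this
  subst h0
  have : e = e' := by
    ext1 j
    have := congrArg (fun σ : Equiv.Perm (Fin (n + 1)) => σ j.succ) h
    simpa [consPerm_succ] using this
  rw [this]

/-- A signed sum over permutations, expanded along the image of `0`. -/
theorem sum_perm_succ {n : ℕ} {V N : Type*} [AddCommGroup N] (f : (Fin (n + 1) → V) → N)
    (v : Fin (n + 1) → V) :
    ∑ σ : Equiv.Perm (Fin (n + 1)), Equiv.Perm.sign σ • f (v ∘ σ) =
      ∑ i : Fin (n + 1), ((-1 : ℤˣ) ^ (i : ℕ)) •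
        ∑ e : Equiv.Perm (Fin n), Equiv.Perm.sign e •
          f (Matrix.vecCons (v i) (i.removeNth v ∘ e)) := by
  rw [← (consPerm_bijective n).sum_comp, Fintype.sum_prod_type]
  refine Finset.sum_congr rfl fun i _ => ?_
  rw [Finset.smul_sum]
  refine Finset.sum_congr rfl fun e _ => ?_
  rw [sign_consPerm, mul_smul]
  congr 3
  funext j
  refine Fin.cases ?_ (fun j => ?_) j
  · simp [consPerm_zero]
  · simp [consPerm_succ, Fin.removeNth]

section Wedge

variable {V : Type*} [AddCommGroup V] [Module ℝ V] [TopologicalSpace V]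
variable {A : Type*} [NormedRing A] [NormedAlgebra ℝ A]

theorem sum_perm_alternating {l : ℕ} (b : V [⋀^Fin l]→L[ℝ] A) (x : A) (v : Fin l → V) :
    ∑ e : Equiv.Perm (Fin l), Equiv.Perm.sign e • (x * b (v ∘ e)) =
      (l.factorial : ℝ) • (x * b v) := by
  have : ∀ e : Equiv.Perm (Fin l), Equiv.Perm.sign e • (x * b (v ∘ e)) = x * b v := fun e => by
    have := b.toAlternatingMap.map_perm v e
    rw [show b (v ∘ e) = Equiv.Perm.sign e • b v from this]
    rcases Int.units_eq_one_or (Equiv.Perm.sign e) with h | h <;> simp [h]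
  simp only [this, Finset.sum_const, Finset.card_univ, Fintype.card_perm, Fintype.card_fin]
  rw [Nat.cast_smul_eq_nsmul]

/-- Expansion of the alternatization of `f (v 0) * b (v 1, …, v l)` along the first argument. -/
theorem sum_perm_mul {l : ℕ} (f : V → A) (b : V [⋀^Fin l]→L[ℝ] A) (v : Fin (l + 1) → V) :
    ∑ σ : Equiv.Perm (Fin (l + 1)), Equiv.Perm.sign σ •
        (f (v (σ 0)) * b (fun j => v (σ j.succ))) =
      (l.factorial : ℝ) • ∑ i : Fin (l + 1), (-1 : ℤˣ) ^ (i : ℕ) •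
        (f (v i) * b (i.removeNth v)) := by
  have h := sum_perm_succ (fun w : Fin (l + 1) → V => f (w 0) * b (fun j => w j.succ)) v
  simp only [Function.comp_apply] at h
  rw [h, Finset.smul_sum]
  refine Finset.sum_congr rfl fun i _ => ?_
  rw [smul_comm]
  congr 1
  exact sum_perm_alternating b (f (v i)) (i.removeNth v)

theorem wedge_apply {k l : ℕ} (a : V [⋀^Fin k]→L[ℝ] A) (b : V [⋀^Fin l]→L[ℝ] A)
    (v : Fin (k + l) → V) :
    wedge a b v = ((k.factorial * l.factorial : ℝ)⁻¹) •
      ∑ σ : Equiv.Perm (Fin (k + l)), Equiv.Perm.sign σ • (a (fun i => v (σ (Fin.castAdd l i))) *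
        b (fun j => v (σ (Fin.natAdd k j)))) := by
  change (_ : ℝ) • ContinuousMultilinearMap.alternatization (tensorMul a b) v = _
  rw [ContinuousMultilinearMap.alternatization_apply_apply]
  rfl

/-- The exterior product with a `1`-form is an alternating sum over the position of the argument of
that `1`-form. -/
theorem wedge_one_apply {l : ℕ} (a : V [⋀^Fin 1]→L[ℝ] A) (b : V [⋀^Fin l]→L[ℝ] A)
    (h : 1 + l = l + 1) (v : Fin (l + 1) → V) :
    wedge a b (fun i => v (Fin.cast h i)) = ∑ i : Fin (l + 1), (-1 : ℤˣ) ^ (i : ℕ) •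
        (a (fun _ => v i) * b (i.removeNth v)) := by
  have e := sum_perm_mul (fun x => a fun _ => x) b v
  rw [wedge_apply]
  have : ∑ σ : Equiv.Perm (Fin (1 + l)), Equiv.Perm.sign σ •
      (a (fun i => v (Fin.cast h (σ (Fin.castAdd l i)))) *
        b (fun j => v (Fin.cast h (σ (Fin.natAdd 1 j))))) =
      ∑ σ : Equiv.Perm (Fin (l + 1)), Equiv.Perm.sign σ •
        (a (fun _ => v (σ 0)) * b (fun j => v (σ j.succ))) := by
    rw [← (Equiv.permCongr (finCongr h)).sum_comp]
    refine Finset.sum_congr rfl fun σ _ => ?_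
    rw [Equiv.Perm.sign_permCongr]
    congr 3
    · funext i
      obtain rfl := Subsingleton.elim i 0
      simp [Equiv.permCongr_apply]
      rfl
    · funext j
      simp only [Equiv.permCongr_apply, finCongr_apply, finCongr_symm]
      congr 4
      ext
      simp [add_comm]
  rw [this, e, ← mul_smul]
  simp [Nat.factorial_ne_zero]

theorem wedge_one_one (a b : V [⋀^Fin 1]→L[ℝ] A) (v : Fin 2 → V) :
    wedge a b v = a (fun _ => v 0) * b (fun _ => v 1) - a (fun _ => v 1) * b (fun _ => v 0) := by
  have e : ∀ (i : Fin 2) (j : Fin 2), (∀ k : Fin 1, i.succAbove k = j) →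
    i.removeNth v = fun _ => v j := fun i j h => funext fun k => congrArg v (h k)
  refine (wedge_one_apply a b rfl v).trans ?_
  simp only [Fin.sum_univ_succ]
  simp [e 0 1 (by decide), e 1 0 (by decide)]
  abel

theorem wedge_one_two (a : V [⋀^Fin 1]→L[ℝ] A) (b : V [⋀^Fin 2]→L[ℝ] A) (v : Fin 3 → V) :
    wedge a b v = a (fun _ => v 0) * b ![v 1, v 2] - a (fun _ => v 1) * b ![v 0, v 2]
      + a (fun _ => v 2) * b ![v 0, v 1] := by
  have e0 : Fin.removeNth 0 v = ![v 1, v 2] := by ext i; fin_cases i <;> rfl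
  have e1 : Fin.removeNth 1 v = ![v 0, v 2] := by ext i; fin_cases i <;> rfl
  have e2 : Fin.removeNth 2 v = ![v 0, v 1] := by ext i; fin_cases i <;> rfl
  have h : wedge a b v = _ := wedge_one_apply a b rfl v
  rw [h, Fin.sum_univ_three, e0, e1, e2]
  simp
  abel

theorem wedge_one_five (a : V [⋀^Fin 1]→L[ℝ] A) (b : V [⋀^Fin 5]→L[ℝ] A) (v : Fin 6 → V) :
    wedge a b v = a (fun _ => v 0) * b ![v 1, v 2, v 3, v 4, v 5]
      - a (fun _ => v 1) * b ![v 0, v 2, v 3, v 4, v 5]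
      + a (fun _ => v 2) * b ![v 0, v 1, v 3, v 4, v 5]
      - a (fun _ => v 3) * b ![v 0, v 1, v 2, v 4, v 5]
      + a (fun _ => v 4) * b ![v 0, v 1, v 2, v 3, v 5]
      - a (fun _ => v 5) * b ![v 0, v 1, v 2, v 3, v 4] := by
  have e0 : Fin.removeNth 0 v = ![v 1, v 2, v 3, v 4, v 5] := by ext i; fin_cases i <;> rfl
  have e1 : Fin.removeNth 1 v = ![v 0, v 2, v 3, v 4, v 5] := by ext i; fin_cases i <;> rfl
  have e2 : Fin.removeNth 2 v = ![v 0, v 1, v 3, v 4, v 5] := by ext i; fin_cases i <;> rfl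
  have e3 : Fin.removeNth 3 v = ![v 0, v 1, v 2, v 4, v 5] := by ext i; fin_cases i <;> rfl
  have e4 : Fin.removeNth 4 v = ![v 0, v 1, v 2, v 3, v 5] := by ext i; fin_cases i <;> rfl
  have e5 : Fin.removeNth 5 v = ![v 0, v 1, v 2, v 3, v 4] := by ext i; fin_cases i <;> rfl
  have h : wedge a b v = ∑ i : Fin 6, (-1 : ℤˣ) ^ (i : ℕ) •
      (a (fun _ => v i) * b (i.removeNth v)) := wedge_one_apply a b (by norm_num) v
  refine h.trans ?_
  rw [Fin.sum_univ_six, e0, e1, e2, e3, e4, e5]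
  simp [pow_succ]
  abel

/-- The exterior product of a `2`-form and a `3`-form is the signed sum over the ten
`(2, 3)`-shuffles. -/
theorem wedge_two_three (a : V [⋀^Fin 2]→L[ℝ] A) (b : V [⋀^Fin 3]→L[ℝ] A) (v : Fin 5 → V) :
    wedge a b v = a ![v 0, v 1] * b ![v 2, v 3, v 4] - a ![v 0, v 2] * b ![v 1, v 3, v 4]
      + a ![v 0, v 3] * b ![v 1, v 2, v 4] - a ![v 0, v 4] * b ![v 1, v 2, v 3]
      + a ![v 1, v 2] * b ![v 0, v 3, v 4] - a ![v 1, v 3] * b ![v 0, v 2, v 4]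
      + a ![v 1, v 4] * b ![v 0, v 2, v 3] + a ![v 2, v 3] * b ![v 0, v 1, v 4]
      - a ![v 2, v 4] * b ![v 0, v 1, v 3] + a ![v 3, v 4] * b ![v 0, v 1, v 2] := by
  have h := sum_perm_succ (n := 4)
    (fun w : Fin 5 → V => a ![w 0, w 1] * b (fun j => w j.succ.succ)) v
  have h' : ∀ i : Fin 5, ∑ e : Equiv.Perm (Fin 4), Equiv.Perm.sign e •
      (a ![v i, i.removeNth v (e 0)] * b (fun j : Fin 3 => i.removeNth v (e j.succ))) = _ :=
    fun i => sum_perm_mul (fun x => a ![v i, x]) b (i.removeNth v)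
  have h2 : wedge a b v = ((Nat.factorial 2 * Nat.factorial 3 : ℝ)⁻¹) •
      ∑ i : Fin 5, ((-1 : ℤˣ) ^ (i : ℕ)) • ((Nat.factorial 3 : ℝ) •
        ∑ k : Fin 4, (-1 : ℤˣ) ^ (k : ℕ) •
          (a ![v i, i.removeNth v k] * b (k.removeNth (i.removeNth v)))) := by
    rw [wedge_apply]
    simp only [← h']
    refine congrArg _ (Eq.trans ?_ h)
    refine Finset.sum_congr rfl fun σ _ => ?_
    congr 2
    · congr 1
      funext i
      fin_cases i <;> rfl
    · congr 1
      funext i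
      fin_cases i <;> rfl
  rw [h2]
  -- each shuffle occurs twice, once for each order of the two arguments of `a`
  have e : ∀ (i : Fin 5) (k : Fin 4) (j : Fin 3 → Fin 5),
      (∀ m, i.succAbove (k.succAbove m) = j m) →
      k.removeNth (i.removeNth v) = ![v (j 0), v (j 1), v (j 2)] :=
    fun i k j h => funext fun m => (congrArg v (h m)).trans (by fin_cases m <;> rfl)
  have e' : ∀ (i : Fin 5) (k : Fin 4) (j : Fin 5), i.succAbove k = j → i.removeNth v k = v j :=
    fun i k j h => congrArg v h
  have sw : ∀ x y, a ![y, x] = - a ![x, y] := fun x y => by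
    have := a.toAlternatingMap.map_swap ![x, y] (show (0 : Fin 2) ≠ 1 by decide)
    rw [← show ![x, y] ∘ Equiv.swap 0 1 = ![y, x] by ext i; fin_cases i <;> rfl]
    exact this
  simp only [Fin.sum_univ_five, Fin.sum_univ_four]
  simp only [e 0 0 ![2, 3, 4] (by decide),
    e 0 1 ![1, 3, 4] (by decide),
    e 0 2 ![1, 2, 4] (by decide),
    e 0 3 ![1, 2, 3] (by decide),
    e 1 0 ![2, 3, 4] (by decide),
    e 1 1 ![0, 3, 4] (by decide),
    e 1 2 ![0, 2, 4] (by decide),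
    e 1 3 ![0, 2, 3] (by decide),
    e 2 0 ![1, 3, 4] (by decide),
    e 2 1 ![0, 3, 4] (by decide),
    e 2 2 ![0, 1, 4] (by decide),
    e 2 3 ![0, 1, 3] (by decide),
    e 3 0 ![1, 2, 4] (by decide),
    e 3 1 ![0, 2, 4] (by decide),
    e 3 2 ![0, 1, 4] (by decide),
    e 3 3 ![0, 1, 2] (by decide),
    e 4 0 ![1, 2, 3] (by decide),
    e 4 1 ![0, 2, 3] (by decide),
    e 4 2 ![0, 1, 3] (by decide),
    e 4 3 ![0, 1, 2] (by decide),
    e' 0 0 1 (by decide),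
    e' 0 1 2 (by decide),
    e' 0 2 3 (by decide),
    e' 0 3 4 (by decide),
    e' 1 0 0 (by decide),
    e' 1 1 2 (by decide),
    e' 1 2 3 (by decide),
    e' 1 3 4 (by decide),
    e' 2 0 0 (by decide),
    e' 2 1 1 (by decide),
    e' 2 2 3 (by decide),
    e' 2 3 4 (by decide),
    e' 3 0 0 (by decide),
    e' 3 1 1 (by decide),
    e' 3 2 2 (by decide),
    e' 3 3 4 (by decide),
    e' 4 0 0 (by decide),
    e' 4 1 1 (by decide),
    e' 4 2 2 (by decide),
    e' 4 3 3 (by decide),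
    sw (v 0) (v 1),
    sw (v 0) (v 2),
    sw (v 0) (v 3),
    sw (v 0) (v 4),
    sw (v 1) (v 2),
    sw (v 1) (v 3),
    sw (v 1) (v 4),
    sw (v 2) (v 3),
    sw (v 2) (v 4),
    sw (v 3) (v 4)]
  simp only [Fin.val_zero, Fin.val_one, pow_zero, one_smul, Units.neg_smul, neg_mul,
    smul_neg, neg_neg, show ((2 : Fin 5) : ℕ) = 2 from rfl, show ((3 : Fin 5) : ℕ) = 3 from rfl,
    show ((4 : Fin 5) : ℕ) = 4 from rfl, show ((2 : Fin 4) : ℕ) = 2 from rfl,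
    show ((3 : Fin 4) : ℕ) = 3 from rfl, pow_succ, mul_neg, mul_one,
    Matrix.cons_val]
  norm_num [Nat.factorial]
  module

end Wedge

/-! ### Three-forms in an adapted coframe -/

/-- The `3 × 3` determinant of the rows `f`, `g`, `h`. -/
def det3 (f g h : Fin 3 → ℝ) : ℝ :=
  f 0 * (g 1 * h 2 - g 2 * h 1) + f 1 * (g 2 * h 0 - g 0 * h 2) + f 2 * (g 0 * h 1 - g 1 * h 0)

/-- The cross product of two vectors of `ℝ³`. -/
def cross3 (f g : Fin 3 → ℝ) : Fin 3 → ℝ :=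
  ![f 1 * g 2 - f 2 * g 1, f 2 * g 0 - f 0 * g 2, f 0 * g 1 - f 1 * g 0]

/-- The pairing `∑ₐ wₐ (B y)ₐ`. -/
def pair3 (B : Matrix (Fin 3) (Fin 3) ℝ) (w y : Fin 3 → ℝ) : ℝ :=
  ∑ a, ∑ i, B a i * w a * y i

/-- The value of the `3`-form `c w₀ ∧ w₁ ∧ w₂ + ∑ B a i • wₐ ∧ ⋆ xᵢ`, where
`⋆ xᵢ = xᵢ₊₁ ∧ xᵢ₊₂`, on three vectors. The arguments `w₁ w₂ w₃ x₁ x₂ x₃` are the components in `ℝ³`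
of these vectors with respect to the two halves `w` and `x` of a coframe. -/
def adaptedForm (c : ℝ) (B : Matrix (Fin 3) (Fin 3) ℝ) (w₁ w₂ w₃ x₁ x₂ x₃ : Fin 3 → ℝ) : ℝ :=
  c * det3 w₁ w₂ w₃ + pair3 B w₁ (cross3 x₂ x₃) + pair3 B w₂ (cross3 x₃ x₁)
    + pair3 B w₃ (cross3 x₁ x₂)

/-- Two triples of covectors `w` and `x` on a six-dimensional space without common zeros form a
coframe: they have a dual basis, which consists of two triples `p` and `q`. -/
theorem exists_dual_basis (w x : V6 →ₗ[ℝ] Fin 3 → ℝ) (h : ∀ u, w u = 0 → x u = 0 → u = 0) :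
    ∃ b : Module.Basis (Fin 6) ℝ V6, ∃ p q : Fin 3 → V6,
      (b : Fin 6 → V6) = ![p 0, p 1, p 2, q 0, q 1, q 2] ∧
      (∀ a, w (p a) = Pi.single a 1 ∧ x (p a) = 0) ∧
      (∀ a, w (q a) = 0 ∧ x (q a) = Pi.single a 1) := by
  have hC : Function.Injective (w.prod x) := by
    rw [← LinearMap.ker_eq_bot, LinearMap.ker_eq_bot']
    intro u hu
    exact h u (congrArg Prod.fst hu) (congrArg Prod.snd hu)
  let e : V6 ≃ₗ[ℝ] (Fin 3 → ℝ) × (Fin 3 → ℝ) :=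
    LinearEquiv.ofInjectiveOfFinrankEq (w.prod x) hC (by simp)
  have he : ∀ u, e u = (w u, x u) := fun u => rfl
  let b' := (((Pi.basisFun ℝ (Fin 3)).prod (Pi.basisFun ℝ (Fin 3))).map e.symm).reindex
    finSumFinEquiv
  refine ⟨b', fun a => e.symm (Pi.single a 1, 0), fun a => e.symm (0, Pi.single a 1), ?_, ?_, ?_⟩
  · funext k
    fin_cases k <;> simp [b', finSumFinEquiv, Fin.addCases]
  · intro a
    have := he (e.symm (Pi.single a 1, 0))
    rw [LinearEquiv.apply_symm_apply, Prod.ext_iff] at this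
    exact ⟨this.1.symm, this.2.symm⟩
  · intro a
    have := he (e.symm (0, Pi.single a 1))
    rw [LinearEquiv.apply_symm_apply, Prod.ext_iff] at this
    exact ⟨this.1.symm, this.2.symm⟩

/-- The ratio of two top degree forms may be computed in any basis. -/
theorem topRatio_eq (b : Module.Basis (Fin 6) ℝ V6) (θ v : V6 [⋀^Fin 6]→L[ℝ] ℝ) :
    topRatio θ v = θ b / v b := by
  have h : ∀ η : V6 [⋀^Fin 6]→L[ℝ] ℝ, η (EuclideanSpace.basisFun (Fin 6) ℝ) =
      η b * b.det (EuclideanSpace.basisFun (Fin 6) ℝ) := fun η => by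
    have := congrArg (fun f => f (EuclideanSpace.basisFun (Fin 6) ℝ))
      (η.toAlternatingMap.eq_smul_basis_det b)
    simpa using this
  have hd : b.det (EuclideanSpace.basisFun (Fin 6) ℝ) ≠ 0 := by
    have := (b.isUnit_det (EuclideanSpace.basisFun (Fin 6) ℝ).toBasis).ne_zero
    simpa using this
  rw [topRatio, h θ, h v, mul_div_mul_right _ _ hd]

section

variable {w x : V6 →ₗ[ℝ] Fin 3 → ℝ} {c : ℝ} {B : Matrix (Fin 3) (Fin 3) ℝ}
  {Ω : V6 [⋀^Fin 3]→L[ℝ] ℝ} {v : V6 [⋀^Fin 6]→L[ℝ] ℝ}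

theorem wedge_one_five_of_eq (α : V6 [⋀^Fin 1]→L[ℝ] ℝ) (η : V6 [⋀^Fin 5]→L[ℝ] ℝ)
    {t : Fin 6 → V6} {p q : Fin 3 → V6} (ht : t = ![p 0, p 1, p 2, q 0, q 1, q 2])
    {n₀ n₁ n₂ n₃ n₄ n₅ : ℝ}
    (h₀ : η ![p 1, p 2, q 0, q 1, q 2] = n₀) (h₁ : η ![p 0, p 2, q 0, q 1, q 2] = n₁)
    (h₂ : η ![p 0, p 1, q 0, q 1, q 2] = n₂) (h₃ : η ![p 0, p 1, p 2, q 1, q 2] = n₃)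
    (h₄ : η ![p 0, p 1, p 2, q 0, q 2] = n₄) (h₅ : η ![p 0, p 1, p 2, q 0, q 1] = n₅) :
    wedge α η t = α (fun _ => p 0) * n₀ - α (fun _ => p 1) * n₁ + α (fun _ => p 2) * n₂
      - α (fun _ => q 0) * n₃ + α (fun _ => q 1) * n₄ - α (fun _ => q 2) * n₅ := by
  subst ht h₀ h₁ h₂ h₃ h₄ h₅
  exact wedge_one_five α η _

/-- The five-forms `i_ξ Ω ∧ Ω`, evaluated on five of the six vectors of the dual basis. -/
theorem contraction_wedge_adapted
    (hΩ : ∀ t : Fin 3 → V6, Ω t =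
      adaptedForm c B (w (t 0)) (w (t 1)) (w (t 2)) (x (t 0)) (x (t 1)) (x (t 2)))
    (p q : Fin 3 → V6) (hp : ∀ a, w (p a) = Pi.single a 1 ∧ x (p a) = 0)
    (hq : ∀ a, w (q a) = 0 ∧ x (q a) = Pi.single a 1) (u : V6)
    (η : V6 [⋀^Fin 5]→L[ℝ] ℝ) (hη : η = wedge (Ω.curryLeft u) Ω) :
    η ![p 1, p 2, q 0, q 1, q 2] = -2 * (B.adjugateᵀ *ᵥ (x u)) 0 ∧
    η ![p 0, p 2, q 0, q 1, q 2] = 2 * (B.adjugateᵀ *ᵥ (x u)) 1 ∧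
    η ![p 0, p 1, q 0, q 1, q 2] = -2 * (B.adjugateᵀ *ᵥ (x u)) 2 ∧
    η ![p 0, p 1, p 2, q 1, q 2] = 2 * c * (Bᵀ *ᵥ (w u)) 0 ∧
    η ![p 0, p 1, p 2, q 0, q 2] = -2 * c * (Bᵀ *ᵥ (w u)) 1 ∧
    η ![p 0, p 1, p 2, q 0, q 1] = 2 * c * (Bᵀ *ᵥ (w u)) 2 := by
  have hΩ' : ∀ y z, Ω.curryLeft u ![y, z] = adaptedForm c B (w u) (w y) (w z) (x u) (x y) (x z) :=
    fun y z => hΩ ![u, y, z]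
  have hΩ'' : ∀ y z t, Ω ![y, z, t] = adaptedForm c B (w y) (w z) (w t) (x y) (x z) (x t) :=
    fun y z t => hΩ ![y, z, t]
  refine ⟨?_, ?_, ?_, ?_, ?_, ?_⟩
  all_goals
    refine (congrArg (fun θ : V6 [⋀^Fin 5]→L[ℝ] ℝ => θ _) hη).trans ?_
    refine (wedge_two_three _ _ _).trans ?_
    simp only [Matrix.cons_val, hΩ', hΩ'']
    simp only [(hp 0).1, (hp 0).2, (hp 1).1, (hp 1).2, (hp 2).1, (hp 2).2,
      (hq 0).1, (hq 0).2, (hq 1).1, (hq 1).2, (hq 2).1, (hq 2).2]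
    simp [adaptedForm, pair3, det3, cross3, Fin.sum_univ_three, Matrix.adjugate_fin_three,
      Matrix.mulVec, dotProduct, Pi.single_apply, Matrix.of_apply]
    ring

/-- Hitchin's endomorphism exchanges the two triples of the coframe: up to the volume, it is
`-2 (adj B)ᵀ` from the `x`-components to the `w`-components and `-2 c Bᵀ` back. -/
theorem hitchinK_mulVec_adapted (b : Module.Basis (Fin 6) ℝ V6)
    (hΩ : ∀ t : Fin 3 → V6, Ω t =
      adaptedForm c B (w (t 0)) (w (t 1)) (w (t 2)) (x (t 0)) (x (t 1)) (x (t 2)))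
    (p q : Fin 3 → V6) (hb : (b : Fin 6 → V6) = ![p 0, p 1, p 2, q 0, q 1, q 2])
    (hp : ∀ a, w (p a) = Pi.single a 1 ∧ x (p a) = 0)
    (hq : ∀ a, w (q a) = 0 ∧ x (q a) = Pi.single a 1) (u : V6) :
    w (WithLp.toLp 2 (hitchinK v Ω *ᵥ u)) = (-2 * (v b)⁻¹) • (B.adjugateᵀ *ᵥ (x u)) ∧
      x (WithLp.toLp 2 (hitchinK v Ω *ᵥ u)) = (-2 * c * (v b)⁻¹) • (Bᵀ *ᵥ (w u)) := by
  have hK : ∀ i j, hitchinK v Ω i j = (v b)⁻¹ *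
      (p 0 i * (-2 * (B.adjugateᵀ *ᵥ (x (EuclideanSpace.basisFun (Fin 6) ℝ j))) 0)
      + p 1 i * (-2 * (B.adjugateᵀ *ᵥ (x (EuclideanSpace.basisFun (Fin 6) ℝ j))) 1)
      + p 2 i * (-2 * (B.adjugateᵀ *ᵥ (x (EuclideanSpace.basisFun (Fin 6) ℝ j))) 2)
      + q 0 i * (-2 * c * (Bᵀ *ᵥ (w (EuclideanSpace.basisFun (Fin 6) ℝ j))) 0)
      + q 1 i * (-2 * c * (Bᵀ *ᵥ (w (EuclideanSpace.basisFun (Fin 6) ℝ j))) 1)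
      + q 2 i * (-2 * c * (Bᵀ *ᵥ (w (EuclideanSpace.basisFun (Fin 6) ℝ j))) 2)) := by
    intro i j
    rw [hitchinK, Matrix.of_apply]
    -- `i_ξ Ω ∧ Ω` is replaced by a variable, with its values on the dual basis as hypotheses
    have hs : ∀ y, stdCoform i (fun _ => y) = y i := fun y => rfl
    obtain ⟨η, hη⟩ : ∃ η : V6 [⋀^Fin 5]→L[ℝ] ℝ,
        η = wedge (Ω.curryLeft (EuclideanSpace.basisFun (Fin 6) ℝ j)) Ω := ⟨_, rfl⟩
    obtain ⟨h0, h1, h2, h3, h4, h5⟩ :=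
      contraction_wedge_adapted hΩ p q hp hq (EuclideanSpace.basisFun (Fin 6) ℝ j) η hη
    have h6 := wedge_one_five_of_eq (stdCoform i) η hb h0 h1 h2 h3 h4 h5
    refine Eq.trans (congrArg (fun θ => topRatio (wedge (stdCoform i) θ) v) hη.symm) ?_
    change topRatio (wedge (stdCoform i) η) v = _
    rw [topRatio_eq b, h6]
    simp only [hs]
    ring
  have hu : u = ∑ j, u j • EuclideanSpace.basisFun (Fin 6) ℝ j := by
    simpa using ((EuclideanSpace.basisFun (Fin 6) ℝ).sum_repr u).symm
  have hm : WithLp.toLp 2 (hitchinK v Ω *ᵥ u) = (v b)⁻¹ •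
      ((-2 * (B.adjugateᵀ *ᵥ (x u)) 0) • p 0 + (-2 * (B.adjugateᵀ *ᵥ (x u)) 1) • p 1
      + (-2 * (B.adjugateᵀ *ᵥ (x u)) 2) • p 2 + (-2 * c * (Bᵀ *ᵥ (w u)) 0) • q 0
      + (-2 * c * (Bᵀ *ᵥ (w u)) 1) • q 1 + (-2 * c * (Bᵀ *ᵥ (w u)) 2) • q 2) := by
    have e1 : ∀ k, (B.adjugateᵀ *ᵥ (x u)) k = ∑ j, u j *
        (B.adjugateᵀ *ᵥ (x (EuclideanSpace.basisFun (Fin 6) ℝ j))) k := fun k => by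
      conv_lhs => rw [hu, map_sum, Matrix.mulVec_sum]
      simp [Matrix.mulVec_smul]
    have e2 : ∀ k, (Bᵀ *ᵥ (w u)) k = ∑ j, u j *
        (Bᵀ *ᵥ (w (EuclideanSpace.basisFun (Fin 6) ℝ j))) k := fun k => by
      conv_lhs => rw [hu, map_sum, Matrix.mulVec_sum]
      simp [Matrix.mulVec_smul]
    ext i
    change ∑ j, hitchinK v Ω i j * u j = _
    simp only [PiLp.smul_apply, PiLp.add_apply, smul_eq_mul, e1, e2, Finset.mul_sum,
      Finset.sum_mul, ← Finset.sum_add_distrib]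
    refine Finset.sum_congr rfl fun j _ => ?_
    rw [hK]
    ring
  rw [hm]
  simp only [map_smul, map_add, (hp 0).1, (hp 0).2, (hp 1).1, (hp 1).2, (hp 2).1, (hp 2).2,
      (hq 0).1, (hq 0).2, (hq 1).1, (hq 1).2, (hq 2).1, (hq 2).2]
  constructor
  · ext k
    fin_cases k <;> simp <;> ring
  · ext k
    fin_cases k <;> simp <;> ring

theorem eq_zero_of_dual_basis (h : ∀ u, w u = 0 → x u = 0 → u = 0) {u u' : V6}
    (h1 : w u = w u') (h2 : x u = x u') : u = u' :=
  sub_eq_zero.1 (h _ (by rw [map_sub, h1, sub_self]) (by rw [map_sub, h2, sub_self]))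

/-- Since `B` times its adjugate is `det B`, the square of Hitchin's endomorphism is a scalar. -/
theorem hitchinK_mul_self_adapted (h : ∀ u, w u = 0 → x u = 0 → u = 0)
    (b : Module.Basis (Fin 6) ℝ V6)
    (hΩ : ∀ t : Fin 3 → V6, Ω t =
      adaptedForm c B (w (t 0)) (w (t 1)) (w (t 2)) (x (t 0)) (x (t 1)) (x (t 2)))
    (p q : Fin 3 → V6) (hb : (b : Fin 6 → V6) = ![p 0, p 1, p 2, q 0, q 1, q 2])
    (hp : ∀ a, w (p a) = Pi.single a 1 ∧ x (p a) = 0)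
    (hq : ∀ a, w (q a) = 0 ∧ x (q a) = Pi.single a 1) :
    hitchinK v Ω * hitchinK v Ω = (4 * c * B.det * (v b)⁻¹ ^ 2) • 1 := by
  have hK := hitchinK_mulVec_adapted (v := v) b hΩ p q hb hp hq
  apply Matrix.ext_of_mulVec_single
  intro j
  set u : V6 := WithLp.toLp 2 (Pi.single j 1) with hu
  have h1 := hK u
  have h2 := hK (WithLp.toLp 2 (hitchinK v Ω *ᵥ u))
  rw [h1.2, h1.1] at h2
  rw [← Matrix.mulVec_mulVec, Matrix.smul_mulVec, Matrix.one_mulVec]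
  have : WithLp.toLp 2 (hitchinK v Ω *ᵥ hitchinK v Ω *ᵥ u) = (4 * c * B.det * (v b)⁻¹ ^ 2) • u := by
    apply eq_zero_of_dual_basis h
    · refine h2.1.trans ?_
      rw [map_smul, Matrix.mulVec_smul, Matrix.mulVec_mulVec, ← Matrix.transpose_mul,
        Matrix.mul_adjugate, Matrix.transpose_smul, Matrix.transpose_one, Matrix.smul_mulVec,
        Matrix.one_mulVec, smul_smul, smul_smul]
      congr 1
      ring
    · refine h2.2.trans ?_
      rw [map_smul, Matrix.mulVec_smul, Matrix.mulVec_mulVec, ← Matrix.transpose_mul,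
        Matrix.adjugate_mul, Matrix.transpose_smul, Matrix.transpose_one, Matrix.smul_mulVec,
        Matrix.one_mulVec, smul_smul, smul_smul]
      congr 1
      ring
  exact congrArg WithLp.ofLp this

theorem hitchinLambda_adapted (h : ∀ u, w u = 0 → x u = 0 → u = 0)
    (b : Module.Basis (Fin 6) ℝ V6)
    (hΩ : ∀ t : Fin 3 → V6, Ω t =
      adaptedForm c B (w (t 0)) (w (t 1)) (w (t 2)) (x (t 0)) (x (t 1)) (x (t 2)))
    (p q : Fin 3 → V6) (hb : (b : Fin 6 → V6) = ![p 0, p 1, p 2, q 0, q 1, q 2])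
    (hp : ∀ a, w (p a) = Pi.single a 1 ∧ x (p a) = 0)
    (hq : ∀ a, w (q a) = 0 ∧ x (q a) = Pi.single a 1) :
    hitchinLambda v Ω = 4 * c * B.det * (v b)⁻¹ ^ 2 := by
  rw [hitchinLambda, hitchinK_mul_self_adapted h b hΩ p q hb hp hq, Matrix.trace_smul,
    Matrix.trace_one]
  simp
  ring

/-- The sign of Hitchin's invariant is that of the coefficient `c` times the determinant of `B`. -/
theorem mul_det_neg_of_hitchinLambda_neg (h : ∀ u, w u = 0 → x u = 0 → u = 0)
    (hΩ : ∀ t : Fin 3 → V6, Ω t =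
      adaptedForm c B (w (t 0)) (w (t 1)) (w (t 2)) (x (t 0)) (x (t 1)) (x (t 2)))
    (hneg : hitchinLambda v Ω < 0) : c * B.det < 0 := by
  obtain ⟨b, p, q, hb, hp, hq⟩ := exists_dual_basis w x h
  rw [hitchinLambda_adapted h b hΩ p q hb hp hq] at hneg
  by_contra hc
  push Not at hc
  have : 0 ≤ 4 * (c * B.det) * (v b)⁻¹ ^ 2 := by positivity
  linarith

/-- The value on the vectors `t` of the top degree form `w₀ ∧ w₁ ∧ w₂ ∧ x₀ ∧ x₁ ∧ x₂`. -/
noncomputable def coframeDet (w x : V6 → Fin 3 → ℝ) (t : Fin 6 → V6) : ℝ :=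
  Matrix.det (Matrix.of fun k j =>
    (![w (t j) 0, w (t j) 1, w (t j) 2, x (t j) 0, x (t j) 1, x (t j) 2] : Fin 6 → ℝ) k)

theorem coframeDet_eq_det (h : ∀ u, w u = 0 → x u = 0 → u = 0)
    (b : Module.Basis (Fin 6) ℝ V6)
    (p q : Fin 3 → V6) (hb : (b : Fin 6 → V6) = ![p 0, p 1, p 2, q 0, q 1, q 2])
    (hp : ∀ a, w (p a) = Pi.single a 1 ∧ x (p a) = 0)
    (hq : ∀ a, w (q a) = 0 ∧ x (q a) = Pi.single a 1) (t : Fin 6 → V6) :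
    coframeDet w x t = b.det t := by
  rw [coframeDet, Module.Basis.det_apply]
  congr 1
  ext k j
  rw [Module.Basis.toMatrix_apply, Matrix.of_apply]
  have hu : t j = ∑ k, (![w (t j) 0, w (t j) 1, w (t j) 2, x (t j) 0, x (t j) 1, x (t j) 2] :
      Fin 6 → ℝ) k • b k := by
    apply eq_zero_of_dual_basis h
    · simp only [hb, Fin.sum_univ_six, map_add, map_smul, Matrix.cons_val, hp, hq]
      ext a; fin_cases a <;> simp
    · simp only [hb, Fin.sum_univ_six, map_add, map_smul, Matrix.cons_val, hp, hq]
      ext a; fin_cases a <;> simp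
  conv_rhs => rw [hu]
  rw [Module.Basis.repr_sum_self]

/-- For `Ω = ½ Re ((w₀ + i x₀) ∧ (w₁ + i x₁) ∧ (w₂ + i x₂))`, the form `Ω̂` is, up to the sign that
compares the orientations, the corresponding imaginary part. -/
theorem hitchinHat_adapted (h : ∀ u, w u = 0 → x u = 0 → u = 0)
    (hΩ : ∀ t : Fin 3 → V6, Ω t = adaptedForm (1 / 2) (-(1 / 2 : ℝ) • 1)
      (w (t 0)) (w (t 1)) (w (t 2)) (x (t 0)) (x (t 1)) (x (t 2)))
    (hv : v ≠ 0) (e : Module.Basis (Fin 6) ℝ V6) (t : Fin 3 → V6) :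
    hitchinHat v Ω t = SignType.sign (v e * coframeDet w x e) *
      adaptedForm (1 / 2) (-(1 / 2 : ℝ) • 1)
        (x (t 0)) (x (t 1)) (x (t 2)) (w (t 0)) (w (t 1)) (w (t 2)) := by
  obtain ⟨b, p, q, hb, hp, hq⟩ := exists_dual_basis w x h
  have hvb : v b ≠ 0 := by
    have := (v.toAlternatingMap.map_basis_ne_zero_iff b).2
      (fun h0 => hv (ContinuousAlternatingMap.toAlternatingMap_injective h0))
    exact this
  have hs : SignType.sign (v e * coframeDet w x e) = SignType.sign (v b) := by
    have hd : b.det e ≠ 0 := (b.isUnit_det e).ne_zero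
    have : v e = v b * b.det e := by
      have := congrArg (fun f => f e) (v.toAlternatingMap.eq_smul_basis_det b)
      simpa using this
    rw [coframeDet_eq_det h b p q hb hp hq, this, mul_assoc, sign_mul,
      sign_pos (mul_self_pos.2 hd), mul_one]
  rw [hs]
  have hdet : (-(1 / 2 : ℝ) • (1 : Matrix (Fin 3) (Fin 3) ℝ)).det = -(1 / 8) := by
    rw [Matrix.det_smul]; norm_num
  have hadj : (-(1 / 2 : ℝ) • (1 : Matrix (Fin 3) (Fin 3) ℝ)).adjugate = (1 / 4 : ℝ) • 1 := by
    rw [Matrix.adjugate_smul, Matrix.adjugate_one]; norm_num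
  have hl := hitchinLambda_adapted (v := v) h b hΩ p q hb hp hq
  have hK := hitchinK_mulVec_adapted (v := v) b hΩ p q hb hp hq
  have hsq : √(-hitchinLambda v Ω) = 1 / 2 * |(v b)⁻¹| := by
    rw [hl, hdet, ← Real.sqrt_sq (show 0 ≤ 1 / 2 * |(v b)⁻¹| by positivity), mul_pow, sq_abs]
    congr 1
    ring
  have hsg : (√(-hitchinLambda v Ω))⁻¹ * (1 / 2 * (v b)⁻¹) = SignType.sign (v b) := by
    rw [hsq]
    rcases lt_or_gt_of_ne hvb with h0 | h0
    · rw [sign_neg h0, abs_of_neg (inv_neg''.2 h0)]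
      simp
      field_simp
    · rw [sign_pos h0, abs_of_pos (inv_pos.2 h0)]
      simp
      field_simp
  set s : ℝ := ((SignType.sign (v b) : SignType) : ℝ) with hs'
  have hs3 : s * s = 1 := by
    rcases lt_or_gt_of_ne hvb with h0 | h0
    · simp [hs', sign_neg h0]
    · simp [hs', sign_pos h0]
  -- up to the sign `s`, the almost complex structure is `p ↦ q`, `q ↦ -p`
  have hJ : ∀ u, w (Matrix.toEuclideanCLM (n := Fin 6) (𝕜 := ℝ) (hitchinJ v Ω) u) = -s • x u ∧
      x (Matrix.toEuclideanCLM (n := Fin 6) (𝕜 := ℝ) (hitchinJ v Ω) u) = s • w u := by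
    intro u
    have e1 : Matrix.toEuclideanCLM (n := Fin 6) (𝕜 := ℝ) (hitchinJ v Ω) u =
        (√(-hitchinLambda v Ω))⁻¹ • WithLp.toLp 2 (hitchinK v Ω *ᵥ u) := by
      rw [hitchinJ, map_smul]
      rfl
    rw [e1, map_smul, map_smul, (hK u).1, (hK u).2, ← hsg, hadj]
    simp only [Matrix.transpose_smul, Matrix.transpose_one, Matrix.smul_mulVec, Matrix.one_mulVec,
      smul_smul]
    constructor <;> congr 1 <;> ring
  have e2 : hitchinHat v Ω t = -Ω (fun i =>
      Matrix.toEuclideanCLM (n := Fin 6) (𝕜 := ℝ) (hitchinJ v Ω) (t i)) := rfl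
  rw [e2, hΩ]
  have e3 : ∀ w₁ w₂ w₃ x₁ x₂ x₃ : Fin 3 → ℝ,
      adaptedForm (1 / 2) (-(1 / 2 : ℝ) • 1) (-s • x₁) (-s • x₂) (-s • x₃)
        (s • w₁) (s • w₂) (s • w₃) =
      -(s * s * s) * adaptedForm (1 / 2) (-(1 / 2 : ℝ) • 1) x₁ x₂ x₃ w₁ w₂ w₃ := by
    intro w₁ w₂ w₃ x₁ x₂ x₃
    simp [adaptedForm, det3, pair3, cross3, Fin.sum_univ_three, Matrix.one_apply]
    ring
  simp only [hJ, e3, hs3]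
  ring

end

/-! ### The Lie algebra `su(2)` -/

instance Mat2.finiteDimensional : FiniteDimensional ℝ Mat2 :=
  inferInstanceAs (FiniteDimensional ℝ (Matrix (Fin 2) (Fin 2) ℂ))

theorem Mat2.toMatrix_mul (X Y : Mat2) : (X * Y).toMatrix = X.toMatrix * Y.toMatrix := rfl
theorem Mat2.toMatrix_add (X Y : Mat2) : (X + Y).toMatrix = X.toMatrix + Y.toMatrix := rfl
theorem Mat2.toMatrix_sub (X Y : Mat2) : (X - Y).toMatrix = X.toMatrix - Y.toMatrix := rfl
theorem Mat2.toMatrix_smul (c : ℝ) (X : Mat2) : (c • X).toMatrix = c • X.toMatrix := rfl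
theorem Mat2.toMatrix_one : (1 : Mat2).toMatrix = 1 := rfl

theorem Mat2.ext_iff' {X Y : Mat2} : X = Y ↔ ∀ i j, X.toMatrix i j = Y.toMatrix i j :=
  ⟨fun h _ _ => by rw [h], fun h => Matrix.ext h⟩

theorem reTrace_apply (X : Mat2) : reTrace X = (X.toMatrix 0 0).re + (X.toMatrix 1 1).re := by
  change X.toMatrix.trace.re = _
  rw [Matrix.trace_fin_two, Complex.add_re]

/-- The components of a matrix in `su(2)` with respect to the basis `-i σₐ / 2`, where the `σₐ` are
the Pauli matrices. The bracket of this basis is the cross product. -/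
noncomputable def su2Coord : Mat2 →L[ℝ] (Fin 3 → ℝ) :=
  LinearMap.toContinuousLinearMap
    { toFun := fun X => ![-2 * (X.toMatrix 0 1).im, -2 * (X.toMatrix 0 1).re,
        -2 * (X.toMatrix 0 0).im]
      map_add' := fun X Y => by
        ext i; fin_cases i <;> simp [Mat2.toMatrix_add] <;> ring
      map_smul' := fun c X => by
        ext i; fin_cases i <;> simp [Mat2.toMatrix_smul] <;> ring }

/-- The matrix in `su(2)` with given components with respect to the basis `-i σₐ / 2`. -/
noncomputable def su2Of : (Fin 3 → ℝ) →L[ℝ] Mat2 :=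
  LinearMap.toContinuousLinearMap
    { toFun := fun f => (!![⟨0, -f 2 / 2⟩, ⟨-f 1 / 2, -f 0 / 2⟩; ⟨f 1 / 2, -f 0 / 2⟩, ⟨0, f 2 / 2⟩] :
        Matrix (Fin 2) (Fin 2) ℂ)
      map_add' := fun f g => by
        apply Matrix.ext
        intro i j
        change _ = (_ : Matrix (Fin 2) (Fin 2) ℂ) i j + (_ : Matrix (Fin 2) (Fin 2) ℂ) i j
        fin_cases i <;> fin_cases j <;> simp [Complex.ext_iff] <;> (try constructor) <;> ring
      map_smul' := fun c f => by
        apply Matrix.ext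
        intro i j
        change _ = c • (_ : Matrix (Fin 2) (Fin 2) ℂ) i j
        fin_cases i <;> fin_cases j <;> simp [Complex.ext_iff] <;> (try constructor) <;> ring }

theorem su2Coord_apply (X : Mat2) : su2Coord X = ![-2 * (X.toMatrix 0 1).im,
    -2 * (X.toMatrix 0 1).re, -2 * (X.toMatrix 0 0).im] := rfl

theorem su2Of_toMatrix (f : Fin 3 → ℝ) : (su2Of f).toMatrix =
    !![⟨0, -f 2 / 2⟩, ⟨-f 1 / 2, -f 0 / 2⟩; ⟨f 1 / 2, -f 0 / 2⟩, ⟨0, f 2 / 2⟩] := rfl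

theorem su2Coord_su2Of (f : Fin 3 → ℝ) : su2Coord (su2Of f) = f := by
  rw [su2Coord_apply, su2Of_toMatrix]
  ext i
  fin_cases i <;> simp <;> ring

theorem isSu2_su2Of (f : Fin 3 → ℝ) : IsSu2 (su2Of f) := by
  constructor
  · rw [su2Of_toMatrix]
    ext i j
    fin_cases i <;> fin_cases j <;> simp [Complex.ext_iff] <;> ring
  · rw [su2Of_toMatrix, Matrix.trace_fin_two]
    simp [Complex.ext_iff]
    ring

theorem IsSu2.su2Of_su2Coord {X : Mat2} (h : IsSu2 X) : su2Of (su2Coord X) = X := by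
  rw [Mat2.ext_iff']
  obtain ⟨h1, h2⟩ := h
  have h00 := congrFun (congrFun h1 0) 0
  have h01 := congrFun (congrFun h1 0) 1
  rw [Matrix.trace_fin_two] at h2
  simp [Complex.ext_iff] at h00 h01 h2
  rw [su2Coord_apply, su2Of_toMatrix]
  intro i j
  fin_cases i <;> fin_cases j <;> simp [Complex.ext_iff] <;> (try constructor) <;> linarith

theorem isSu2_iff {X : Mat2} : IsSu2 X ↔ su2Of (su2Coord X) = X :=
  ⟨IsSu2.su2Of_su2Coord, fun h => h ▸ isSu2_su2Of _⟩

theorem IsSu2.exists_eq {X : Mat2} (h : IsSu2 X) : ∃ f, X = su2Of f := ⟨_, h.su2Of_su2Coord.symm⟩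

theorem IsSu2.eq_of_su2Coord {X Y : Mat2} (hX : IsSu2 X) (hY : IsSu2 Y)
    (h : su2Coord X = su2Coord Y) : X = Y := by
  rw [← hX.su2Of_su2Coord, ← hY.su2Of_su2Coord, h]

theorem IsSu2.add {X Y : Mat2} (hX : IsSu2 X) (hY : IsSu2 Y) : IsSu2 (X + Y) := by
  rw [isSu2_iff] at *; rw [map_add, map_add, hX, hY]

theorem IsSu2.sub {X Y : Mat2} (hX : IsSu2 X) (hY : IsSu2 Y) : IsSu2 (X - Y) := by
  rw [isSu2_iff] at *; rw [map_sub, map_sub, hX, hY]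

theorem isSu2_zero : IsSu2 0 := by
  rw [isSu2_iff, map_zero, map_zero]

/-- The bracket of `su(2)` is the cross product. -/
theorem su2Of_bracket (f g : Fin 3 → ℝ) :
    su2Of f * su2Of g - su2Of g * su2Of f = su2Of (cross3 f g) := by
  rw [Mat2.ext_iff']
  intro i j
  rw [Mat2.toMatrix_sub, Mat2.toMatrix_mul, Mat2.toMatrix_mul]
  simp only [su2Of_toMatrix, cross3]
  fin_cases i <;> fin_cases j <;> simp [Complex.ext_iff] <;> (try constructor) <;> ring

theorem reTrace_su2Of_mul (f g : Fin 3 → ℝ) :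
    reTrace (su2Of f * su2Of g) = -(1 / 2) * (f ⬝ᵥ g) := by
  rw [reTrace_apply, Mat2.toMatrix_mul]
  simp [su2Of_toMatrix, Matrix.mul_apply, dotProduct, Fin.sum_univ_three]
  ring

theorem IsSu2.bracket {X Y : Mat2} (hX : IsSu2 X) (hY : IsSu2 Y) : IsSu2 (X * Y - Y * X) := by
  obtain ⟨f, rfl⟩ := hX.exists_eq
  obtain ⟨g, rfl⟩ := hY.exists_eq
  rw [su2Of_bracket]
  exact isSu2_su2Of _

theorem IsSu2.su2Coord_bracket {X Y : Mat2} (hX : IsSu2 X) (hY : IsSu2 Y) :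
    su2Coord (X * Y - Y * X) = cross3 (su2Coord X) (su2Coord Y) := by
  obtain ⟨f, rfl⟩ := hX.exists_eq
  obtain ⟨g, rfl⟩ := hY.exists_eq
  rw [su2Of_bracket]
  simp only [su2Coord_su2Of]

theorem IsSu2.reTrace_mul {X Y : Mat2} (hX : IsSu2 X) (hY : IsSu2 Y) :
    reTrace (X * Y) = -(1 / 2) * (su2Coord X ⬝ᵥ su2Coord Y) := by
  obtain ⟨f, rfl⟩ := hX.exists_eq
  obtain ⟨g, rfl⟩ := hY.exists_eq
  rw [reTrace_su2Of_mul]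
  simp only [su2Coord_su2Of]

theorem reTrace_mul_comm (X Y : Mat2) : reTrace (X * Y) = reTrace (Y * X) := by
  change (X.toMatrix * Y.toMatrix).trace.re = (Y.toMatrix * X.toMatrix).trace.re
  rw [Matrix.trace_mul_comm]

theorem SU2.inv_mat_mul_mat (g : SU2) : SU2.mat g⁻¹ * SU2.mat g = 1 := by
  have : ((g⁻¹ * g : SU2) : Matrix (Fin 2) (Fin 2) ℂ) = 1 := by rw [inv_mul_cancel]; rfl
  exact this

theorem SU2.mat_mul_inv_mat (g : SU2) : SU2.mat g * SU2.mat g⁻¹ = 1 := by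
  have : ((g * g⁻¹ : SU2) : Matrix (Fin 2) (Fin 2) ℂ) = 1 := by rw [mul_inv_cancel]; rfl
  exact this

theorem SU2.mat_mul (g h : SU2) : SU2.mat (g * h) = SU2.mat g * SU2.mat h := rfl

theorem SU2.mat_one : SU2.mat 1 = 1 := rfl

theorem IsSu2.conj {X : Mat2} (hX : IsSu2 X) (g : SU2) :
    IsSu2 (SU2.mat g⁻¹ * X * SU2.mat g) := by
  have hg : (SU2.mat g⁻¹).toMatrix = (SU2.mat g).toMatrixᴴ := rfl
  have h1 := congrArg Mat2.toMatrix (SU2.mat_mul_inv_mat g)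
  rw [Mat2.toMatrix_mul, hg, Mat2.toMatrix_one] at h1
  constructor
  · rw [Mat2.toMatrix_mul, Mat2.toMatrix_mul, hg, Matrix.conjTranspose_mul,
      Matrix.conjTranspose_mul, Matrix.conjTranspose_conjTranspose, hX.1]
    simp [Matrix.mul_assoc]
  · rw [Mat2.toMatrix_mul, Mat2.toMatrix_mul, hg, Matrix.trace_mul_comm, ← Matrix.mul_assoc, h1,
      Matrix.one_mul, hX.2]

theorem conj_mul_conj (g : SU2) (X Y : Mat2) :
    (SU2.mat g⁻¹ * X * SU2.mat g) * (SU2.mat g⁻¹ * Y * SU2.mat g) =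
      SU2.mat g⁻¹ * (X * Y) * SU2.mat g := by
  calc _ = SU2.mat g⁻¹ * X * (SU2.mat g * SU2.mat g⁻¹) * Y * SU2.mat g := by noncomm_ring
    _ = _ := by rw [SU2.mat_mul_inv_mat]; noncomm_ring

theorem reTrace_conj (g : SU2) (X : Mat2) :
    reTrace (SU2.mat g⁻¹ * X * SU2.mat g) = reTrace X := by
  rw [reTrace_mul_comm, ← mul_assoc, SU2.mat_mul_inv_mat, one_mul]

section

variable {V : Type*} [AddCommGroup V] [Module ℝ V] [TopologicalSpace V]

/-- The trace of the cube of an `su(2)`-valued `1`-form is a multiple of the determinant of its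
components. -/
theorem reTrace_wedge_cube (E : V [⋀^Fin 1]→L[ℝ] Mat2) (hE : ∀ u, IsSu2 (E u)) (t : Fin 3 → V) :
    reTrace (wedge E (wedge E E) t) = -(3 / 2) * det3 (su2Coord (E fun _ => t 0))
      (su2Coord (E fun _ => t 1)) (su2Coord (E fun _ => t 2)) := by
  have h : wedge E (wedge E E) t = _ := wedge_one_two E (wedge E E) t
  have h2 : ∀ y z, (wedge E E : V [⋀^Fin 2]→L[ℝ] Mat2) ![y, z] = _ := fun y z =>
    wedge_one_one E E ![y, z]
  rw [h, h2, h2, h2]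
  simp only [Matrix.cons_val, map_add, map_sub]
  rw [IsSu2.reTrace_mul (hE _) ((hE _).bracket (hE _)),
    IsSu2.reTrace_mul (hE _) ((hE _).bracket (hE _)),
    IsSu2.reTrace_mul (hE _) ((hE _).bracket (hE _))]
  simp only [IsSu2.su2Coord_bracket (hE _) (hE _)]
  simp [dotProduct, Fin.sum_univ_three, det3, cross3]
  ring

/-- If the curvature `F = D + W ∧ W` is `C` applied to the cross product `x × x`, then the
Chern-Simons form `Tr (W ∧ D + ⅔ W³) = Tr (W ∧ F - ⅓ W³)` is of adapted type in the coframe given by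
the components of `W` and by `x`. -/
theorem reTrace_chernSimons (W : V [⋀^Fin 1]→L[ℝ] Mat2) (D : V [⋀^Fin 2]→L[ℝ] Mat2)
    (hW : ∀ u, IsSu2 (W u)) (hD : ∀ u, IsSu2 (D u)) (x : V → Fin 3 → ℝ)
    (C : Matrix (Fin 3) (Fin 3) ℝ)
    (hF : ∀ y z, su2Coord ((D + (wedge W W : V [⋀^Fin 2]→L[ℝ] Mat2)) ![y, z]) =
      C *ᵥ cross3 (x y) (x z)) (t : Fin 3 → V) :
    reTrace ((wedge W D + (2 / 3 : ℝ) • (wedge W (wedge W W)) : V [⋀^Fin 3]→L[ℝ] Mat2) t) =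
      adaptedForm (1 / 2) (-(1 / 2 : ℝ) • C)
        (su2Coord (W fun _ => t 0)) (su2Coord (W fun _ => t 1)) (su2Coord (W fun _ => t 2))
        (x (t 0)) (x (t 1)) (x (t 2)) := by
  have hF' : ∀ y z, su2Coord (D ![y, z]) = C *ᵥ cross3 (x y) (x z) -
      cross3 (su2Coord (W fun _ => y)) (su2Coord (W fun _ => z)) := by
    intro y z
    rw [← hF, ContinuousAlternatingMap.add_apply, wedge_one_one, map_add,
      IsSu2.su2Coord_bracket (hW _) (hW _)]
    simp
  have h : (wedge W D + (2 / 3 : ℝ) • (wedge W (wedge W W)) : V [⋀^Fin 3]→L[ℝ] Mat2) t =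
    wedge W D t + (2 / 3 : ℝ) • (wedge W (wedge W W) t) := rfl
  rw [h, map_add, map_smul, reTrace_wedge_cube W hW, wedge_one_two W D t, map_add, map_sub,
    IsSu2.reTrace_mul (hW _) (hD _), IsSu2.reTrace_mul (hW _) (hD _),
    IsSu2.reTrace_mul (hW _) (hD _), hF', hF', hF']
  simp [dotProduct, Fin.sum_univ_three, det3, cross3, adaptedForm, pair3, Matrix.mulVec]
  ring

end

/-! ### One-forms along maps -/

section Along

variable {n : ℕ} {X : Type*} [TopologicalSpace X] [ChartedSpace (EuclideanSpace ℝ (Fin n)) X]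
variable {m : ℕ} {Y : Type*} [TopologicalSpace Y] [ChartedSpace (EuclideanSpace ℝ (Fin m)) Y]
variable {l : ℕ} {Z : Type*} [TopologicalSpace Z] [ChartedSpace (EuclideanSpace ℝ (Fin l)) Z]
variable {F : Type*} [NormedAddCommGroup F] [NormedSpace ℝ F]

/-- The derivative of a map between manifolds, as a linear map between the model spaces (with which
the tangent spaces are definitionally identified). -/
noncomputable def tder (n m : ℕ) {X : Type*} [TopologicalSpace X]
    [ChartedSpace (EuclideanSpace ℝ (Fin n)) X] {Y : Type*} [TopologicalSpace Y]
    [ChartedSpace (EuclideanSpace ℝ (Fin m)) Y] (f : X → Y) (p : X) :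
    EuclideanSpace ℝ (Fin n) →L[ℝ] EuclideanSpace ℝ (Fin m) :=
  mfderiv (𝓡 n) (𝓡 m) f p

theorem tder_comp {g : Y → Z} {f : X → Y} {p : X} (hg : MDifferentiableAt (𝓡 m) (𝓡 l) g (f p))
    (hf : MDifferentiableAt (𝓡 n) (𝓡 m) f p) :
    tder n l (fun x => g (f x)) p = (tder m l g (f p)).comp (tder n m f p) :=
  mfderiv_comp p hg hf

theorem tder_congr {f g : X → Y} {p : X} (h : f =ᶠ[𝓝 p] g) : tder n m f p = tder n m g p :=
  h.mfderiv_eq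

theorem tder_eq_fderiv (f : EuclideanSpace ℝ (Fin n) → EuclideanSpace ℝ (Fin m))
    (y : EuclideanSpace ℝ (Fin n)) : tder n m f y = fderiv ℝ f y :=
  mfderiv_eq_fderiv

theorem tder_id (p : X) : tder n n (fun x : X => x) p = ContinuousLinearMap.id ℝ _ :=
  mfderiv_id

/-- Linear maps as alternating maps in one variable. -/
noncomputable abbrev oneFormEquiv (n : ℕ) (F : Type*) [NormedAddCommGroup F] [NormedSpace ℝ F] :
    (EuclideanSpace ℝ (Fin n) →L[ℝ] F) ≃ₗᵢ[ℝ] EuclideanSpace ℝ (Fin n) [⋀^Fin 1]→L[ℝ] F :=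
  ContinuousAlternatingMap.ofSubsingletonLIE (0 : Fin 1)

/-- A `1`-form at a point, as a linear map. -/
noncomputable def DForm.val (a : DForm n X 1 F) (p : X) : EuclideanSpace ℝ (Fin n) →L[ℝ] F :=
  (oneFormEquiv n F).symm (a p)

/-- The pullback of a `1`-form by a map from a coordinate space. -/
noncomputable def DForm.along (a : DForm n X 1 F) (f : EuclideanSpace ℝ (Fin m) → X)
    (y : EuclideanSpace ℝ (Fin m)) : EuclideanSpace ℝ (Fin m) →L[ℝ] F :=
  (a.val (f y)).comp (tder m n f y)

theorem DForm.along_congr (a : DForm n X 1 F) {f g : EuclideanSpace ℝ (Fin m) → X}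
    {y : EuclideanSpace ℝ (Fin m)} (h : f =ᶠ[𝓝 y] g) : a.along f y = a.along g y := by
  rw [DForm.along, DForm.along, h.self_of_nhds, tder_congr h]

theorem DForm.along_comp (a : DForm n X 1 F) {f : EuclideanSpace ℝ (Fin m) → X}
    {k : EuclideanSpace ℝ (Fin l) → EuclideanSpace ℝ (Fin m)} {y : EuclideanSpace ℝ (Fin l)}
    (hf : MDifferentiableAt (𝓡 m) (𝓡 n) f (k y)) (hk : DifferentiableAt ℝ k y) :
    a.along (fun z => f (k z)) y = (a.along f (k y)).comp (fderiv ℝ k y) := by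
  rw [DForm.along, tder_comp hf hk.mdifferentiableAt, tder_eq_fderiv]
  rfl

theorem DForm.inChart_val (a : DForm n X 1 F) (p : X) (y : EuclideanSpace ℝ (Fin n)) :
    (oneFormEquiv n F).symm
      (a.inChart p y) = a.along (extChartAt (𝓡 n) p).symm y := rfl

variable [IsManifold (𝓡 n) ∞ X]

theorem mdifferentiableAt_extChartAt_symm' {p : X} {y : EuclideanSpace ℝ (Fin n)}
    (hy : y ∈ (extChartAt (𝓡 n) p).target) :
    MDifferentiableAt (𝓡 n) (𝓡 n) (extChartAt (𝓡 n) p).symm y := by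
  have : IsManifold (𝓡 n) 1 X := IsManifold.of_le (n := ∞) (by norm_cast)
  have := mdifferentiableWithinAt_extChartAt_symm (I := 𝓡 n) hy
  simpa [mdifferentiableWithinAt_univ] using this

theorem contMDiffAt_extChartAt_symm' {p : X} {y : EuclideanSpace ℝ (Fin n)}
    (hy : y ∈ (extChartAt (𝓡 n) p).target) :
    ContMDiffAt (𝓡 n) (𝓡 n) ∞ (extChartAt (𝓡 n) p).symm y :=
  (contMDiffOn_extChartAt_symm p).contMDiffAt (extChartAt_target_mem_nhds' hy)

theorem tder_extChartAt_comp_symm {p : X} {y : EuclideanSpace ℝ (Fin n)}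
    (hy : y ∈ (extChartAt (𝓡 n) p).target) :
    (tder n n (extChartAt (𝓡 n) p) ((extChartAt (𝓡 n) p).symm y)).comp
      (tder n n (extChartAt (𝓡 n) p).symm y) = ContinuousLinearMap.id ℝ _ := by
  have : IsManifold (𝓡 n) 1 X := IsManifold.of_le (n := ∞) (by norm_cast)
  have := mfderiv_extChartAt_comp_mfderivWithin_extChartAt_symm (I := 𝓡 n) hy
  simp only [ModelWithCorners.range_eq_univ, mfderivWithin_univ] at this
  exact this

theorem tder_symm_comp_extChartAt {p : X} {y : EuclideanSpace ℝ (Fin n)}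
    (hy : y ∈ (extChartAt (𝓡 n) p).target) :
    (tder n n (extChartAt (𝓡 n) p).symm y).comp
      (tder n n (extChartAt (𝓡 n) p) ((extChartAt (𝓡 n) p).symm y)) = ContinuousLinearMap.id ℝ _ := by
  have : IsManifold (𝓡 n) 1 X := IsManifold.of_le (n := ∞) (by norm_cast)
  have := mfderivWithin_extChartAt_symm_comp_mfderiv_extChartAt (I := 𝓡 n) hy
  simp only [ModelWithCorners.range_eq_univ, mfderivWithin_univ] at this
  exact this

theorem tder_extChartAt_self (p : X) :
    tder n n (extChartAt (𝓡 n) p) p = ContinuousLinearMap.id ℝ _ := by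
  have : IsManifold (𝓡 n) 1 X := IsManifold.of_le (n := ∞) (by norm_cast)
  exact mfderiv_extChartAt_self

theorem tder_extChartAt_symm_self (p : X) :
    tder n n (extChartAt (𝓡 n) p).symm (extChartAt (𝓡 n) p p) = ContinuousLinearMap.id ℝ _ := by
  have : IsManifold (𝓡 n) 1 X := IsManifold.of_le (n := ∞) (by norm_cast)
  have := mfderivWithin_range_extChartAt_symm (I := 𝓡 n) (x := p)
  simp only [ModelWithCorners.range_eq_univ, mfderivWithin_univ] at this
  exact this

theorem DForm.along_symm_self (a : DForm n X 1 F) (p : X) :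
    a.along (extChartAt (𝓡 n) p).symm (extChartAt (𝓡 n) p p) = a.val p := by
  rw [DForm.along, tder_extChartAt_symm_self, extChartAt_to_inv]
  rfl

theorem mdifferentiableAt_extChartAt' {p q : X} (hq : q ∈ (extChartAt (𝓡 n) p).source) :
    MDifferentiableAt (𝓡 n) (𝓡 n) (extChartAt (𝓡 n) p) q := by
  have : IsManifold (𝓡 n) 1 X := IsManifold.of_le (n := ∞) (by norm_cast)
  exact mdifferentiableAt_extChartAt (by simpa using hq)

theorem contMDiffAt_extChartAt'' {p q : X} (hq : q ∈ (extChartAt (𝓡 n) p).source) :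
    ContMDiffAt (𝓡 n) (𝓡 n) ∞ (extChartAt (𝓡 n) p) q :=
  contMDiffAt_extChartAt' (by simpa using hq)

/-- The pullback of a smooth `1`-form by a smooth map is smooth. -/
theorem DForm.IsSmooth.along {a : DForm n X 1 F} (ha : a.IsSmooth)
    {f : EuclideanSpace ℝ (Fin m) → X} {y : EuclideanSpace ℝ (Fin m)}
    (hf : ContMDiffAt (𝓡 m) (𝓡 n) ∞ f y) : ContDiffAt ℝ ∞ (a.along f) y := by
  set φ := extChartAt (𝓡 n) (f y) with hφ
  have hsrc : ∀ᶠ z in 𝓝 y, f z ∈ φ.source :=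
    hf.continuousAt (extChartAt_source_mem_nhds (f y))
  have hdf : ∀ᶠ z in 𝓝 y, MDifferentiableAt (𝓡 m) (𝓡 n) f z := by
    have := (contMDiffAt_iff_contMDiffAt_nhds (n := 1) (by simp)).1 (hf.of_le (by norm_cast))
    filter_upwards [this] with z hz
    exact hz.mdifferentiableAt (by simp)
  have hφf : ContDiffAt ℝ ∞ (fun z => φ (f z)) y := by
    rw [← contMDiffAt_iff_contDiffAt]
    exact (contMDiffAt_extChartAt (I := 𝓡 n) (x := f y)).comp y hf
  have key : a.along f =ᶠ[𝓝 y] fun z =>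
      (a.along φ.symm (φ (f z))).comp (fderiv ℝ (fun z => φ (f z)) z) := by
    filter_upwards [hsrc, hdf] with z hz hdz
    have h1 : MDifferentiableAt (𝓡 n) (𝓡 n) φ (f z) := mdifferentiableAt_extChartAt' hz
    have ht : φ (f z) ∈ φ.target := φ.map_source hz
    rw [← tder_eq_fderiv, tder_comp h1 hdz, DForm.along, DForm.along, φ.left_inv hz]
    have h2 := tder_symm_comp_extChartAt (p := f y) ht
    rw [← hφ, φ.left_inv hz] at h2
    rw [ContinuousLinearMap.comp_assoc, ← ContinuousLinearMap.comp_assoc (tder n n φ.symm (φ (f z))),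
      h2]
    rfl
  refine ContDiffAt.congr_of_eventuallyEq ?_ key
  have h3 : ContDiffAt ℝ ∞ (a.along φ.symm) (φ (f y)) := by
    have h4 := (ha (f y)).contDiffAt (extChartAt_target_mem_nhds (I := 𝓡 n) (f y))
    exact (oneFormEquiv n F).symm.contDiff.contDiffAt.comp _ h4
  exact (h3.comp y hφf).clm_comp (hφf.fderiv_right (by simp))

/-- The exterior derivative of a `1`-form. -/
theorem DForm.d_apply (a : DForm n X 1 F) (ha : a.IsSmooth) (p : X)
    (u v : EuclideanSpace ℝ (Fin n)) :
    (a.d p : EuclideanSpace ℝ (Fin n) [⋀^Fin 2]→L[ℝ] F) ![u, v] =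
      fderiv ℝ (a.along (extChartAt (𝓡 n) p).symm) (extChartAt (𝓡 n) p p) u v -
      fderiv ℝ (a.along (extChartAt (𝓡 n) p).symm) (extChartAt (𝓡 n) p p) v u := by
  set y := extChartAt (𝓡 n) p p
  have hd : DifferentiableAt ℝ (a.inChart p) y :=
    ((ha p).contDiffAt (extChartAt_target_mem_nhds (I := 𝓡 n) p)).differentiableAt (by simp)
  have hd' : DifferentiableAt ℝ (a.along (extChartAt (𝓡 n) p).symm) y :=
    (oneFormEquiv n F).symm.differentiableAt.comp y hd
  have h1 : (a.d p : EuclideanSpace ℝ (Fin n) [⋀^Fin 2]→L[ℝ] F) ![u, v] =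
      extDeriv (a.inChart p) y (fun i => tder n n (extChartAt (𝓡 n) p) p (![u, v] i)) := rfl
  rw [h1, tder_extChartAt_self, extDeriv_apply hd]
  have h2 : ∀ w : Fin 1 → EuclideanSpace ℝ (Fin n), (fun z => a.inChart p z w) =
      fun z => a.along (extChartAt (𝓡 n) p).symm z (w 0) := by
    intro w
    funext z
    rw [← DForm.inChart_val]
    change _ = a.inChart p z (fun _ => w 0)
    congr 1
    funext i
    rw [Subsingleton.elim i 0]
  have h3 : ∀ w x, fderiv ℝ (fun z => a.along (extChartAt (𝓡 n) p).symm z w) y x =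
      fderiv ℝ (a.along (extChartAt (𝓡 n) p).symm) y x w := by
    intro w x
    rw [fderiv_clm_apply hd' (differentiableAt_const w)]
    simp
  simp only [h2, h3]
  simp [Fin.sum_univ_succ, Fin.removeNth, sub_eq_add_neg]

end Along

/-! ### Curves in the bundle -/

/-- The coordinates on `Mat2` that restrict to the inverse of `su2OfSphere` on `SU(2)`. -/
noncomputable def sphereCoord : Mat2 →L[ℝ] EuclideanSpace ℝ (Fin (3 + 1)) :=
  LinearMap.toContinuousLinearMap
    { toFun := fun X => WithLp.toLp 2 ![(X.toMatrix 0 0).re, (X.toMatrix 0 1).im,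
        (X.toMatrix 0 1).re, (X.toMatrix 0 0).im]
      map_add' := fun X Y => by
        ext i; fin_cases i <;> simp [Mat2.toMatrix_add]
      map_smul' := fun c X => by
        ext i; fin_cases i <;> simp [Mat2.toMatrix_smul] }

theorem sphereCoord_apply (X : Mat2) : sphereCoord X =
    WithLp.toLp 2 ![(X.toMatrix 0 0).re, (X.toMatrix 0 1).im,
        (X.toMatrix 0 1).re, (X.toMatrix 0 0).im] := rfl

theorem SU2.adjugate_eq (g : SU2) : (g : Matrix (Fin 2) (Fin 2) ℂ).adjugate = star g.1 := by
  have h1 := Matrix.mem_specialUnitaryGroup_iff.1 g.2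
  have h2 := Matrix.mem_unitaryGroup_iff.1 h1.1
  have h3 := Matrix.adjugate_mul (g : Matrix (Fin 2) (Fin 2) ℂ)
  rw [h1.2, one_smul] at h3
  calc _ = (g : Matrix (Fin 2) (Fin 2) ℂ).adjugate * (g.1 * star g.1) := by rw [h2, mul_one]
    _ = _ := by rw [← mul_assoc, h3, one_mul]

theorem norm_sphereCoord (g : SU2) : ‖sphereCoord (SU2.mat g)‖ = 1 := by
  have h1 := Matrix.mem_specialUnitaryGroup_iff.1 g.2
  have h2 := congrFun (congrFun (Matrix.mem_unitaryGroup_iff.1 h1.1) 0) 0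
  rw [EuclideanSpace.norm_eq, Real.sqrt_eq_one, Fin.sum_univ_four, sphereCoord_apply]
  simp [Matrix.mul_apply, Matrix.star_apply, Complex.ext_iff, Fin.sum_univ_two] at h2
  simp [SU2.mat, Mat2.toMatrix]
  linarith [h2.1]

/-- The inverse of `su2OfSphere`. -/
noncomputable def sphereOfSU2 (g : SU2) : Metric.sphere (0 : EuclideanSpace ℝ (Fin (3 + 1))) 1 :=
  ⟨sphereCoord (SU2.mat g), by simp [norm_sphereCoord]⟩

theorem su2OfSphere_sphereOfSU2 (g : SU2) : su2OfSphere (sphereOfSU2 g) = g := by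
  have h := SU2.adjugate_eq g
  rw [Matrix.adjugate_fin_two] at h
  have h00 := congrFun (congrFun h 0) 0
  have h01 := congrFun (congrFun h 0) 1
  simp [Matrix.star_apply] at h00 h01
  have e : (sphereOfSU2 g).1 = WithLp.toLp 2 ![(g.1 0 0).re, (g.1 0 1).im,
        (g.1 0 1).re, (g.1 0 0).im] := rfl
  apply Subtype.ext
  apply Matrix.ext
  intro i j
  simp [Complex.ext_iff] at h01
  simp only [su2OfSphere, e]
  fin_cases i <;> fin_cases j <;> simp [Complex.ext_iff, h00, h01]

section Bundle

variable {M : Type*} [TopologicalSpace M] [ChartedSpace (EuclideanSpace ℝ (Fin 3)) M]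
variable {P : Type*} [TopologicalSpace P] [ChartedSpace (EuclideanSpace ℝ (Fin 6)) P]
variable [MulAction SU2ᵐᵒᵖ P]

omit [TopologicalSpace P] [ChartedSpace (EuclideanSpace ℝ (Fin 6)) P] in
theorem ract_ract (g g' : SU2) (p : P) : ract g' (ract g p) = ract (g * g') p := by
  simp only [ract, smul_smul, MulOpposite.op_mul]

omit [TopologicalSpace P] [ChartedSpace (EuclideanSpace ℝ (Fin 6)) P] in
theorem ract_one (p : P) : ract 1 p = p := by
  simp [ract]

/-- A local trivialization of the bundle, given by a section `s` over `U` and the fibre coordinate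
`h` with respect to it, so that `p = s (π p) h(p)`. -/
structure IsLocalTriv (π : P → M) (U : Set M) (s : M → P) (h : P → SU2) : Prop where
  isOpen : IsOpen U
  smooth_s : ContMDiffOn (𝓡 3) (𝓡 6) ∞ s U
  smooth_h : ContMDiffOn (𝓡 6) 𝓘(ℝ, Mat2) ∞ (fun p => SU2.mat (h p)) (π ⁻¹' U)
  proj_s : ∀ y ∈ U, π (s y) = y
  act : ∀ p ∈ π ⁻¹' U, ract (h p) (s (π p)) = p
  h_act : ∀ y ∈ U, ∀ g : SU2, h (ract g (s y)) = g

theorem IsPrincipalSU2Bundle.exists_localTriv {π : P → M} (hπ : IsPrincipalSU2Bundle π) (x : M) :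
    ∃ U s h, x ∈ U ∧ IsLocalTriv π U s h := by
  obtain ⟨U, hU, hx, s, h, h1, h2, h3, h4, h5⟩ := hπ.locally_trivial x
  exact ⟨U, s, h, hx, ⟨hU, h1, h2, h3, h4, h5⟩⟩

/-- The velocity of a curve. -/
noncomputable def velocity (γ : ℝ → P) (t : ℝ) : V6 :=
  mfderiv 𝓘(ℝ, ℝ) (𝓡 6) γ t (1 : ℝ)

variable {π : P → M} {U : Set M} {s : M → P} {h : P → SU2}

theorem IsLocalTriv.contDiff_mat (hπ : IsPrincipalSU2Bundle π)
    (hT : IsLocalTriv π U s h) (γ : ℝ → P)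
    (hγ : ContMDiff 𝓘(ℝ, ℝ) (𝓡 6) ∞ γ) (hU : ∀ t, π (γ t) ∈ U) :
    ContDiff ℝ ∞ (fun t => SU2.mat (h (γ t))) := by
  rw [← contMDiff_iff_contDiff]
  intro t
  have h1 : ContMDiffAt (𝓡 6) 𝓘(ℝ, Mat2) ∞ (fun p => SU2.mat (h p)) (γ t) :=
    hT.smooth_h.contMDiffAt ((hT.isOpen.preimage hπ.smooth_proj.continuous).mem_nhds (hU t))
  exact h1.comp t (hγ t)

/-- The velocity of a curve `γ` in the bundle is the sum of the translate of the velocity of its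
projection to a local section and of the velocity of a curve in the fibre through `γ 0`. The latter
vanishes if the fibre coordinate of `γ` is stationary. The action is only known to be smooth as a
map on `P × S³`, so the fibre coordinate is regarded as a curve in the sphere. -/
theorem IsPrincipalSU2Bundle.velocity_eq (hπ : IsPrincipalSU2Bundle π)
    (hT : IsLocalTriv π U s h) (γ : ℝ → P)
    (hγ : ContMDiff 𝓘(ℝ, ℝ) (𝓡 6) ∞ γ) (hU : ∀ t, π (γ t) ∈ U) :
    velocity γ 0 = tder 6 6 (ract (h (γ 0))) (s (π (γ 0))) (velocity (fun t => s (π (γ t))) 0) +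
      velocity (fun t => ract (h (γ t)) (s (π (γ 0)))) 0 ∧
    (deriv (fun t => SU2.mat (h (γ t))) 0 = 0 →
      velocity (fun t => ract (h (γ t)) (s (π (γ 0)))) 0 = 0) ∧
    MDifferentiableAt 𝓘(ℝ, ℝ) (𝓡 6) (fun t => ract (h (γ t)) (s (π (γ 0)))) 0 := by
  have hh := hT.contDiff_mat hπ γ hγ hU
  have hd : ContMDiff 𝓘(ℝ, ℝ) (𝓡 6) ∞ (fun t => s (π (γ t))) := by
    intro t
    have h1 : ContMDiffAt (𝓡 3) (𝓡 6) ∞ s (π (γ t)) :=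
      hT.smooth_s.contMDiffAt (hT.isOpen.mem_nhds (hU t))
    exact h1.comp t ((hπ.smooth_proj (γ t)).comp t (hγ t))
  have hsc : ContDiff ℝ ∞ (fun t => sphereCoord (SU2.mat (h (γ t)))) :=
    sphereCoord.contDiff.comp hh
  have hb : ContMDiff 𝓘(ℝ, ℝ) (𝓡 3) ∞ (fun t => sphereOfSU2 (h (γ t))) := by
    have : Fact (Module.finrank ℝ (EuclideanSpace ℝ (Fin (3 + 1))) = 3 + 1) := ⟨by simp⟩
    exact ContMDiff.codRestrict_sphere hsc.contMDiff _
  set Φ : P × Metric.sphere (0 : EuclideanSpace ℝ (Fin (3 + 1))) 1 → P :=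
    fun q => ract (su2OfSphere q.2) q.1 with hΦ
  have hΦd : ∀ q, MDifferentiableAt ((𝓡 6).prod (𝓡 3)) (𝓡 6) Φ q := fun q =>
    (hπ.smooth_act q).mdifferentiableAt (by simp)
  have hdd := (hd 0).mdifferentiableAt (by simp : (∞ : WithTop ℕ∞) ≠ 0)
  have hbd := (hb 0).mdifferentiableAt (by simp : (∞ : WithTop ℕ∞) ≠ 0)
  set d : ℝ → P := fun t => s (π (γ t)) with hd_def
  set b : ℝ → Metric.sphere (0 : EuclideanSpace ℝ (Fin (3 + 1))) 1 :=
    fun t => sphereOfSU2 (h (γ t)) with hb_def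
  have hΦγ : γ = fun t => Φ (d t, b t) := by
    funext t
    simp only [hΦ, hd_def, hb_def, su2OfSphere_sphereOfSU2]
    exact (hT.act (γ t) (hU t)).symm
  have hΦb : (fun t => ract (h (γ t)) (s (π (γ 0)))) = fun t => Φ (d 0, b t) := by
    funext t
    simp only [hΦ, hd_def, hb_def, su2OfSphere_sphereOfSU2]
  have hΦd' : (fun z => Φ (z, b 0)) = ract (h (γ 0)) := by
    funext z
    simp only [hΦ, hb_def, su2OfSphere_sphereOfSU2]
  have h2 : MDifferentiableAt (𝓡 3) (𝓡 6) (fun z => Φ (d 0, z)) (b 0) :=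
    (hΦd (d 0, b 0)).comp (b 0) (mdifferentiableAt_const.prodMk mdifferentiableAt_id)
  have h1 : MDifferentiableAt (𝓡 6) (𝓡 6) (fun z => Φ (z, b 0)) (d 0) :=
    (hΦd (d 0, b 0)).comp (d 0) (mdifferentiableAt_id.prodMk mdifferentiableAt_const)
  have hv2 : velocity (fun t => Φ (d 0, b t)) 0 =
      mfderiv (𝓡 3) (𝓡 6) (fun z => Φ (d 0, z)) (b 0) (mfderiv 𝓘(ℝ, ℝ) (𝓡 3) b 0 (1 : ℝ)) := by
    have := mfderiv_comp (0 : ℝ) h2 hbd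
    exact congrArg (fun L => L (1 : ℝ)) this
  refine ⟨?_, ?_, ?_⟩
  · rw [hΦb, hv2]
    conv_lhs => rw [hΦγ]
    have hp := hdd.prodMk hbd
    have e1 := mfderiv_comp (0 : ℝ) (hΦd (d 0, b 0)) hp
    have e2 : velocity (fun t => Φ (d t, b t)) 0 = mfderiv ((𝓡 6).prod (𝓡 3)) (𝓡 6) Φ (d 0, b 0)
        (mfderiv 𝓘(ℝ, ℝ) ((𝓡 6).prod (𝓡 3)) (fun t => (d t, b t)) 0 (1 : ℝ)) :=
      congrArg (fun L => L (1 : ℝ)) e1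
    rw [e2, mfderiv_prodMk hdd hbd]
    refine (mfderiv_prod_eq_add_apply (hΦd (d 0, b 0))).trans ?_
    rw [hΦd']
    rfl
  · intro h0
    rw [hΦb, hv2]
    have hfact : Fact (Module.finrank ℝ (EuclideanSpace ℝ (Fin (3 + 1))) = 3 + 1) := ⟨by simp⟩
    -- the inclusion of the sphere is an immersion
    have hinj : Function.Injective (mfderiv (𝓡 3) 𝓘(ℝ, EuclideanSpace ℝ (Fin (3 + 1)))
        (Subtype.val : Metric.sphere (0 : EuclideanSpace ℝ (Fin (3 + 1))) 1 →
          EuclideanSpace ℝ (Fin (3 + 1))) (b 0)) := by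
      convert! injective_mvfderiv_subtypeVal_sphere (b 0)
    have hb0 : mfderiv 𝓘(ℝ, ℝ) (𝓡 3) b 0 (1 : ℝ) = 0 := by
      apply hinj
      rw [map_zero]
      have e1 := mfderiv_comp (0 : ℝ) (((contMDiff_coe_sphere (m := 1) (n := 3) (b 0)).mdifferentiableAt
        one_ne_zero) : MDifferentiableAt (𝓡 3) 𝓘(ℝ, EuclideanSpace ℝ (Fin (3 + 1))) _ (b 0)) hbd
      have e2 := congrArg (fun L => L (1 : ℝ)) e1
      refine e2.symm.trans ?_
      change mfderiv 𝓘(ℝ, ℝ) 𝓘(ℝ, EuclideanSpace ℝ (Fin (3 + 1)))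
        (fun t => sphereCoord (SU2.mat (h (γ t)))) 0 (1 : ℝ) = 0
      rw [mfderiv_eq_fderiv]
      have e3 := (sphereCoord.hasFDerivAt.comp_hasDerivAt (0 : ℝ)
        ((hh.differentiable (by simp)) 0).hasDerivAt).hasFDerivAt.fderiv
      rw [h0, map_zero] at e3
      have e4 : fderiv ℝ (fun t => sphereCoord (SU2.mat (h (γ t)))) 0 = _ := e3
      rw [e4]
      exact smul_zero (1 : ℝ)
    rw [hb0, map_zero]
    rfl
  · rw [hΦb]
    exact h2.comp (0 : ℝ) hbd

theorem IsEquivariantSu2Form.val_ract {E : DForm 6 P 1 Mat2} (hE : IsEquivariantSu2Form E)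
    (g : SU2) (p : P) (u : V6) :
    E.val (ract g p) (tder 6 6 (ract g) p u) = SU2.mat g⁻¹ * E.val p u * SU2.mat g :=
  hE.equivariant g p u

/-- In a local trivialization, a connection is the sum of the conjugate of its pullback by the
section and of the logarithmic derivative of the fibre coordinate. -/
theorem IsConnectionForm.val_velocity (hπ : IsPrincipalSU2Bundle π)
    (hT : IsLocalTriv π U s h) {W : DForm 6 P 1 Mat2} (hW : IsConnectionForm W) (γ : ℝ → P)
    (hγ : ContMDiff 𝓘(ℝ, ℝ) (𝓡 6) ∞ γ) (hU : ∀ t, π (γ t) ∈ U) :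
    W.val (γ 0) (velocity γ 0) = SU2.mat (h (γ 0))⁻¹ *
      W.val (s (π (γ 0))) (velocity (fun t => s (π (γ t))) 0) * SU2.mat (h (γ 0)) +
      SU2.mat (h (γ 0))⁻¹ * deriv (fun t => SU2.mat (h (γ t))) 0 := by
  have hh := hT.contDiff_mat hπ γ hγ hU
  have h0 : ract (h (γ 0)) (s (π (γ 0))) = γ 0 := hT.act (γ 0) (hU 0)
  rw [(hπ.velocity_eq hT γ hγ hU).1, map_add]
  congr 1
  · have := hW.toIsEquivariantSu2Form.val_ract (h (γ 0)) (s (π (γ 0)))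
      (velocity (fun t => s (π (γ t))) 0)
    rwa [h0] at this
  -- the vertical part is the orbit of `γ 0` under the curve `(h (γ 0))⁻¹ h (γ t)` through `1`
  · have h1 : (fun t => ract (h (γ t)) (s (π (γ 0)))) =
        fun t => ract ((h (γ 0))⁻¹ * h (γ t)) (γ 0) := by
      funext t
      have := ract_ract (h (γ 0)) ((h (γ 0))⁻¹ * h (γ t)) (s (π (γ 0)))
      rw [h0, mul_inv_cancel_left] at this
      exact this.symm
    have hs : ContDiff ℝ ∞ (fun t => SU2.mat ((h (γ 0))⁻¹ * h (γ t))) := by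
      simp only [SU2.mat_mul]
      exact contDiff_const.mul hh
    have h2 := hW.vertical (γ 0) (fun t => (h (γ 0))⁻¹ * h (γ t)) hs (by simp)
    have h3 : W.val (ract ((h (γ 0))⁻¹ * h (γ 0)) (γ 0))
        (velocity (fun t => ract ((h (γ 0))⁻¹ * h (γ t)) (γ 0)) 0) = _ := h2
    rw [inv_mul_cancel, ract_one] at h3
    rw [h1, h3]
    simp only [SU2.mat_mul]
    exact deriv_const_mul _ ((hh.differentiable (by simp)) 0)

/-- In a local trivialization, a basic form is the conjugate of its pullback by the section. -/
theorem IsEquivariantSu2Form.val_velocity (hπ : IsPrincipalSU2Bundle π)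
    (hT : IsLocalTriv π U s h) {E : DForm 6 P 1 Mat2} (hE : IsEquivariantSu2Form E)
    (hE' : ∀ (p : P) (u : V6), tder 6 3 π p u = 0 → E.val p u = 0) (γ : ℝ → P)
    (hγ : ContMDiff 𝓘(ℝ, ℝ) (𝓡 6) ∞ γ) (hU : ∀ t, π (γ t) ∈ U) :
    E.val (γ 0) (velocity γ 0) = SU2.mat (h (γ 0))⁻¹ *
      E.val (s (π (γ 0))) (velocity (fun t => s (π (γ t))) 0) * SU2.mat (h (γ 0)) := by
  have h0 : ract (h (γ 0)) (s (π (γ 0))) = γ 0 := hT.act (γ 0) (hU 0)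
  obtain ⟨e1, -, e2⟩ := hπ.velocity_eq hT γ hγ hU
  have h3 : E.val (γ 0) (velocity (fun t => ract (h (γ t)) (s (π (γ 0)))) 0) = 0 := by
    apply hE'
    have h4 : MDifferentiableAt (𝓡 6) (𝓡 3) π (ract (h (γ 0)) (s (π (γ 0)))) :=
      (hπ.smooth_proj _).mdifferentiableAt (by simp)
    have h5 := congrArg (fun L => L (1 : ℝ)) (mfderiv_comp (0 : ℝ) h4 e2)
    have h6 : π ∘ (fun t => ract (h (γ t)) (s (π (γ 0)))) = fun _ => π (s (π (γ 0))) :=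
      funext fun t => hπ.proj_act _ _
    rw [h6, mfderiv_const] at h5
    have h7 : tder 6 3 π (ract (h (γ 0)) (s (π (γ 0))))
      (velocity (fun t => ract (h (γ t)) (s (π (γ 0)))) 0) = 0 := h5.symm
    rwa [h0] at h7
  rw [e1, map_add, h3, add_zero]
  have := hE.val_ract (h (γ 0)) (s (π (γ 0))) (velocity (fun t => s (π (γ t))) 0)
  rwa [h0] at this

/-- A curve in a trivialized part of the bundle has zero velocity if its projection to the base and
its fibre coordinate have zero velocity. -/
theorem IsPrincipalSU2Bundle.velocity_eq_zero (hπ : IsPrincipalSU2Bundle π)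
    (hT : IsLocalTriv π U s h) (γ : ℝ → P)
    (hγ : ContMDiff 𝓘(ℝ, ℝ) (𝓡 6) ∞ γ) (hU : ∀ t, π (γ t) ∈ U)
    (h1 : tder 6 3 π (γ 0) (velocity γ 0) = 0) (h2 : deriv (fun t => SU2.mat (h (γ t))) 0 = 0) :
    velocity γ 0 = 0 := by
  obtain ⟨e1, e2, -⟩ := hπ.velocity_eq hT γ hγ hU
  have h3 : velocity (fun t => s (π (γ t))) 0 = 0 := by
    have d1 : MDifferentiableAt 𝓘(ℝ, ℝ) (𝓡 6) γ 0 := (hγ 0).mdifferentiableAt (by simp)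
    have d2 : MDifferentiableAt (𝓡 6) (𝓡 3) π (γ 0) := (hπ.smooth_proj _).mdifferentiableAt (by simp)
    have d3 : MDifferentiableAt (𝓡 3) (𝓡 6) s (π (γ 0)) :=
      (hT.smooth_s.contMDiffAt (hT.isOpen.mem_nhds (hU 0))).mdifferentiableAt (by simp)
    have e3 := congrArg (fun L => L (1 : ℝ)) (mfderiv_comp (0 : ℝ) (d3.comp (γ 0) d2) d1)
    have e4 := congrArg (fun L => L (velocity γ 0)) (mfderiv_comp (γ 0) d3 d2)
    refine e3.trans (e4.trans ?_)
    have e5 : mfderiv (𝓡 6) (𝓡 3) π (γ 0) (velocity γ 0) = 0 := h1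
    change mfderiv (𝓡 3) (𝓡 6) s (π (γ 0)) (mfderiv (𝓡 6) (𝓡 3) π (γ 0) (velocity γ 0)) = 0
    rw [e5, map_zero]
  rw [e1, e2 h2, h3, map_zero, zero_add]

end Bundle

/-! ### Gauge transformations of connections -/

section Calculus

variable {E E' : Type*} [NormedAddCommGroup E] [NormedSpace ℝ E]
  [NormedAddCommGroup E'] [NormedSpace ℝ E']
  {A : Type*} [NormedRing A] [NormedAlgebra ℝ A]

/-- The curvature `da + a ∧ a` of a matrix-valued `1`-form. -/
noncomputable def curv (a : E → E →L[ℝ] A) (y : E) (u v : E) : A :=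
  fderiv ℝ a y u v - fderiv ℝ a y v u + (a y u * a y v - a y v * a y u)

/-- The covariant exterior derivative `de + a ∧ e + e ∧ a`. -/
noncomputable def covD (a e : E → E →L[ℝ] A) (y : E) (u v : E) : A :=
  fderiv ℝ e y u v - fderiv ℝ e y v u + (a y u * e y v - a y v * e y u)
    + (e y u * a y v - e y v * a y u)

variable {H K : E → A} {ϖ : E → E'} {y : E}

theorem fderiv_left_inverse (hH : DifferentiableAt ℝ H y) (hK : DifferentiableAt ℝ K y)
    (hKH : ∀ᶠ z in 𝓝 y, K z * H z = 1) (hHK : H y * K y = 1) (u : E) :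
    fderiv ℝ K y u = -(K y * fderiv ℝ H y u * K y) := by
  have h1 : HasFDerivAt (fun z => K z * H z) _ y := hK.hasFDerivAt.mul' hH.hasFDerivAt
  have h2 : HasFDerivAt (fun z => K z * H z) (0 : E →L[ℝ] A) y :=
    (hasFDerivAt_const (1 : A) y).congr_of_eventuallyEq hKH
  have h3 := congrArg (fun L => L u) (h1.unique h2)
  simp at h3
  have h4 : fderiv ℝ K y u * H y = -(K y * fderiv ℝ H y u) := by
    rw [eq_neg_iff_add_eq_zero, add_comm]
    exact h3
  calc fderiv ℝ K y u = fderiv ℝ K y u * H y * K y := by rw [mul_assoc, hHK, mul_one]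
    _ = _ := by rw [h4, neg_mul]

/-- The derivative of a conjugate of a pulled back `1`-form. -/
theorem fderiv_gauge {e : E' → E' →L[ℝ] A} (hH : DifferentiableAt ℝ H y)
    (hK : DifferentiableAt ℝ K y) (hϖ : ContDiffAt ℝ 2 ϖ y) (he : DifferentiableAt ℝ e (ϖ y))
    (u v : E) :
    HasFDerivAt (fun z => K z * e (ϖ z) (fderiv ℝ ϖ z v) * H z)
      (fderiv ℝ (fun z => K z * e (ϖ z) (fderiv ℝ ϖ z v) * H z) y) y ∧
    fderiv ℝ (fun z => K z * e (ϖ z) (fderiv ℝ ϖ z v) * H z) y u =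
      fderiv ℝ K y u * e (ϖ y) (fderiv ℝ ϖ y v) * H y +
      K y * (fderiv ℝ e (ϖ y) (fderiv ℝ ϖ y u) (fderiv ℝ ϖ y v) +
        e (ϖ y) (fderiv ℝ (fderiv ℝ ϖ) y u v)) * H y +
      K y * e (ϖ y) (fderiv ℝ ϖ y v) * fderiv ℝ H y u := by
  have h1 : HasFDerivAt ϖ (fderiv ℝ ϖ y) y := (hϖ.differentiableAt (by simp)).hasFDerivAt
  have h2 : HasFDerivAt (fderiv ℝ ϖ) (fderiv ℝ (fderiv ℝ ϖ) y) y :=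
    ((hϖ.fderiv_right (m := 1) (by norm_num)).differentiableAt (by simp)).hasFDerivAt
  have h3 : HasFDerivAt (fun z => fderiv ℝ ϖ z v) _ y := h2.clm_apply (hasFDerivAt_const v y)
  have h4 : HasFDerivAt (fun z => e (ϖ z)) _ y := he.hasFDerivAt.comp y h1
  have h5 := (hK.hasFDerivAt.mul' (h4.clm_apply h3)).mul' hH.hasFDerivAt
  refine ⟨h5.differentiableAt.hasFDerivAt, ?_⟩
  refine (congrArg (fun L => L u) h5.fderiv).trans ?_
  simp [mul_add, add_mul, mul_assoc]
  abel

theorem fderiv_clm_apply_const {b : E → E →L[ℝ] A} (hb : DifferentiableAt ℝ b y) (u v : E) :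
    fderiv ℝ b y u v = fderiv ℝ (fun z => b z v) y u := by
  rw [fderiv_clm_apply hb (differentiableAt_const v)]
  simp

/-- Covariance of the covariant exterior derivative under gauge transformations. -/
theorem covD_gauge {a e : E' → E' →L[ℝ] A} {b f : E → E →L[ℝ] A}
    (hH : DifferentiableAt ℝ H y) (hK : DifferentiableAt ℝ K y)
    (hKH : ∀ᶠ z in 𝓝 y, K z * H z = 1) (hHK : H y * K y = 1)
    (hϖ : ContDiffAt ℝ 2 ϖ y) (he : DifferentiableAt ℝ e (ϖ y)) (hfd : DifferentiableAt ℝ f y)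
    (hb : ∀ u, b y u = K y * a (ϖ y) (fderiv ℝ ϖ y u) * H y + K y * fderiv ℝ H y u)
    (hf : ∀ᶠ z in 𝓝 y, ∀ u, f z u = K z * e (ϖ z) (fderiv ℝ ϖ z u) * H z) (u v : E) :
    covD b f y u v = K y * covD a e (ϖ y) (fderiv ℝ ϖ y u) (fderiv ℝ ϖ y v) * H y := by
  have hsymm : fderiv ℝ (fderiv ℝ ϖ) y u v = fderiv ℝ (fderiv ℝ ϖ) y v u :=
    (hϖ.isSymmSndFDerivAt (by simp)) u v
  have h1 : ∀ u v, fderiv ℝ f y u v = fderiv ℝ K y u * e (ϖ y) (fderiv ℝ ϖ y v) * H y +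
      K y * (fderiv ℝ e (ϖ y) (fderiv ℝ ϖ y u) (fderiv ℝ ϖ y v) +
        e (ϖ y) (fderiv ℝ (fderiv ℝ ϖ) y u v)) * H y +
      K y * e (ϖ y) (fderiv ℝ ϖ y v) * fderiv ℝ H y u := fun u v => by
    have e1 : (fun z => f z v) =ᶠ[𝓝 y] fun z => K z * e (ϖ z) (fderiv ℝ ϖ z v) * H z := by
      filter_upwards [hf] with z hz using hz v
    rw [fderiv_clm_apply_const hfd, e1.fderiv_eq]
    exact (fderiv_gauge hH hK hϖ he u v).2
  have hc : ∀ x, H y * (K y * x) = x := fun x => by rw [← mul_assoc, hHK, one_mul]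
  rw [covD, covD, h1, h1, hb, hb, hf.self_of_nhds u, hf.self_of_nhds v,
    fderiv_left_inverse hH hK hKH hHK, fderiv_left_inverse hH hK hKH hHK, hsymm]
  simp only [mul_add, add_mul, mul_sub, sub_mul, mul_assoc, neg_mul, hc]
  abel

/-- Covariance of the curvature under gauge transformations. -/
theorem curv_gauge {a : E' → E' →L[ℝ] A} {b : E → E →L[ℝ] A}
    (hH : ContDiffAt ℝ 2 H y) (hK : DifferentiableAt ℝ K y)
    (hKH : ∀ᶠ z in 𝓝 y, K z * H z = 1) (hHK : H y * K y = 1)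
    (hϖ : ContDiffAt ℝ 2 ϖ y) (ha : DifferentiableAt ℝ a (ϖ y)) (hbd : DifferentiableAt ℝ b y)
    (hb : ∀ᶠ z in 𝓝 y, ∀ u, b z u =
      K z * a (ϖ z) (fderiv ℝ ϖ z u) * H z + K z * fderiv ℝ H z u) (u v : E) :
    curv b y u v = K y * curv a (ϖ y) (fderiv ℝ ϖ y u) (fderiv ℝ ϖ y v) * H y := by
  have hsymm : fderiv ℝ (fderiv ℝ ϖ) y u v = fderiv ℝ (fderiv ℝ ϖ) y v u :=
    (hϖ.isSymmSndFDerivAt (by simp)) u v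
  have hsymm' : fderiv ℝ (fderiv ℝ H) y u v = fderiv ℝ (fderiv ℝ H) y v u :=
    (hH.isSymmSndFDerivAt (by simp)) u v
  have hHd : DifferentiableAt ℝ H y := hH.differentiableAt (by simp)
  have hH2 : HasFDerivAt (fderiv ℝ H) (fderiv ℝ (fderiv ℝ H) y) y :=
    ((hH.fderiv_right (m := 1) (by norm_num)).differentiableAt (by simp)).hasFDerivAt
  have h1 : ∀ u v, fderiv ℝ b y u v = (fderiv ℝ K y u * a (ϖ y) (fderiv ℝ ϖ y v) * H y +
      K y * (fderiv ℝ a (ϖ y) (fderiv ℝ ϖ y u) (fderiv ℝ ϖ y v) +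
        a (ϖ y) (fderiv ℝ (fderiv ℝ ϖ) y u v)) * H y +
      K y * a (ϖ y) (fderiv ℝ ϖ y v) * fderiv ℝ H y u) +
      (K y * fderiv ℝ (fderiv ℝ H) y u v + fderiv ℝ K y u * fderiv ℝ H y v) := fun u v => by
    have e1 : (fun z => b z v) =ᶠ[𝓝 y] fun z => K z * a (ϖ z) (fderiv ℝ ϖ z v) * H z +
        K z * fderiv ℝ H z v := by
      filter_upwards [hb] with z hz using hz v
    obtain ⟨e2, e3⟩ := fderiv_gauge hHd hK hϖ ha u v
    have e4 : HasFDerivAt (fun z => fderiv ℝ H z v) _ y :=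
      hH2.clm_apply (hasFDerivAt_const v y)
    have e5 := hK.hasFDerivAt.mul' e4
    rw [fderiv_clm_apply_const hbd, e1.fderiv_eq, ← e3]
    refine (congrArg (fun L => L u) (e2.add e5).fderiv).trans ?_
    simp
  have hc : ∀ x, H y * (K y * x) = x := fun x => by rw [← mul_assoc, hHK, one_mul]
  rw [curv, curv, h1, h1, hb.self_of_nhds u, hb.self_of_nhds v,
    fderiv_left_inverse hHd hK hKH hHK, fderiv_left_inverse hHd hK hKH hHK, hsymm, hsymm']
  simp only [mul_add, add_mul, mul_sub, sub_mul, mul_assoc, neg_mul, hc]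
  abel

/-- Every vector is the velocity of a curve that is defined for all times and stays in a given
neighbourhood. -/
theorem exists_curve {O : Set E} (hO : IsOpen O) (hy : y ∈ O) (u : E) :
    ∃ β : ℝ → E, ContDiff ℝ ∞ β ∧ β 0 = y ∧ HasDerivAt β u 0 ∧ ∀ t, β t ∈ O := by
  obtain ⟨r, hr, hball⟩ := Metric.isOpen_iff.1 hO y hy
  set ε := r / (2 * (‖u‖ + 1)) with hε
  have hε0 : 0 < ε := by positivity
  -- the parameter `ε sin (t / ε)` has velocity one at `0` and never leaves `[-ε, ε]`
  refine ⟨fun t => y + (ε * Real.sin (t / ε)) • u, ?_, by simp, ?_, fun t => hball ?_⟩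
  · exact contDiff_const.add ((contDiff_const.mul
      (Real.contDiff_sin.comp (contDiff_id.div_const ε))).smul contDiff_const)
  · have h1 : HasDerivAt (fun t : ℝ => ε * Real.sin (t / ε)) 1 0 := by
      have := (((hasDerivAt_id (0 : ℝ)).div_const ε).sin).const_mul ε
      simpa [hε0.ne'] using this
    simpa using (h1.smul_const u).const_add y
  · rw [Metric.mem_ball, dist_eq_norm, add_sub_cancel_left, norm_smul, Real.norm_eq_abs, abs_mul,
      abs_of_pos hε0]
    have h2 := Real.abs_sin_le_one (t / ε)
    have h3 : ε * ‖u‖ < r := by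
      rw [hε, div_mul_eq_mul_div, div_lt_iff₀ (by positivity)]
      nlinarith [norm_nonneg u]
    calc ε * |Real.sin (t / ε)| * ‖u‖ ≤ ε * 1 * ‖u‖ := by gcongr
      _ < r := by rwa [mul_one]

end Calculus

/-! ### Connections and basic forms in local trivializations -/

/-- The adjugate of a `2 × 2` matrix, which is a linear map. On `SU(2)` it is the inverse. -/
noncomputable def adjugateMat2 : Mat2 →L[ℝ] Mat2 :=
  LinearMap.toContinuousLinearMap
    { toFun := fun X => X.toMatrix.adjugate
      map_add' := fun X Y => by
        apply Matrix.ext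
        intro i j
        change _ = (_ : Matrix (Fin 2) (Fin 2) ℂ) i j + (_ : Matrix (Fin 2) (Fin 2) ℂ) i j
        simp only [Mat2.toMatrix_add, Matrix.adjugate_fin_two]
        fin_cases i <;> fin_cases j <;> simp <;> ring
      map_smul' := fun c X => by
        apply Matrix.ext
        intro i j
        change _ = c • (_ : Matrix (Fin 2) (Fin 2) ℂ) i j
        simp only [Mat2.toMatrix_smul, Matrix.adjugate_fin_two]
        fin_cases i <;> fin_cases j <;> simp }

theorem SU2.mat_inv (g : SU2) : SU2.mat g⁻¹ = adjugateMat2 (SU2.mat g) :=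
  (SU2.adjugate_eq g).symm

section Bundle

variable {M : Type*} [TopologicalSpace M] [ChartedSpace (EuclideanSpace ℝ (Fin 3)) M]
variable {P : Type*} [TopologicalSpace P] [ChartedSpace (EuclideanSpace ℝ (Fin 6)) P]
variable [MulAction SU2ᵐᵒᵖ P] {π : P → M} {U : Set M} {s : M → P} {h : P → SU2}
  {W E : DForm 6 P 1 Mat2}

theorem IsLocalTriv.mono (hT : IsLocalTriv π U s h) {U' : Set M} (hU' : IsOpen U')
    (hsub : U' ⊆ U) : IsLocalTriv π U' s h :=
  ⟨hU', hT.smooth_s.mono hsub, hT.smooth_h.mono (Set.preimage_mono hsub),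
    fun y hy => hT.proj_s y (hsub hy), fun p hp => hT.act p (hsub hp),
    fun y hy => hT.h_act y (hsub hy)⟩

/-- A local trivialization over a part of the domain of a chart of the base. -/
structure IsChartTriv (π : P → M) (x₀ : M) (U : Set M) (s : M → P) (h : P → SU2) : Prop
    extends IsLocalTriv π U s h where
  subset_source : U ⊆ (extChartAt (𝓡 3) x₀).source

theorem IsPrincipalSU2Bundle.exists_chartTriv (hπ : IsPrincipalSU2Bundle π) (x₀ : M) {x : M}
    (hx : x ∈ (extChartAt (𝓡 3) x₀).source) : ∃ U s h, x ∈ U ∧ IsChartTriv π x₀ U s h := by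
  obtain ⟨U, s, h, hxU, hT⟩ := hπ.exists_localTriv x
  exact ⟨U ∩ (extChartAt (𝓡 3) x₀).source, s, h, ⟨hxU, hx⟩,
    hT.mono (hT.isOpen.inter (isOpen_extChartAt_source x₀)) Set.inter_subset_left,
    Set.inter_subset_right⟩

/-- A section of the bundle, as a function of the coordinates. -/
noncomputable def coordSection (x₀ : M) (s : M → P) : V3 → P :=
  fun z => s ((extChartAt (𝓡 3) x₀).symm z)

/-- The projection of the bundle, followed by the coordinates of the base. -/
noncomputable def coordProj (π : P → M) (x₀ : M) : P → V3 :=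
  fun p => extChartAt (𝓡 3) x₀ (π p)

variable [IsManifold (𝓡 3) ∞ M] {x₀ : M} {k : ℕ}

theorem IsChartTriv.section_smooth (hT : IsChartTriv π x₀ U s h) {z : V3}
    (hz : z ∈ (extChartAt (𝓡 3) x₀).target) (hzU : (extChartAt (𝓡 3) x₀).symm z ∈ U) :
    ContMDiffAt (𝓡 3) (𝓡 6) ∞ (coordSection x₀ s) z :=
  (hT.smooth_s.contMDiffAt (hT.isOpen.mem_nhds hzU)).comp z (contMDiffAt_extChartAt_symm' hz)

theorem IsChartTriv.coordProj_smooth (hT : IsChartTriv π x₀ U s h) (hπ : IsPrincipalSU2Bundle π)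
    {p : P} (hp : π p ∈ U) : ContMDiffAt (𝓡 6) (𝓡 3) ∞ (coordProj π x₀) p :=
  (contMDiffAt_extChartAt'' (hT.subset_source hp)).comp p (hπ.smooth_proj p)

theorem IsChartTriv.section_smooth_proj (hT : IsChartTriv π x₀ U s h) {p : P} (hp : π p ∈ U) :
    ContMDiffAt (𝓡 3) (𝓡 6) ∞ (coordSection x₀ s) (coordProj π x₀ p) := by
  apply hT.section_smooth ((extChartAt (𝓡 3) x₀).map_source (hT.subset_source hp))
  rwa [(extChartAt (𝓡 3) x₀).left_inv (hT.subset_source hp)]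

omit [IsManifold (𝓡 3) ∞ M] in
theorem IsChartTriv.section_proj (hT : IsChartTriv π x₀ U s h) {p : P} (hp : π p ∈ U) :
    coordSection x₀ s (coordProj π x₀ p) = s (π p) := by
  rw [coordSection, coordProj, (extChartAt (𝓡 3) x₀).left_inv (hT.subset_source hp)]

omit [IsManifold (𝓡 3) ∞ M] [ChartedSpace (EuclideanSpace ℝ (Fin 3)) M] [TopologicalSpace M]
  [MulAction SU2ᵐᵒᵖ P] in
theorem velocity_comp {c : EuclideanSpace ℝ (Fin k) → P} {y u : EuclideanSpace ℝ (Fin k)}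
    (hc : MDifferentiableAt (𝓡 k) (𝓡 6) c y) {β : ℝ → EuclideanSpace ℝ (Fin k)} (hβ : β 0 = y)
    (hβ' : HasDerivAt β u 0) : velocity (fun t => c (β t)) 0 = tder k 6 c y u := by
  subst hβ
  have h1 : MDifferentiableAt 𝓘(ℝ, ℝ) (𝓡 k) β 0 := hβ'.differentiableAt.mdifferentiableAt
  have h2 := congrArg (fun L => L (1 : ℝ)) (mfderiv_comp (0 : ℝ) hc h1)
  have h3 : mfderiv 𝓘(ℝ, ℝ) (𝓡 k) β 0 (1 : ℝ) = u := by
    rw [mfderiv_eq_fderiv, hβ'.hasFDerivAt.fderiv]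
    exact one_smul ℝ u
  refine h2.trans ?_
  change mfderiv (𝓡 k) (𝓡 6) c (β 0) (mfderiv 𝓘(ℝ, ℝ) (𝓡 k) β 0 (1 : ℝ)) = _
  rw [h3]
  rfl

theorem IsChartTriv.along_section (hT : IsChartTriv π x₀ U s h) (hπ : IsPrincipalSU2Bundle π)
    (a : DForm 6 P 1 Mat2) {c : EuclideanSpace ℝ (Fin k) → P} {y : EuclideanSpace ℝ (Fin k)}
    (hc : ContMDiffAt (𝓡 k) (𝓡 6) ∞ c y) (hy : π (c y) ∈ U) :
    a.along (fun z => s (π (c z))) y =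
      (a.along (coordSection x₀ s) (coordProj π x₀ (c y))).comp
        (fderiv ℝ (fun z => coordProj π x₀ (c z)) y) := by
  have h1 : (fun z => s (π (c z))) =ᶠ[𝓝 y] fun z => coordSection x₀ s (coordProj π x₀ (c z)) := by
    have : ∀ᶠ z in 𝓝 y, π (c z) ∈ U :=
      (hπ.smooth_proj.continuous.continuousAt.comp hc.continuousAt).eventually
        (hT.isOpen.mem_nhds hy)
    filter_upwards [this] with z hz using (hT.section_proj hz).symm
  rw [a.along_congr h1]
  refine a.along_comp ((hT.section_smooth_proj hy).mdifferentiableAt (by simp)) ?_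
  rw [← mdifferentiableAt_iff_differentiableAt]
  exact ((hT.coordProj_smooth hπ hy).comp y hc).mdifferentiableAt (by simp)

omit [IsManifold (𝓡 3) ∞ M] in
/-- The fibre coordinate along a parametrization of a part of the bundle. -/
theorem IsLocalTriv.fibre_smooth (hT : IsLocalTriv π U s h) (hπ : IsPrincipalSU2Bundle π)
    {c : EuclideanSpace ℝ (Fin k) → P} {y : EuclideanSpace ℝ (Fin k)}
    (hc : ContMDiffAt (𝓡 k) (𝓡 6) ∞ c y) (hy : π (c y) ∈ U) :
    ContDiffAt ℝ ∞ (fun z => SU2.mat (h (c z))) y := by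
  rw [← contMDiffAt_iff_contDiffAt]
  have h1 : ContMDiffAt (𝓡 6) 𝓘(ℝ, Mat2) ∞ (fun p => SU2.mat (h p)) (c y) :=
    hT.smooth_h.contMDiffAt ((hT.isOpen.preimage hπ.smooth_proj.continuous).mem_nhds hy)
  exact h1.comp y hc

/-- A connection along a parametrization of a part of the bundle. -/
theorem IsConnectionForm.along_eq (hW : IsConnectionForm W) (hπ : IsPrincipalSU2Bundle π)
    (hT : IsChartTriv π x₀ U s h) {c : EuclideanSpace ℝ (Fin k) → P}
    {O : Set (EuclideanSpace ℝ (Fin k))} (hO : IsOpen O) (hc : ContMDiffOn (𝓡 k) (𝓡 6) ∞ c O)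
    (hcU : ∀ y ∈ O, π (c y) ∈ U) {y : EuclideanSpace ℝ (Fin k)} (hy : y ∈ O)
    (u : EuclideanSpace ℝ (Fin k)) :
    W.along c y u = SU2.mat (h (c y))⁻¹ * W.along (coordSection x₀ s) (coordProj π x₀ (c y))
        (fderiv ℝ (fun z => coordProj π x₀ (c z)) y u) * SU2.mat (h (c y)) +
      SU2.mat (h (c y))⁻¹ * fderiv ℝ (fun z => SU2.mat (h (c z))) y u := by
  have hcy := hc.contMDiffAt (hO.mem_nhds hy)
  obtain ⟨β, hβ, hβ0, hβ', hβO⟩ := exists_curve hO hy u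
  have key := hW.val_velocity hπ hT.toIsLocalTriv (fun t => c (β t))
    (fun t => (hc.contMDiffAt (hO.mem_nhds (hβO t))).comp t (hβ.contMDiff t))
    (fun t => hcU _ (hβO t))
  have h1 : ContMDiffAt (𝓡 k) (𝓡 6) ∞ (fun z => s (π (c z))) y :=
    (hT.smooth_s.contMDiffAt (hT.isOpen.mem_nhds (hcU y hy))).comp y
      ((hπ.smooth_proj (c y)).comp y hcy)
  have h2 : HasDerivAt (fun t => SU2.mat (h (c (β t))))
      (fderiv ℝ (fun z => SU2.mat (h (c z))) y u) 0 := by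
    have := ((hT.fibre_smooth hπ hcy (hcU y hy)).differentiableAt (by simp)).hasFDerivAt
    subst hβ0
    exact this.comp_hasDerivAt (0 : ℝ) hβ'
  rw [velocity_comp (hcy.mdifferentiableAt (by simp)) hβ0 hβ',
    velocity_comp (c := fun z => s (π (c z))) (h1.mdifferentiableAt (by simp)) hβ0 hβ',
    h2.deriv, hβ0] at key
  refine key.trans ?_
  rw [← ContinuousLinearMap.comp_apply (W.along _ _), ← hT.along_section hπ W hcy (hcU y hy)]
  rfl

/-- A basic form along a parametrization of a part of the bundle. -/
theorem IsEquivariantSu2Form.along_eq (hE : IsEquivariantSu2Form E)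
    (hE' : ∀ (p : P) (u : V6), tder 6 3 π p u = 0 → E.val p u = 0) (hπ : IsPrincipalSU2Bundle π)
    (hT : IsChartTriv π x₀ U s h) {c : EuclideanSpace ℝ (Fin k) → P}
    {O : Set (EuclideanSpace ℝ (Fin k))} (hO : IsOpen O) (hc : ContMDiffOn (𝓡 k) (𝓡 6) ∞ c O)
    (hcU : ∀ y ∈ O, π (c y) ∈ U) {y : EuclideanSpace ℝ (Fin k)} (hy : y ∈ O)
    (u : EuclideanSpace ℝ (Fin k)) :
    E.along c y u = SU2.mat (h (c y))⁻¹ * E.along (coordSection x₀ s) (coordProj π x₀ (c y))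
        (fderiv ℝ (fun z => coordProj π x₀ (c z)) y u) * SU2.mat (h (c y)) := by
  have hcy := hc.contMDiffAt (hO.mem_nhds hy)
  obtain ⟨β, hβ, hβ0, hβ', hβO⟩ := exists_curve hO hy u
  have key := hE.val_velocity hπ hT.toIsLocalTriv hE' (fun t => c (β t))
    (fun t => (hc.contMDiffAt (hO.mem_nhds (hβO t))).comp t (hβ.contMDiff t))
    (fun t => hcU _ (hβO t))
  have h1 : ContMDiffAt (𝓡 k) (𝓡 6) ∞ (fun z => s (π (c z))) y :=
    (hT.smooth_s.contMDiffAt (hT.isOpen.mem_nhds (hcU y hy))).comp y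
      ((hπ.smooth_proj (c y)).comp y hcy)
  rw [velocity_comp (hcy.mdifferentiableAt (by simp)) hβ0 hβ',
    velocity_comp (c := fun z => s (π (c z))) (h1.mdifferentiableAt (by simp)) hβ0 hβ',
    hβ0] at key
  refine key.trans ?_
  rw [← ContinuousLinearMap.comp_apply (E.along _ _), ← hT.along_section hπ E hcy (hcU y hy)]
  rfl

end Bundle

/-! ### Curvature and torsion in local trivializations -/

section Su2Derivative

variable {E : Type*} [NormedAddCommGroup E] [NormedSpace ℝ E]

theorem isSu2_fderiv {b : E → E →L[ℝ] Mat2} {y : E} (hb : ∀ᶠ z in 𝓝 y, ∀ u, IsSu2 (b z u))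
    (hd : DifferentiableAt ℝ b y) (u v : E) : IsSu2 (fderiv ℝ b y u v) := by
  have hd' : DifferentiableAt ℝ (fun z => b z v) y := hd.clm_apply (differentiableAt_const v)
  rw [isSu2_iff, fderiv_clm_apply_const hd]
  have h1 : (fun z => (su2Of.comp su2Coord) (b z v)) =ᶠ[𝓝 y] fun z => b z v := by
    filter_upwards [hb] with z hz using (hz v).su2Of_su2Coord
  have h2 := h1.fderiv_eq (𝕜 := ℝ)
  have h3 := ((su2Of.comp su2Coord).hasFDerivAt.comp y hd'.hasFDerivAt).fderiv
  exact congrArg (fun L => L u) (h3.symm.trans h2)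

theorem isSu2_curv {a : E → E →L[ℝ] Mat2} {y : E} (ha : ∀ᶠ z in 𝓝 y, ∀ u, IsSu2 (a z u))
    (hd : DifferentiableAt ℝ a y) (u v : E) : IsSu2 (curv a y u v) :=
  ((isSu2_fderiv ha hd u v).sub (isSu2_fderiv ha hd v u)).add
    ((ha.self_of_nhds u).bracket (ha.self_of_nhds v))

end Su2Derivative

/-- The matrix of an alternating bilinear map on `ℝ³`, as a linear map of the cross product. -/
noncomputable def crossMatrix (F : V3 → V3 → Fin 3 → ℝ) : Matrix (Fin 3) (Fin 3) ℝ :=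
  Matrix.of fun a i => F (EuclideanSpace.basisFun (Fin 3) ℝ (i + 1))
    (EuclideanSpace.basisFun (Fin 3) ℝ (i + 2)) a

theorem crossMatrix_mulVec (F : V3 →ₗ[ℝ] V3 →ₗ[ℝ] Fin 3 → ℝ) (hF : ∀ u, F u u = 0) (u v : V3) :
    F u v = crossMatrix (fun u v => F u v) *ᵥ cross3 u v := by
  have hF' : ∀ u v, F v u = -F u v := fun u v => by
    have := hF (u + v)
    rw [map_add, map_add, LinearMap.add_apply, LinearMap.add_apply, hF, hF, zero_add,
      add_zero] at this
    exact eq_neg_of_add_eq_zero_left this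
  set e := EuclideanSpace.basisFun (Fin 3) ℝ
  have hu : ∀ u : V3, u = u 0 • e 0 + u 1 • e 1 + u 2 • e 2 := fun u => by
    ext i
    fin_cases i <;> simp [e]
  have h1 : F u v = (u 1 * v 2 - u 2 * v 1) • F (e 1) (e 2) +
      (u 2 * v 0 - u 0 * v 2) • F (e 2) (e 0) + (u 0 * v 1 - u 1 * v 0) • F (e 0) (e 1) := by
    conv_lhs => rw [hu u, hu v]
    simp only [map_add, map_smul, LinearMap.add_apply, LinearMap.smul_apply, hF]
    rw [hF' (e 1) (e 2), hF' (e 2) (e 0), hF' (e 0) (e 1)]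
    module
  rw [h1]
  ext a
  simp [crossMatrix, Matrix.mulVec, dotProduct, Fin.sum_univ_three, cross3, e]
  ring

/-- The matrix of the curvature of an `su(2)`-valued form on `ℝ³`. -/
noncomputable def curvMatrix (a : V3 → V3 →L[ℝ] Mat2) (z : V3) : Matrix (Fin 3) (Fin 3) ℝ :=
  crossMatrix fun u v => su2Coord (curv a z u v)

theorem su2Coord_curv (a : V3 → V3 →L[ℝ] Mat2) (z u v : V3) :
    su2Coord (curv a z u v) = curvMatrix a z *ᵥ cross3 u v := by
  let F : V3 →ₗ[ℝ] V3 →ₗ[ℝ] Fin 3 → ℝ := LinearMap.mk₂ ℝ (fun u v => su2Coord (curv a z u v))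
    (fun u u' v => by rw [← map_add]; congr 1; simp [curv, add_mul, mul_add]; abel)
    (fun c u v => by rw [← map_smul]; congr 1; simp [curv, smul_sub, smul_add])
    (fun u v v' => by rw [← map_add]; congr 1; simp [curv, add_mul, mul_add]; abel)
    (fun c u v => by rw [← map_smul]; congr 1; simp [curv, smul_sub, smul_add])
  refine crossMatrix_mulVec F (fun u => ?_) u v
  change su2Coord (curv a z u u) = 0
  simp [curv]

section Bundle

variable {M : Type*} [TopologicalSpace M] [ChartedSpace (EuclideanSpace ℝ (Fin 3)) M]
variable {P : Type*} [TopologicalSpace P] [ChartedSpace (EuclideanSpace ℝ (Fin 6)) P]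
variable [MulAction SU2ᵐᵒᵖ P] {π : P → M} {U : Set M} {s : M → P} {h : P → SU2}
  {W E : DForm 6 P 1 Mat2} {x₀ : M} {p q : P}
variable [IsManifold (𝓡 3) ∞ M] [IsManifold (𝓡 6) ∞ P]

/-- The part of the domain of a chart of the bundle that lies over `U`. -/
def chartDomain (π : P → M) (U : Set M) (p : P) : Set V6 :=
  (extChartAt (𝓡 6) p).target ∩ (extChartAt (𝓡 6) p).symm ⁻¹' (π ⁻¹' U)

omit [IsManifold (𝓡 3) ∞ M] [IsManifold (𝓡 6) ∞ P] in
theorem IsLocalTriv.isOpen_chartDomain (hT : IsLocalTriv π U s h) (hπ : IsPrincipalSU2Bundle π)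
    (p : P) : IsOpen (chartDomain π U p) :=
  (continuousOn_extChartAt_symm p).isOpen_inter_preimage (isOpen_extChartAt_target p)
    (hT.isOpen.preimage hπ.smooth_proj.continuous)

omit [IsManifold (𝓡 3) ∞ M] [IsManifold (𝓡 6) ∞ P] [MulAction SU2ᵐᵒᵖ P]
  [ChartedSpace (EuclideanSpace ℝ (Fin 3)) M] [TopologicalSpace M] in
theorem self_mem_chartDomain (hq : π q ∈ U) : extChartAt (𝓡 6) q q ∈ chartDomain π U q := by
  refine ⟨mem_extChartAt_target q, ?_⟩
  rw [Set.mem_preimage, extChartAt_to_inv]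
  exact hq

theorem IsChartTriv.fderiv_coordProj (hT : IsChartTriv π x₀ U s h) (hπ : IsPrincipalSU2Bundle π)
    {y : V6} (hy : y ∈ chartDomain π U p) :
    fderiv ℝ (fun z => coordProj π x₀ ((extChartAt (𝓡 6) p).symm z)) y =
      (tder 6 3 (coordProj π x₀) ((extChartAt (𝓡 6) p).symm y)).comp
        (tder 6 6 (extChartAt (𝓡 6) p).symm y) := by
  rw [← tder_eq_fderiv]
  exact tder_comp ((hT.coordProj_smooth hπ hy.2).mdifferentiableAt (by simp))
    (mdifferentiableAt_extChartAt_symm' hy.1)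

theorem IsChartTriv.fderiv_coordProj_self (hT : IsChartTriv π x₀ U s h)
    (hπ : IsPrincipalSU2Bundle π) (hq : π q ∈ U) :
    fderiv ℝ (fun z => coordProj π x₀ ((extChartAt (𝓡 6) q).symm z)) (extChartAt (𝓡 6) q q) =
      tder 6 3 (coordProj π x₀) q := by
  rw [hT.fderiv_coordProj hπ (self_mem_chartDomain hq), tder_extChartAt_symm_self,
    extChartAt_to_inv]
  rfl

theorem IsChartTriv.coordProj_contDiffAt (hT : IsChartTriv π x₀ U s h)
    (hπ : IsPrincipalSU2Bundle π) {y : V6} (hy : y ∈ chartDomain π U p) :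
    ContDiffAt ℝ ∞ (fun z => coordProj π x₀ ((extChartAt (𝓡 6) p).symm z)) y := by
  rw [← contMDiffAt_iff_contDiffAt]
  exact (hT.coordProj_smooth hπ hy.2).comp y (contMDiffAt_extChartAt_symm' hy.1)

omit [IsManifold (𝓡 3) ∞ M] in
theorem IsLocalTriv.fibre_contDiffAt (hT : IsLocalTriv π U s h)
    (hπ : IsPrincipalSU2Bundle π) {y : V6} (hy : y ∈ chartDomain π U p) :
    ContDiffAt ℝ ∞ (fun z => SU2.mat (h ((extChartAt (𝓡 6) p).symm z))) y :=
  hT.fibre_smooth hπ (contMDiffAt_extChartAt_symm' hy.1) hy.2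

omit [IsManifold (𝓡 3) ∞ M] in
theorem IsLocalTriv.fibre_inv_contDiffAt (hT : IsLocalTriv π U s h)
    (hπ : IsPrincipalSU2Bundle π) {y : V6} (hy : y ∈ chartDomain π U p) :
    ContDiffAt ℝ ∞ (fun z => SU2.mat (h ((extChartAt (𝓡 6) p).symm z))⁻¹) y := by
  simp only [SU2.mat_inv]
  exact adjugateMat2.contDiff.contDiffAt.comp y (hT.fibre_contDiffAt hπ hy)

omit [IsManifold (𝓡 3) ∞ M] [TopologicalSpace M] [ChartedSpace (EuclideanSpace ℝ (Fin 3)) M]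
  [MulAction SU2ᵐᵒᵖ P] in
theorem contMDiffOn_chartDomain (p : P) :
    ContMDiffOn (𝓡 6) (𝓡 6) ∞ (extChartAt (𝓡 6) p).symm (chartDomain π U p) :=
  fun _ hy => (contMDiffAt_extChartAt_symm' hy.1).contMDiffWithinAt

/-- The connection at a point of the bundle in terms of its local expression on the base. -/
theorem IsConnectionForm.val_eq (hW : IsConnectionForm W) (hπ : IsPrincipalSU2Bundle π)
    (hT : IsChartTriv π x₀ U s h) (hq : π q ∈ U) (u : V6) :
    W.val q u = SU2.mat (h q)⁻¹ * W.along (coordSection x₀ s) (coordProj π x₀ q)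
      (tder 6 3 (coordProj π x₀) q u) * SU2.mat (h q) + SU2.mat (h q)⁻¹ *
        fderiv ℝ (fun z => SU2.mat (h ((extChartAt (𝓡 6) q).symm z))) (extChartAt (𝓡 6) q q) u := by
  have := hW.along_eq hπ hT (hT.isOpen_chartDomain hπ q) (contMDiffOn_chartDomain q)
    (fun y hy => hy.2) (self_mem_chartDomain hq) u
  rwa [hT.fderiv_coordProj_self hπ hq, W.along_symm_self, extChartAt_to_inv] at this

omit [IsManifold (𝓡 3) ∞ M] [TopologicalSpace M] [ChartedSpace (EuclideanSpace ℝ (Fin 3)) M]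
  [MulAction SU2ᵐᵒᵖ P] in
theorem curvature_apply (hW : W.IsSmooth) (q : P) (u v : V6) :
    (curvature W q : V6 [⋀^Fin 2]→L[ℝ] Mat2) ![u, v] =
      curv (W.along (extChartAt (𝓡 6) q).symm) (extChartAt (𝓡 6) q q) u v := by
  have e1 : (curvature W q : V6 [⋀^Fin 2]→L[ℝ] Mat2) ![u, v] = _ + _ :=
    congrArg₂ (· + ·) (W.d_apply hW q u v) (wedge_one_one (V := V6) (W q) (W q) ![u, v])
  rw [e1, curv, W.along_symm_self q]
  rfl

omit [IsManifold (𝓡 3) ∞ M] [TopologicalSpace M] [ChartedSpace (EuclideanSpace ℝ (Fin 3)) M]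
  [MulAction SU2ᵐᵒᵖ P] in
theorem covExtDeriv_apply (hE : E.IsSmooth) (q : P) (u v : V6) :
    (covExtDeriv W E q : V6 [⋀^Fin 2]→L[ℝ] Mat2) ![u, v] =
      covD (W.along (extChartAt (𝓡 6) q).symm) (E.along (extChartAt (𝓡 6) q).symm)
        (extChartAt (𝓡 6) q q) u v := by
  have e1 : (covExtDeriv W E q : V6 [⋀^Fin 2]→L[ℝ] Mat2) ![u, v] = _ + _ + _ :=
    congrArg₂ (· + ·) (congrArg₂ (· + ·) (E.d_apply hE q u v)
      (wedge_one_one (V := V6) (W q) (E q) ![u, v]))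
      (wedge_one_one (V := V6) (E q) (W q) ![u, v])
  rw [e1, covD, W.along_symm_self q, E.along_symm_self q]
  rfl

/-- The curvature at a point of the bundle is a conjugate of the curvature of the local expression
of the connection. -/
theorem IsConnectionForm.curvature_eq (hW : IsConnectionForm W) (hπ : IsPrincipalSU2Bundle π)
    (hT : IsChartTriv π x₀ U s h) (hq : π q ∈ U) (u v : V6) :
    (curvature W q : V6 [⋀^Fin 2]→L[ℝ] Mat2) ![u, v] =
      SU2.mat (h q)⁻¹ * curv (W.along (coordSection x₀ s)) (coordProj π x₀ q)
        (tder 6 3 (coordProj π x₀) q u) (tder 6 3 (coordProj π x₀) q v) * SU2.mat (h q) := by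
  have hy := self_mem_chartDomain hq
  set y := extChartAt (𝓡 6) q q with hy_def
  set c := (extChartAt (𝓡 6) q).symm with hc
  have hO := (hT.isOpen_chartDomain hπ q).mem_nhds hy
  have h1 : (curvature W q : V6 [⋀^Fin 2]→L[ℝ] Mat2) ![u, v] = curv (W.along c) y u v :=
    curvature_apply hW.smooth q u v
  have hcy : c y = q := extChartAt_to_inv q
  have hfd := hT.fderiv_coordProj_self hπ hq
  have h2 := curv_gauge (a := W.along (coordSection x₀ s)) (b := W.along c) (y := y)
    (ϖ := fun z => coordProj π x₀ (c z))
    (H := fun z => SU2.mat (h (c z))) (K := fun z => SU2.mat (h (c z))⁻¹)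
    ((hT.fibre_contDiffAt hπ hy).of_le (by norm_cast))
    ((hT.fibre_inv_contDiffAt hπ hy).differentiableAt (by simp))
    (Filter.Eventually.of_forall fun z => SU2.inv_mat_mul_mat _) (SU2.mat_mul_inv_mat _)
    ((hT.coordProj_contDiffAt hπ hy).of_le (by norm_cast))
    ((hW.smooth.along (hT.section_smooth_proj hy.2)).differentiableAt (by simp))
    ((hW.smooth.along (contMDiffAt_extChartAt_symm' hy.1)).differentiableAt (by simp))
    (by filter_upwards [hO] with z hz u using hW.along_eq hπ hT (hT.isOpen_chartDomain hπ q)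
          (contMDiffOn_chartDomain q) (fun y hy => hy.2) hz u) u v
  rw [h1, h2, hfd, hcy]

/-- The torsion at a point of the bundle is a conjugate of its local expression. -/
theorem IsConnectionForm.covExtDeriv_eq (hW : IsConnectionForm W) (hE : IsEquivariantSu2Form E)
    (hEs : E.IsSmooth) (hE' : ∀ (p : P) (u : V6), tder 6 3 π p u = 0 → E.val p u = 0)
    (hπ : IsPrincipalSU2Bundle π) (hT : IsChartTriv π x₀ U s h) (hq : π q ∈ U) (u v : V6) :
    (covExtDeriv W E q : V6 [⋀^Fin 2]→L[ℝ] Mat2) ![u, v] =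
      SU2.mat (h q)⁻¹ * covD (W.along (coordSection x₀ s)) (E.along (coordSection x₀ s))
        (coordProj π x₀ q) (tder 6 3 (coordProj π x₀) q u) (tder 6 3 (coordProj π x₀) q v) *
        SU2.mat (h q) := by
  have hy := self_mem_chartDomain hq
  set y := extChartAt (𝓡 6) q q with hy_def
  set c := (extChartAt (𝓡 6) q).symm with hc
  have hO := (hT.isOpen_chartDomain hπ q).mem_nhds hy
  have h1 : (covExtDeriv W E q : V6 [⋀^Fin 2]→L[ℝ] Mat2) ![u, v] =
      covD (W.along c) (E.along c) y u v := covExtDeriv_apply hEs q u v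
  have hcy : c y = q := extChartAt_to_inv q
  have hfd := hT.fderiv_coordProj_self hπ hq
  have h2 := covD_gauge (a := W.along (coordSection x₀ s)) (b := W.along c) (y := y)
    (e := E.along (coordSection x₀ s)) (f := E.along c)
    (ϖ := fun z => coordProj π x₀ (c z))
    (H := fun z => SU2.mat (h (c z))) (K := fun z => SU2.mat (h (c z))⁻¹)
    ((hT.fibre_contDiffAt hπ hy).differentiableAt (by simp))
    ((hT.fibre_inv_contDiffAt hπ hy).differentiableAt (by simp))
    (Filter.Eventually.of_forall fun z => SU2.inv_mat_mul_mat _) (SU2.mat_mul_inv_mat _)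
    ((hT.coordProj_contDiffAt hπ hy).of_le (by norm_cast))
    ((hEs.along (hT.section_smooth_proj hy.2)).differentiableAt (by simp))
    ((hEs.along (contMDiffAt_extChartAt_symm' hy.1)).differentiableAt (by simp))
    (fun u => hW.along_eq hπ hT (hT.isOpen_chartDomain hπ q)
          (contMDiffOn_chartDomain q) (fun y hy => hy.2) hy u)
    (by filter_upwards [hO] with z hz u using hE.along_eq hE' hπ hT (hT.isOpen_chartDomain hπ q)
          (contMDiffOn_chartDomain q) (fun y hy => hy.2) hz u) u v
  rw [h1, h2, hfd, hcy]

omit [IsManifold (𝓡 6) ∞ P] in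
theorem IsChartTriv.tder_coordProj_eq_zero_iff (hT : IsChartTriv π x₀ U s h)
    (hπ : IsPrincipalSU2Bundle π) (hq : π q ∈ U) (u : V6) :
    tder 6 3 (coordProj π x₀) q u = 0 ↔ tder 6 3 π q u = 0 := by
  have h1 : tder 6 3 (coordProj π x₀) q = (tder 3 3 (extChartAt (𝓡 3) x₀) (π q)).comp
      (tder 6 3 π q) := tder_comp (mdifferentiableAt_extChartAt' (hT.subset_source hq))
        ((hπ.smooth_proj q).mdifferentiableAt (by simp))
  have h2 := tder_symm_comp_extChartAt (n := 3) (p := x₀)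
    ((extChartAt (𝓡 3) x₀).map_source (hT.subset_source hq))
  rw [(extChartAt (𝓡 3) x₀).left_inv (hT.subset_source hq)] at h2
  rw [h1, ContinuousLinearMap.comp_apply]
  constructor
  · intro h0
    have h3 := congrArg (fun L => L (tder 6 3 π q u)) h2
    rw [ContinuousLinearMap.comp_apply, h0, map_zero] at h3
    exact h3.symm
  · intro h0
    rw [h0, map_zero]

/-- The connection is injective on vertical vectors. -/
theorem IsConnectionForm.eq_zero (hW : IsConnectionForm W) (hπ : IsPrincipalSU2Bundle π)
    (hT : IsChartTriv π x₀ U s h) (hq : π q ∈ U) {u : V6} (h1 : W.val q u = 0)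
    (h2 : tder 6 3 (coordProj π x₀) q u = 0) : u = 0 := by
  have hy := self_mem_chartDomain hq
  set y := extChartAt (𝓡 6) q q with hy_def
  set c := (extChartAt (𝓡 6) q).symm with hc
  have hcy : c y = q := extChartAt_to_inv q
  have hO := hT.isOpen_chartDomain hπ q
  have h3 := hW.val_eq hπ hT hq u
  rw [h1, h2, map_zero, mul_zero, zero_mul, zero_add] at h3
  have h4 : fderiv ℝ (fun z => SU2.mat (h (c z))) y u = 0 := by
    have := congrArg (fun X => SU2.mat (h q) * X) h3
    simp only [← mul_assoc, SU2.mat_mul_inv_mat, one_mul, mul_zero] at this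
    exact this.symm
  obtain ⟨β, hβ, hβ0, hβ', hβO⟩ := exists_curve hO hy u
  have h5 : velocity (fun t => c (β t)) 0 = u := by
    rw [velocity_comp (mdifferentiableAt_extChartAt_symm' hy.1) hβ0 hβ', hy_def,
      tder_extChartAt_symm_self]
    rfl
  rw [← h5]
  refine hπ.velocity_eq_zero hT.toIsLocalTriv (fun t => c (β t))
    (fun t => (contMDiffAt_extChartAt_symm' (hβO t).1).comp t (hβ.contMDiff t))
    (fun t => (hβO t).2) ?_ ?_
  · rw [h5, hβ0, hcy]
    exact (hT.tder_coordProj_eq_zero_iff hπ hq u).1 h2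
  · have h6 := ((hT.fibre_contDiffAt hπ hy).differentiableAt (by simp)).hasFDerivAt
    have h7 : HasDerivAt (fun t => SU2.mat (h (c (β t))))
        (fderiv ℝ (fun z => SU2.mat (h (c z))) y u) 0 := by
      rw [← hβ0] at h6 ⊢
      exact h6.comp_hasDerivAt (0 : ℝ) hβ'
    rw [h7.deriv, h4]

/-- A basis of the tangent space adapted to the connection and to the coordinates of the base. -/
theorem IsConnectionForm.exists_adapted_basis (hW : IsConnectionForm W)
    (hπ : IsPrincipalSU2Bundle π) (hT : IsChartTriv π x₀ U s h) (hq : π q ∈ U) :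
    ∃ p r : Fin 3 → V6,
      (∀ a, su2Coord (W.val q (p a)) = Pi.single a 1 ∧ tder 6 3 (coordProj π x₀) q (p a) = 0) ∧
      (∀ a, W.val q (r a) = 0 ∧
        tder 6 3 (coordProj π x₀) q (r a) = EuclideanSpace.basisFun (Fin 3) ℝ a) := by
  let w : V6 →ₗ[ℝ] Fin 3 → ℝ := (su2Coord.comp (W.val q)).toLinearMap
  let x : V6 →ₗ[ℝ] Fin 3 → ℝ := ((EuclideanSpace.equiv (Fin 3) ℝ).toContinuousLinearMap.comp
    (tder 6 3 (coordProj π x₀) q)).toLinearMap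
  have hx : ∀ u (f : V3), x u = f.ofLp → tder 6 3 (coordProj π x₀) q u = f := fun u f hu =>
    (EuclideanSpace.equiv (Fin 3) ℝ).injective hu
  have hw : ∀ u, w u = 0 → W.val q u = 0 := fun u hu =>
    (hW.mem_su2 q (fun _ => u)).eq_of_su2Coord isSu2_zero (by rw [map_zero]; exact hu)
  obtain ⟨-, p, r, -, hp, hr⟩ := exists_dual_basis w x fun u hu1 hu2 =>
    hW.eq_zero hπ hT hq (hw u hu1) (hx u 0 hu2)
  refine ⟨p, r, fun a => ⟨(hp a).1, hx _ _ (hp a).2⟩, fun a => ⟨hw _ (hr a).1, hx _ _ ?_⟩⟩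
  rw [(hr a).2]
  ext i
  simp [Pi.single_apply]

end Bundle

/-! ### Cofactor square roots of matrices -/

/-- The cofactor matrix describes the action of a matrix on cross products. -/
theorem cross3_mulVec (N : Matrix (Fin 3) (Fin 3) ℝ) (u v : Fin 3 → ℝ) :
    cross3 (N *ᵥ u) (N *ᵥ v) = N.adjugateᵀ *ᵥ cross3 u v := by
  rw [Matrix.adjugate_fin_three]
  ext i
  fin_cases i <;> simp [cross3, Matrix.mulVec, dotProduct, Fin.sum_univ_three] <;> ring

theorem det3_mulVec (N : Matrix (Fin 3) (Fin 3) ℝ) (u v w : Fin 3 → ℝ) :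
    det3 (N *ᵥ u) (N *ᵥ v) (N *ᵥ w) = N.det * det3 u v w := by
  rw [Matrix.det_fin_three]
  simp [det3, Matrix.mulVec, dotProduct, Fin.sum_univ_three]
  ring

theorem adjugate_transpose_adjugate_transpose (N : Matrix (Fin 3) (Fin 3) ℝ) :
    N.adjugateᵀ.adjugateᵀ = N.det • N := by
  rw [Matrix.adjugate_transpose, Matrix.transpose_transpose, Matrix.adjugate_adjugate _ (by simp)]
  simp

theorem det_adjugate_transpose (N : Matrix (Fin 3) (Fin 3) ℝ) :
    N.adjugateᵀ.det = N.det ^ 2 := by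
  rw [Matrix.det_transpose, Matrix.det_adjugate]
  simp

/-- The matrix with cofactor matrix `B` whose determinant has the sign of `κ`. It exists and is
unique if `0 < det B` and `κ ≠ 0`, see `adjugate_frameMatrix`, `mul_det_frameMatrix_pos` and
`eq_frameMatrix`; otherwise the value is meaningless. -/
noncomputable def frameMatrix (κ : ℝ) (B : Matrix (Fin 3) (Fin 3) ℝ) : Matrix (Fin 3) (Fin 3) ℝ :=
  ((SignType.sign κ : ℝ) * (√B.det)⁻¹) • B.adjugateᵀ

theorem sign_mul_sign_self {κ : ℝ} (hκ : κ ≠ 0) :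
    (SignType.sign κ : ℝ) * (SignType.sign κ : ℝ) = 1 := by
  rcases lt_or_gt_of_ne hκ with h | h
  · simp [sign_neg h]
  · simp [sign_pos h]

theorem adjugate_frameMatrix {κ : ℝ} {B : Matrix (Fin 3) (Fin 3) ℝ} (hκ : κ ≠ 0)
    (hB : 0 < B.det) : (frameMatrix κ B).adjugateᵀ = B := by
  have h1 : √B.det ≠ 0 := (Real.sqrt_pos.2 hB).ne'
  rw [frameMatrix, Matrix.adjugate_smul, Matrix.transpose_smul,
    adjugate_transpose_adjugate_transpose, smul_smul]
  have h2 : ((SignType.sign κ : ℝ) * (√B.det)⁻¹) ^ (Fintype.card (Fin 3) - 1) * B.det = 1 := by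
    have h3 : √B.det ^ 2 = B.det := Real.sq_sqrt hB.le
    have h4 : (SignType.sign κ : ℝ) ^ 2 = 1 := by rw [pow_two, sign_mul_sign_self hκ]
    have h5 : Fintype.card (Fin 3) - 1 = 2 := by simp
    rw [h5, mul_pow, h4, inv_pow, h3, one_mul, inv_mul_cancel₀ hB.ne']
  rw [h2, one_smul]

theorem mul_det_frameMatrix_pos {κ : ℝ} {B : Matrix (Fin 3) (Fin 3) ℝ} (hκ : κ ≠ 0)
    (hB : 0 < B.det) : 0 < κ * (frameMatrix κ B).det := by
  have h1 : 0 < √B.det := Real.sqrt_pos.2 hB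
  rw [frameMatrix, Matrix.det_smul, det_adjugate_transpose, mul_pow, Fintype.card_fin]
  have h2 : 0 < κ * (SignType.sign κ : ℝ) ^ 3 := by
    rcases lt_or_gt_of_ne hκ with h | h
    · simp [sign_neg h]
      norm_num [h]
    · simp [sign_pos h, h]
  have h3 : 0 < ((√B.det)⁻¹) ^ 3 * B.det ^ 2 := by positivity
  nlinarith [mul_pos h2 h3]

/-- A matrix whose determinant has the sign of `κ` is determined by its cofactor matrix. -/
theorem eq_frameMatrix {κ : ℝ} {N : Matrix (Fin 3) (Fin 3) ℝ} (h : 0 < κ * N.det) :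
    N = frameMatrix κ N.adjugateᵀ := by
  have hN : N.det ≠ 0 := fun h0 => by simp [h0] at h
  rw [frameMatrix, adjugate_transpose_adjugate_transpose, det_adjugate_transpose, Real.sqrt_sq_eq_abs,
    smul_smul]
  have : (SignType.sign κ : ℝ) * |N.det|⁻¹ * N.det = 1 := by
    rcases lt_or_gt_of_ne hN with h1 | h1
    · have h2 : κ < 0 := by
        by_contra! h3
        nlinarith
      rw [sign_neg h2, abs_of_neg h1]
      simp
      field_simp
    · have h2 : 0 < κ := by
        by_contra! h3
        nlinarith
      rw [sign_pos h2, abs_of_pos h1]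
      simp
      field_simp
  rw [this, one_smul]

/-- The `su(2)`-valued form on `ℝ³` with matrix `N`. -/
noncomputable def frameMap (N : Matrix (Fin 3) (Fin 3) ℝ) : V3 →L[ℝ] Mat2 :=
  ∑ a, ∑ i, N a i • (EuclideanSpace.proj (𝕜 := ℝ) i : V3 →L[ℝ] ℝ).smulRight
    (su2Of (Pi.single a 1))

theorem frameMap_apply (N : Matrix (Fin 3) (Fin 3) ℝ) (u : V3) :
    frameMap N u = su2Of (N *ᵥ u) := by
  have h : N *ᵥ u = ∑ a, ∑ i, N a i • u i • (Pi.single a 1 : Fin 3 → ℝ) := by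
    ext b
    fin_cases b <;>
      simp [Matrix.mulVec, dotProduct, Fin.sum_univ_three, Pi.single_apply]
  rw [h]
  simp only [frameMap, map_sum, map_smul]
  simp

theorem contDiffAt_frameMap {E : Type*} [NormedAddCommGroup E] [NormedSpace ℝ E]
    {N : E → Matrix (Fin 3) (Fin 3) ℝ} {y : E} {n : WithTop ℕ∞}
    (hN : ∀ a i, ContDiffAt ℝ n (fun z => N z a i) y) :
    ContDiffAt ℝ n (fun z => frameMap (N z)) y :=
  ContDiffAt.sum fun a _ => ContDiffAt.sum fun i _ => (hN a i).smul contDiffAt_const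

theorem contDiffAt_frameMatrix {B : V3 → Matrix (Fin 3) (Fin 3) ℝ} {κ : V3 → ℝ} {z : V3}
    (hκ : ContinuousAt κ z) (hκ0 : κ z ≠ 0) (hB : ∀ a i, ContDiffAt ℝ ∞ (fun z => B z a i) z)
    (hdet : 0 < (B z).det) (a i : Fin 3) :
    ContDiffAt ℝ ∞ (fun z => frameMatrix (κ z) (B z) a i) z := by
  -- only the sign of `κ` enters, and it is locally constant
  have hs : ∀ᶠ y in 𝓝 z, SignType.sign (κ y) = SignType.sign (κ z) := by
    rcases lt_or_gt_of_ne hκ0 with h | h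
    · filter_upwards [hκ.eventually_lt_const h] with y hy
      rw [sign_neg hy, sign_neg h]
    · filter_upwards [hκ.eventually_const_lt h] with y hy
      rw [sign_pos hy, sign_pos h]
  have h1 : ContDiffAt ℝ ∞ (fun y => (B y).det) z := by
    simp only [Matrix.det_fin_three]
    fun_prop
  have h2 : ContDiffAt ℝ ∞ (fun y => (B y).adjugateᵀ a i) z := by
    simp only [Matrix.adjugate_fin_three]
    fin_cases a <;> fin_cases i <;> simp <;> fun_prop
  have h3 : ContDiffAt ℝ ∞ (fun y => ((SignType.sign (κ z) : ℝ) * (√(B y).det)⁻¹) *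
      (B y).adjugateᵀ a i) z :=
    (contDiffAt_const.mul ((h1.sqrt hdet.ne').inv (Real.sqrt_pos.2 hdet).ne')).mul h2
  refine h3.congr_of_eventuallyEq ?_
  filter_upwards [hs] with y hy
  rw [frameMatrix, hy]
  rfl

/-- The triple product of `su(2)` is invariant under conjugation, being a multiple of the trace of
`X [Y, Z]`. -/
theorem det3_su2Coord_conj (g : SU2) {X Y Z : Mat2} (hX : IsSu2 X) (hY : IsSu2 Y) (hZ : IsSu2 Z) :
    det3 (su2Coord (SU2.mat g⁻¹ * X * SU2.mat g)) (su2Coord (SU2.mat g⁻¹ * Y * SU2.mat g))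
      (su2Coord (SU2.mat g⁻¹ * Z * SU2.mat g)) = det3 (su2Coord X) (su2Coord Y) (su2Coord Z) := by
  have h : ∀ {X Y Z : Mat2}, IsSu2 X → IsSu2 Y → IsSu2 Z →
      det3 (su2Coord X) (su2Coord Y) (su2Coord Z) = -2 * reTrace (X * (Y * Z - Z * Y)) := by
    intro X Y Z hX hY hZ
    rw [hX.reTrace_mul (hY.bracket hZ), hY.su2Coord_bracket hZ]
    simp [det3, cross3, dotProduct, Fin.sum_univ_three]
  rw [h (hX.conj g) (hY.conj g) (hZ.conj g), h hX hY hZ, conj_mul_conj, conj_mul_conj, ← sub_mul,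
    ← mul_sub, conj_mul_conj, reTrace_conj]

theorem alternating_three_apply (η : V3 [⋀^Fin 3]→L[ℝ] ℝ) (t : Fin 3 → V3) :
    η t = η (EuclideanSpace.basisFun (Fin 3) ℝ) * det3 (t 0) (t 1) (t 2) := by
  have h := congrArg (fun f => f t)
    (η.toAlternatingMap.eq_smul_basis_det (EuclideanSpace.basisFun (Fin 3) ℝ).toBasis)
  have h2 : (EuclideanSpace.basisFun (Fin 3) ℝ).toBasis.det t = det3 (t 0) (t 1) (t 2) := by
    rw [Module.Basis.det_apply, Matrix.det_fin_three]
    simp [Module.Basis.toMatrix_apply, det3]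
    ring
  simp only [AlternatingMap.smul_apply, h2] at h
  simpa using h

/-! ### Pointwise square roots of the curvature -/

section Bundle

variable {M : Type*} [TopologicalSpace M] [ChartedSpace (EuclideanSpace ℝ (Fin 3)) M]
variable {P : Type*} [TopologicalSpace P] [ChartedSpace (EuclideanSpace ℝ (Fin 6)) P]
variable [MulAction SU2ᵐᵒᵖ P] {π : P → M} {U : Set M} {s : M → P} {h : P → SU2}
  {W E : DForm 6 P 1 Mat2} {x₀ : M} {p q : P} {vM : DForm 3 M 3 ℝ} {vP : DForm 6 P 6 ℝ}

/-- The coefficient of a volume form with respect to the coordinates. -/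
noncomputable def volCoeff (vM : DForm 3 M 3 ℝ) (x₀ : M) (z : V3) : ℝ :=
  vM.inChart x₀ z (EuclideanSpace.basisFun (Fin 3) ℝ)

/-- The local expression on the base of the positively oriented square root of the curvature, for the
local section `s`: the matrix whose cofactor matrix is that of the curvature, and whose determinant
has the sign of the volume form. -/
noncomputable def baseFrameMatrix (vM : DForm 3 M 3 ℝ) (W : DForm 6 P 1 Mat2) (x₀ : M) (s : M → P)
    (z : V3) : Matrix (Fin 3) (Fin 3) ℝ :=
  frameMatrix (volCoeff vM x₀ z) (curvMatrix (W.along (coordSection x₀ s)) z)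

/-- The value at a point of a positively oriented basic `1`-form `E` with `F(W) = E ∧ E`. -/
structure IsFrameAt (π : P → M) (vM : DForm 3 M 3 ℝ) (W : DForm 6 P 1 Mat2) (q : P)
    (f : V6 →L[ℝ] Mat2) : Prop where
  mem_su2 : ∀ u, IsSu2 (f u)
  horizontal : ∀ u, tder 6 3 π q u = 0 → f u = 0
  curvature_eq : ∀ u v : V6,
    (curvature W q : V6 [⋀^Fin 2]→L[ℝ] Mat2) ![u, v] = f u * f v - f v * f u
  oriented : ∃ c : ℝ, 0 < c ∧ ∀ t : Fin 3 → V6,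
    det3 (su2Coord (f (t 0))) (su2Coord (f (t 1))) (su2Coord (f (t 2))) =
      c * (vM (π q) : V3 [⋀^Fin 3]→L[ℝ] ℝ) (fun i => tder 6 3 π q (t i))

theorem IsFrameOf.isFrameAt (hE : IsFrameOf π vM W E) (q : P) :
    IsFrameAt π vM W q (E.val q) where
  mem_su2 u := hE.mem_su2 q _
  horizontal u hu := hE.horizontal q u hu
  curvature_eq u v := by
    rw [hE.curvature_eq q]
    exact wedge_one_one (V := V6) (E q) (E q) ![u, v]
  oriented := by
    obtain ⟨c, hc, h⟩ := hE.oriented q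
    refine ⟨c, hc, fun t => ?_⟩
    have h1 := congrArg (fun θ : V6 [⋀^Fin 3]→L[ℝ] ℝ => θ t) h
    have h2 : (-(2 / 3) : ℝ) * reTrace ((wedge (V := V6) (E q) (wedge (V := V6) (E q) (E q)) :
        V6 [⋀^Fin 3]→L[ℝ] Mat2) t) =
        c * (vM (π q) : V3 [⋀^Fin 3]→L[ℝ] ℝ) (fun i => tder 6 3 π q (t i)) := h1
    rw [← h2]
    refine Eq.trans ?_ (congrArg (fun r => -(2 / 3) * r)
      (reTrace_wedge_cube (V := V6) (E q) (hE.mem_su2 q) t)).symm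
    change _ = -(2 / 3) * (-(3 / 2) * det3 (su2Coord (E.val q (t 0))) (su2Coord (E.val q (t 1)))
      (su2Coord (E.val q (t 2))))
    ring

variable [IsManifold (𝓡 3) ∞ M]

theorem volCoeff_mul_det3 (hq : π q ∈ (extChartAt (𝓡 3) x₀).source)
    (hπ : IsPrincipalSU2Bundle π) (t : Fin 3 → V6) :
    (vM (π q) : V3 [⋀^Fin 3]→L[ℝ] ℝ) (fun i => tder 6 3 π q (t i)) =
      volCoeff vM x₀ (coordProj π x₀ q) * det3 (tder 6 3 (coordProj π x₀) q (t 0))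
        (tder 6 3 (coordProj π x₀) q (t 1)) (tder 6 3 (coordProj π x₀) q (t 2)) := by
  have h0 := (extChartAt (𝓡 3) x₀).left_inv hq
  have h1 : tder 6 3 (coordProj π x₀) q = (tder 3 3 (extChartAt (𝓡 3) x₀) (π q)).comp
      (tder 6 3 π q) := tder_comp (mdifferentiableAt_extChartAt' hq)
        ((hπ.smooth_proj q).mdifferentiableAt (by simp))
  have h2 := tder_symm_comp_extChartAt (n := 3) (p := x₀)
    ((extChartAt (𝓡 3) x₀).map_source hq)
  rw [h0] at h2
  have h3 : ∀ u, tder 3 3 (extChartAt (𝓡 3) x₀).symm (extChartAt (𝓡 3) x₀ (π q))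
      (tder 6 3 (coordProj π x₀) q u) = tder 6 3 π q u := fun u => by
    rw [h1]
    exact congrArg (fun L => L (tder 6 3 π q u)) h2
  rw [volCoeff]
  refine Eq.trans ?_ (alternating_three_apply _
    (fun i => tder 6 3 (coordProj π x₀) q (t i)))
  change _ = (vM ((extChartAt (𝓡 3) x₀).symm (extChartAt (𝓡 3) x₀ (π q))) :
    V3 [⋀^Fin 3]→L[ℝ] ℝ) (fun i => tder 3 3 (extChartAt (𝓡 3) x₀).symm
      (extChartAt (𝓡 3) x₀ (π q)) (tder 6 3 (coordProj π x₀) q (t i)))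
  simp only [h3]
  rw [h0]

theorem volCoeff_ne_zero (hv : vM.IsVolumeForm) {z : V3} (hz : z ∈ (extChartAt (𝓡 3) x₀).target) :
    volCoeff vM x₀ z ≠ 0 := by
  intro h0
  apply hv.2 ((extChartAt (𝓡 3) x₀).symm z)
  have h2 := tder_symm_comp_extChartAt (n := 3) (p := x₀) hz
  set L := tder 3 3 (extChartAt (𝓡 3) x₀) ((extChartAt (𝓡 3) x₀).symm z)
  have h3 : ∀ u, tder 3 3 (extChartAt (𝓡 3) x₀).symm z (L u) = u := fun u =>
    congrArg (fun L => L u) h2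
  apply ContinuousAlternatingMap.ext
  intro t
  have h4 := alternating_three_apply (vM.inChart x₀ z) (fun i => L (t i))
  rw [show vM.inChart x₀ z (EuclideanSpace.basisFun (Fin 3) ℝ) = 0 from h0, zero_mul] at h4
  exact (congrArg (fun t => (vM ((extChartAt (𝓡 3) x₀).symm z) : V3 [⋀^Fin 3]→L[ℝ] ℝ) t)
    (funext fun i => (h3 (t i)).symm)).trans h4

omit [IsManifold (𝓡 3) ∞ M] in
theorem volCoeff_continuousAt (hv : vM.IsVolumeForm) {z : V3}
    (hz : z ∈ (extChartAt (𝓡 3) x₀).target) : ContinuousAt (volCoeff vM x₀) z := by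
  have h1 := ((hv.1 x₀).contDiffAt (extChartAt_target_mem_nhds' hz)).continuousAt
  have h2 : Continuous fun θ : V3 [⋀^Fin 3]→L[ℝ] ℝ => θ (EuclideanSpace.basisFun (Fin 3) ℝ) :=
    (ContinuousAlternatingMap.apply ℝ V3 ℝ (EuclideanSpace.basisFun (Fin 3) ℝ)).continuous
  exact h2.continuousAt.comp h1

variable [IsManifold (𝓡 6) ∞ P]

theorem IsEquivariantSu2Form.isSu2_d (hW : IsEquivariantSu2Form W) (hs : W.IsSmooth) (q : P)
    (t : Fin 2 → V6) : IsSu2 ((W.d q : V6 [⋀^Fin 2]→L[ℝ] Mat2) t) := by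
  have ht : t = ![t 0, t 1] := by ext i; fin_cases i <;> rfl
  rw [ht]
  refine (congrArg IsSu2 (W.d_apply hs q (t 0) (t 1))).mpr ?_
  have hd : DifferentiableAt ℝ (W.along (extChartAt (𝓡 6) q).symm) (extChartAt (𝓡 6) q q) :=
    (hs.along (contMDiffAt_extChartAt_symm' (mem_extChartAt_target q))).differentiableAt (by simp)
  have hb : ∀ᶠ z in 𝓝 (extChartAt (𝓡 6) q q), ∀ u,
      IsSu2 (W.along (extChartAt (𝓡 6) q).symm z u) :=
    Filter.Eventually.of_forall fun z u => hW.mem_su2 _ _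
  exact (isSu2_fderiv hb hd _ _).sub (isSu2_fderiv hb hd _ _)

omit [IsManifold (𝓡 3) ∞ M] [IsManifold (𝓡 6) ∞ P] in
theorem IsLocalTriv.fibre_section (hT : IsLocalTriv π U s h) {x : M} (hx : x ∈ U) :
    h (s x) = 1 := by
  have := hT.h_act x hx 1
  rwa [ract_one] at this

/-- If the connection is negative definite, the determinant of its curvature matrix `C` is positive:
Hitchin's invariant has the sign of `½ det (-½ C)`. -/
theorem IsConnectionForm.det_curvMatrix_pos (hW : IsConnectionForm W)
    (hneg : DForm.IsNegativeType vP (chernSimons W)) (hπ : IsPrincipalSU2Bundle π)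
    (hT : IsChartTriv π x₀ U s h) (hq : π q ∈ U) :
    0 < (curvMatrix (W.along (coordSection x₀ s)) (coordProj π x₀ q)).det := by
  -- it is enough to consider the points of the section, where the fibre coordinate is `1`
  set r := s (π q) with hr
  have hπr : π r = π q := hT.proj_s _ hq
  have hrU : π r ∈ U := by rwa [hπr]
  have hz : coordProj π x₀ q = coordProj π x₀ r := by rw [coordProj, coordProj, hπr]
  rw [hz]
  set B := curvMatrix (W.along (coordSection x₀ s)) (coordProj π x₀ r) with hB
  let w : V6 →ₗ[ℝ] Fin 3 → ℝ := (su2Coord.comp (W.val r)).toLinearMap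
  let x : V6 →ₗ[ℝ] Fin 3 → ℝ := ((EuclideanSpace.equiv (Fin 3) ℝ).toContinuousLinearMap.comp
    (tder 6 3 (coordProj π x₀) r)).toLinearMap
  have hwx : ∀ u, w u = 0 → x u = 0 → u = 0 := fun u hu1 hu2 =>
    hW.eq_zero hπ hT hrU ((hW.mem_su2 r (fun _ => u)).eq_of_su2Coord isSu2_zero
      (by rw [map_zero]; exact hu1)) ((EuclideanSpace.equiv (Fin 3) ℝ).injective hu2)
  have hF : ∀ y z : V6, su2Coord ((curvature W r : V6 [⋀^Fin 2]→L[ℝ] Mat2) ![y, z]) =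
      B *ᵥ cross3 (x y) (x z) := fun y z => by
    rw [hW.curvature_eq hπ hT hrU, hr, hT.fibre_section hq, inv_one, SU2.mat_one, one_mul, mul_one,
      su2Coord_curv]
    rfl
  have hΩ : ∀ t : Fin 3 → V6, (chernSimons W r : V6 [⋀^Fin 3]→L[ℝ] ℝ) t =
      adaptedForm (1 / 2) (-(1 / 2 : ℝ) • B)
        (w (t 0)) (w (t 1)) (w (t 2)) (x (t 0)) (x (t 1)) (x (t 2)) := fun t =>
    reTrace_chernSimons (V := V6) (W r) (W.d r) (hW.mem_su2 r)
      (hW.toIsEquivariantSu2Form.isSu2_d hW.smooth r) x B hF t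
  have h1 := mul_det_neg_of_hitchinLambda_neg hwx hΩ (hneg r)
  rw [Matrix.det_smul, Fintype.card_fin] at h1
  linarith

/-- Horizontal lifts exist, so the projection is a submersion. -/
theorem IsConnectionForm.exists_lift (hW : IsConnectionForm W)
    (hπ : IsPrincipalSU2Bundle π) (hT : IsChartTriv π x₀ U s h) (hq : π q ∈ U) :
    ∃ R : V3 →L[ℝ] V6, ∀ u, tder 6 3 (coordProj π x₀) q (R u) = u := by
  obtain ⟨p, r, -, hr⟩ := hW.exists_adapted_basis hπ hT hq
  refine ⟨∑ i, (EuclideanSpace.proj (𝕜 := ℝ) i : V3 →L[ℝ] ℝ).smulRight (r i), fun u => ?_⟩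
  have : ∑ i, u i • (EuclideanSpace.basisFun (Fin 3) ℝ) i = u :=
    (EuclideanSpace.basisFun (Fin 3) ℝ).sum_repr u
  conv_rhs => rw [← this]
  simp [(hr _).2]

/-- The positively oriented square root of the curvature exists and is unique at every point; it is
given by the square root on the base. -/
theorem IsConnectionForm.isFrameAt_iff (hW : IsConnectionForm W) (hv : vM.IsVolumeForm)
    (hneg : DForm.IsNegativeType vP (chernSimons W)) (hπ : IsPrincipalSU2Bundle π)
    (hT : IsChartTriv π x₀ U s h) (hq : π q ∈ U) (f : V6 →L[ℝ] Mat2) :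
    IsFrameAt π vM W q f ↔ ∀ u, f u = SU2.mat (h q)⁻¹ *
      frameMap (baseFrameMatrix vM W x₀ s (coordProj π x₀ q)) (tder 6 3 (coordProj π x₀) q u) *
        SU2.mat (h q) := by
  have hsrc := hT.subset_source hq
  have hκ : volCoeff vM x₀ (coordProj π x₀ q) ≠ 0 :=
    volCoeff_ne_zero hv ((extChartAt (𝓡 3) x₀).map_source hsrc)
  have hB := hW.det_curvMatrix_pos hneg hπ hT hq
  have hF := hW.curvature_eq hπ hT hq
  have hker := hT.tder_coordProj_eq_zero_iff hπ hq
  have hvol := fun t => volCoeff_mul_det3 (vM := vM) (q := q) hsrc hπ t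
  have hcc := su2Coord_curv (W.along (coordSection x₀ s)) (coordProj π x₀ q)
  obtain ⟨R, hR⟩ := hW.exists_lift hπ hT hq
  have hcurv_su2 : ∀ u v, IsSu2 (curv (W.along (coordSection x₀ s)) (coordProj π x₀ q) u v) :=
    isSu2_curv (Filter.Eventually.of_forall fun z u => hW.mem_su2 _ _)
      ((hW.smooth.along (hT.section_smooth_proj hq)).differentiableAt (by simp))
  rw [baseFrameMatrix]
  set B := curvMatrix (W.along (coordSection x₀ s)) (coordProj π x₀ q)
  set κ := volCoeff vM x₀ (coordProj π x₀ q)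
  set ϑ := tder 6 3 (coordProj π x₀) q
  have hconj : ∀ X : Mat2, SU2.mat (h q)⁻¹ * (SU2.mat (h q) * X * SU2.mat (h q)⁻¹) * SU2.mat (h q)
      = X := fun X => by
    rw [← mul_assoc, ← mul_assoc, SU2.inv_mat_mul_mat, one_mul, mul_assoc, SU2.inv_mat_mul_mat,
      mul_one]
  have hconj' : ∀ X : Mat2, SU2.mat (h q) * (SU2.mat (h q)⁻¹ * X * SU2.mat (h q)) * SU2.mat (h q)⁻¹
      = X := fun X => by
    rw [← mul_assoc, ← mul_assoc, SU2.mat_mul_inv_mat, one_mul, mul_assoc, SU2.mat_mul_inv_mat,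
      mul_one]
  have hconj_mem : ∀ {X : Mat2}, IsSu2 X → IsSu2 (SU2.mat (h q) * X * SU2.mat (h q)⁻¹) :=
    fun {X} hX => by
      have := hX.conj (h q)⁻¹
      rwa [inv_inv] at this
  constructor
  · intro hf
    -- a horizontal form factors through the base; `N` is its matrix after undoing the conjugation
    have hfR : ∀ u, f u = f (R (ϑ u)) := fun u => by
      have h1 : f (u - R (ϑ u)) = 0 := hf.horizontal _ ((hker _).1 (by rw [map_sub, hR, sub_self]))
      rwa [map_sub, sub_eq_zero] at h1
    let g : V3 → Mat2 := fun u => SU2.mat (h q) * f (R u) * SU2.mat (h q)⁻¹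
    have hg : ∀ u, IsSu2 (g u) := fun u => hconj_mem (hf.mem_su2 _)
    let N : Matrix (Fin 3) (Fin 3) ℝ := Matrix.of fun a i =>
      su2Coord (g (EuclideanSpace.basisFun (Fin 3) ℝ i)) a
    have hgN : ∀ u : V3, su2Coord (g u) = N *ᵥ u := fun u => by
      have h1 : u = ∑ i, u i • EuclideanSpace.basisFun (Fin 3) ℝ i :=
        ((EuclideanSpace.basisFun (Fin 3) ℝ).sum_repr u).symm
      have h2 : g u = ∑ i, u i • g (EuclideanSpace.basisFun (Fin 3) ℝ i) := by
        conv_lhs => rw [h1]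
        simp only [g, map_sum, map_smul, Finset.mul_sum, Finset.sum_mul, mul_smul_comm,
          smul_mul_assoc]
      rw [h2]
      ext a
      simp only [map_sum, map_smul, Finset.sum_apply, Pi.smul_apply, smul_eq_mul]
      exact Finset.sum_congr rfl fun i _ => mul_comm _ _
    have hfg : ∀ u, f u = SU2.mat (h q)⁻¹ * g (ϑ u) * SU2.mat (h q) := fun u => by
      rw [hfR u]
      exact (hconj _).symm
    -- `F(W) = f ∧ f` prescribes the cofactor matrix of `N`
    have hNB : N.adjugateᵀ = B := by
      have h1 : ∀ u v : V3, N.adjugateᵀ *ᵥ cross3 u v = B *ᵥ cross3 u v := fun u v => by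
        have h2 := hf.curvature_eq (R u) (R v)
        rw [hF, hR, hR, hfg, hfg, hR, hR, conj_mul_conj, conj_mul_conj, ← sub_mul, ← mul_sub] at h2
        have h3 := congrArg (fun X => SU2.mat (h q) * X * SU2.mat (h q)⁻¹) h2
        simp only [hconj'] at h3
        rw [← cross3_mulVec, ← hgN, ← hgN, ← (hg u).su2Coord_bracket (hg v), ← h3, hcc]
      apply Matrix.ext_of_mulVec_single
      intro i
      have h4 := h1 (EuclideanSpace.basisFun (Fin 3) ℝ (i + 1))
        (EuclideanSpace.basisFun (Fin 3) ℝ (i + 2))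
      have h5 : cross3 (EuclideanSpace.basisFun (Fin 3) ℝ (i + 1))
        (EuclideanSpace.basisFun (Fin 3) ℝ (i + 2)) = Pi.single i 1 := by
        ext j
        fin_cases i <;> fin_cases j <;> simp [cross3]
      rwa [h5] at h4
    -- the orientation prescribes the sign of the determinant of `N`
    have hNκ : 0 < κ * N.det := by
      obtain ⟨c, hc, h1⟩ := hf.oriented
      have h2 := h1 fun i => R (EuclideanSpace.basisFun (Fin 3) ℝ i)
      rw [hvol] at h2
      simp only [hR, hfg] at h2
      rw [det3_su2Coord_conj _ (hg _) (hg _) (hg _), hgN, hgN, hgN, det3_mulVec] at h2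
      have h3 : det3 (EuclideanSpace.basisFun (Fin 3) ℝ 0) (EuclideanSpace.basisFun (Fin 3) ℝ 1)
        (EuclideanSpace.basisFun (Fin 3) ℝ 2) = 1 := by simp [det3]
      rw [h3, mul_one, mul_one] at h2
      rw [h2]
      have := mul_pos hc (mul_self_pos.2 hκ)
      linarith
    intro u
    rw [hfg, frameMap_apply, ← hNB, ← eq_frameMatrix hNκ, ← hgN, (hg _).su2Of_su2Coord]
  · intro hf
    have hN1 := adjugate_frameMatrix hκ hB
    have hN2 := mul_det_frameMatrix_pos hκ hB
    set N := frameMatrix κ B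
    have hmem : ∀ u, IsSu2 (frameMap N u) := fun u => by
      rw [frameMap_apply]
      exact isSu2_su2Of _
    have hco : ∀ u, su2Coord (frameMap N u) = N *ᵥ u := fun u => by
      rw [frameMap_apply, su2Coord_su2Of]
    refine ⟨fun u => ?_, fun u hu => ?_, fun u v => ?_, N.det / κ, ?_, fun t => ?_⟩
    · rw [hf]
      exact (hmem _).conj _
    · rw [hf, (hker u).2 hu, map_zero, mul_zero, zero_mul]
    · rw [hF, hf, hf, conj_mul_conj, conj_mul_conj, ← sub_mul, ← mul_sub]
      congr 2
      apply (hcurv_su2 _ _).eq_of_su2Coord ((hmem _).bracket (hmem _))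
      rw [hcc, (hmem _).su2Coord_bracket (hmem _), hco, hco, cross3_mulVec, hN1]
    · have : N.det / κ = κ * N.det * (κ⁻¹ ^ 2) := by field_simp
      rw [this]
      have := inv_ne_zero hκ
      positivity
    · rw [hf, hf, hf, det3_su2Coord_conj _ (hmem _) (hmem _) (hmem _), hco, hco, hco, det3_mulVec,
        hvol, ← mul_assoc, div_mul_cancel₀ _ hκ]

end Bundle

/-! ### The global square root of the curvature -/

section Bundle

variable {M : Type*} [TopologicalSpace M] [ChartedSpace (EuclideanSpace ℝ (Fin 3)) M]
variable {P : Type*} [TopologicalSpace P] [ChartedSpace (EuclideanSpace ℝ (Fin 6)) P]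
variable [MulAction SU2ᵐᵒᵖ P] {π : P → M} {U : Set M} {s : M → P} {h : P → SU2}
  {W E : DForm 6 P 1 Mat2} {x₀ : M} {p q : P} {vM : DForm 3 M 3 ℝ} {vP : DForm 6 P 6 ℝ}

theorem IsPrincipalSU2Bundle.contMDiff_ract (hπ : IsPrincipalSU2Bundle π) (g : SU2) :
    ContMDiff (𝓡 6) (𝓡 6) ∞ (ract g : P → P) := by
  have h1 : (ract g : P → P) = fun p => ract (su2OfSphere (sphereOfSU2 g)) p := by
    rw [su2OfSphere_sphereOfSU2]
  rw [h1]
  exact hπ.smooth_act.comp (contMDiff_id.prodMk contMDiff_const)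

theorem IsLocalTriv.fibre_ract (hT : IsLocalTriv π U s h) (hq : π q ∈ U) (g : SU2) :
    h (ract g q) = h q * g := by
  conv_lhs => rw [← hT.act q hq, ract_ract]
  exact hT.h_act _ hq _

variable [IsManifold (𝓡 3) ∞ M]

theorem IsChartTriv.tder_coordProj_ract (hT : IsChartTriv π x₀ U s h)
    (hπ : IsPrincipalSU2Bundle π) (hq : π q ∈ U) (g : SU2) (u : V6) :
    tder 6 3 (coordProj π x₀) (ract g q) (tder 6 6 (ract g) q u) =
      tder 6 3 (coordProj π x₀) q u := by
  have h1 : (fun p => coordProj π x₀ (ract g p)) = coordProj π x₀ := by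
    funext p
    rw [coordProj, coordProj, hπ.proj_act]
  have hq' : π (ract g q) ∈ U := by rwa [hπ.proj_act]
  have h2 := tder_comp ((hT.coordProj_smooth hπ hq').mdifferentiableAt (by simp))
    ((hπ.contMDiff_ract g q).mdifferentiableAt (by simp))
  rw [h1] at h2
  rw [h2]
  rfl

variable [IsManifold (𝓡 6) ∞ P]

theorem IsConnectionForm.existsUnique_isFrameAt (hW : IsConnectionForm W) (hv : vM.IsVolumeForm)
    (hneg : DForm.IsNegativeType vP (chernSimons W)) (hπ : IsPrincipalSU2Bundle π) (q : P) :
    ∃! f : V6 →L[ℝ] Mat2, IsFrameAt π vM W q f := by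
  obtain ⟨U, s, h, hq, hT⟩ := hπ.exists_chartTriv (π q) (mem_extChartAt_source (π q))
  have key := hW.isFrameAt_iff hv hneg hπ hT hq
  refine ⟨(ContinuousLinearMap.mulLeftRight ℝ Mat2 (SU2.mat (h q)⁻¹) (SU2.mat (h q))).comp
    ((frameMap (baseFrameMatrix vM W (π q) s (coordProj π (π q) q))).comp
      (tder 6 3 (coordProj π (π q)) q)), (key _).2 fun u => rfl, fun f hf => ?_⟩
  ext1 u
  rw [(key f).1 hf u]
  rfl

theorem contDiffAt_curvMatrix {a : V3 → V3 →L[ℝ] Mat2} {z : V3} (ha : ContDiffAt ℝ ∞ a z)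
    (i j : Fin 3) : ContDiffAt ℝ ∞ (fun z => curvMatrix a z i j) z := by
  have h1 : ∀ u v : V3, ContDiffAt ℝ ∞ (fun z => curv a z u v) z := fun u v => by
    have h2 : ContDiffAt ℝ ∞ (fderiv ℝ a) z := ha.fderiv_right (by simp)
    have h3 : ∀ u v, ContDiffAt ℝ ∞ (fun z => fderiv ℝ a z u v) z := fun u v =>
      (h2.clm_apply contDiffAt_const).clm_apply contDiffAt_const
    have h4 : ∀ u, ContDiffAt ℝ ∞ (fun z => a z u) z := fun u => ha.clm_apply contDiffAt_const
    exact ((h3 u v).sub (h3 v u)).add (((h4 u).mul (h4 v)).sub ((h4 v).mul (h4 u)))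
  have h5 := fun u v => su2Coord.contDiff.contDiffAt.comp z (h1 u v)
  exact contDiffAt_pi.1 (h5 _ _) i

/-- The base expression of the square root of the curvature is smooth. -/
theorem IsConnectionForm.contDiffAt_baseFrameMatrix (hW : IsConnectionForm W)
    (hv : vM.IsVolumeForm) (hneg : DForm.IsNegativeType vP (chernSimons W))
    (hπ : IsPrincipalSU2Bundle π) (hT : IsChartTriv π x₀ U s h) (hq : π q ∈ U) (a i : Fin 3) :
    ContDiffAt ℝ ∞ (fun z => baseFrameMatrix vM W x₀ s z a i) (coordProj π x₀ q) := by
  have ht : coordProj π x₀ q ∈ (extChartAt (𝓡 3) x₀).target :=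
    (extChartAt (𝓡 3) x₀).map_source (hT.subset_source hq)
  exact contDiffAt_frameMatrix (volCoeff_continuousAt hv ht) (volCoeff_ne_zero hv ht)
    (contDiffAt_curvMatrix (hW.smooth.along (hT.section_smooth_proj hq)))
    (hW.det_curvMatrix_pos hneg hπ hT hq) a i

theorem IsConnectionForm.smooth_of_isFrameAt (hW : IsConnectionForm W) (hv : vM.IsVolumeForm)
    (hneg : DForm.IsNegativeType vP (chernSimons W)) (hπ : IsPrincipalSU2Bundle π)
    (hE : ∀ q, IsFrameAt π vM W q (E.val q)) : E.IsSmooth := by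
  intro p y hy
  refine ContDiffAt.contDiffWithinAt ?_
  set c := (extChartAt (𝓡 6) p).symm with hc
  obtain ⟨U, s, h, hq, hT⟩ := hπ.exists_chartTriv (π (c y)) (mem_extChartAt_source (π (c y)))
  have hyU : y ∈ chartDomain π U p := ⟨hy, hq⟩
  have hO := (hT.isOpen_chartDomain hπ p).mem_nhds hyU
  have h1 : E.along c =ᶠ[𝓝 y] fun z =>
      (ContinuousLinearMap.mulLeftRight ℝ Mat2 (SU2.mat (h (c z))⁻¹) (SU2.mat (h (c z)))).comp
        ((frameMap (baseFrameMatrix vM W (π (c y)) s (coordProj π (π (c y)) (c z)))).comp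
          (fderiv ℝ (fun z => coordProj π (π (c y)) (c z)) z)) := by
    filter_upwards [hO] with z hz
    rw [hT.fderiv_coordProj hπ hz]
    ext1 u
    exact (hW.isFrameAt_iff hv hneg hπ hT hz.2 _).1 (hE (c z)) _
  have h2 : ContDiffAt ℝ ∞ (E.along c) y := by
    refine ContDiffAt.congr_of_eventuallyEq ?_ h1
    have hϖ := hT.coordProj_contDiffAt hπ hyU
    have h3 := contDiffAt_frameMap fun a i =>
      (hW.contDiffAt_baseFrameMatrix hv hneg hπ hT hq a i).comp y hϖ
    have h4 := hT.fibre_contDiffAt hπ hyU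
    have h5 := hT.fibre_inv_contDiffAt hπ hyU
    have h6 : ContDiffAt ℝ ∞
        (fun z => ContinuousLinearMap.mulLeftRight ℝ Mat2 (SU2.mat (h (c z))⁻¹)) y := by
      fun_prop
    exact (h6.clm_apply h4).clm_comp (h3.clm_comp (hϖ.fderiv_right (by simp)))
  have h7 : E.inChart p = fun z => oneFormEquiv 6 Mat2 (E.along c z) :=
    funext fun z => ((oneFormEquiv 6 Mat2).apply_symm_apply (E.inChart p z)).symm
  rw [h7]
  exact (oneFormEquiv 6 Mat2).contDiff.contDiffAt.comp y h2

/-- A form which is the positively oriented square root of the curvature at every point is smooth and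
equivariant. -/
theorem IsConnectionForm.isFrameOf (hW : IsConnectionForm W) (hv : vM.IsVolumeForm)
    (hneg : DForm.IsNegativeType vP (chernSimons W)) (hπ : IsPrincipalSU2Bundle π)
    (hE : ∀ q, IsFrameAt π vM W q (E.val q)) : IsFrameOf π vM W E := by
  have hval : ∀ (q : P) (t : Fin 1 → V6), E q t = E.val q (t 0) := fun q t => by
    change _ = E q fun _ => t 0
    congr 1
    funext i
    rw [Subsingleton.elim i 0]
  refine ⟨⟨fun q t => ?_, fun g q u => ?_⟩, hW.smooth_of_isFrameAt hv hneg hπ hE,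
    fun q u hu => (hE q).horizontal u hu, fun q => ?_, fun q => ?_⟩
  · exact (congrArg IsSu2 (hval q t)).mpr ((hE q).mem_su2 _)
  -- the base expression is the same at `q` and `q g`, and the fibre coordinate changes by `g`
  · obtain ⟨U, s, h, hq, hT⟩ := hπ.exists_chartTriv (π q) (mem_extChartAt_source (π q))
    have hq' : π (ract g q) ∈ U := by rwa [hπ.proj_act]
    have key : ∀ u : V6,
        E.val (ract g q) (tder 6 6 (ract g) q u) = SU2.mat g⁻¹ * E.val q u * SU2.mat g := fun u => by
      rw [(hW.isFrameAt_iff hv hneg hπ hT hq _).1 (hE q),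
        (hW.isFrameAt_iff hv hneg hπ hT hq' _).1 (hE (ract g q)), hT.tder_coordProj_ract hπ hq,
        hT.fibre_ract hq, mul_inv_rev, SU2.mat_mul, SU2.mat_mul,
        show coordProj π (π q) (ract g q) = coordProj π (π q) q by
          rw [coordProj, coordProj, hπ.proj_act]]
      simp only [mul_assoc]
    exact key u
  · apply ContinuousAlternatingMap.ext
    intro t
    have ht : t = ![t 0, t 1] := by ext i; fin_cases i <;> rfl
    rw [ht]
    exact ((hE q).curvature_eq (t 0) (t 1)).trans
      (wedge_one_one (V := V6) (E q) (E q) ![t 0, t 1]).symm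
  · obtain ⟨c, hc, hc'⟩ := (hE q).oriented
    refine ⟨c, hc, ?_⟩
    apply ContinuousAlternatingMap.ext
    intro t
    have hsu : ∀ u : Fin 1 → V6, IsSu2 (E q u) := fun u => by
      rw [hval]
      exact (hE q).mem_su2 _
    refine Eq.trans ?_ (hc' t)
    refine (congrArg (fun r => -(2 / 3) * r)
      (reTrace_wedge_cube (V := V6) (E q) hsu t)).trans ?_
    change -(2 / 3) * (-(3 / 2) * det3 (su2Coord (E.val q (t 0))) (su2Coord (E.val q (t 1)))
      (su2Coord (E.val q (t 2)))) = _
    ring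

theorem IsConnectionForm.existsUnique_isFrameOf (hW : IsConnectionForm W) (hv : vM.IsVolumeForm)
    (hneg : DForm.IsNegativeType vP (chernSimons W)) (hπ : IsPrincipalSU2Bundle π) :
    ∃! E : DForm 6 P 1 Mat2, IsFrameOf π vM W E := by
  choose f hf hf' using hW.existsUnique_isFrameAt hv hneg hπ
  refine ⟨fun q => oneFormEquiv 6 Mat2 (f q), hW.isFrameOf hv hneg hπ fun q => ?_,
    fun E hE => funext fun q => ?_⟩
  · have : DForm.val (fun q => oneFormEquiv 6 Mat2 (f q) : DForm 6 P 1 Mat2) q = f q :=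
      (oneFormEquiv 6 Mat2).symm_apply_apply (f q)
    rw [this]
    exact hf q
  · rw [← hf' q _ (hE.isFrameAt q)]
    exact ((oneFormEquiv 6 Mat2).apply_symm_apply (E q)).symm

end Bundle

/-! ### The exterior derivative of the dual three-form -/

/-- The imaginary part of `-det (w₁ + i x₁, w₂ + i x₂, w₃ + i x₃)`: the value of a cubic form in the
complex coframe `w + i x` on three vectors. -/
def imForm (x₁ x₂ x₃ w₁ w₂ w₃ : Fin 3 → ℝ) : ℝ :=
  det3 x₁ x₂ x₃ - det3 x₁ w₂ w₃ - det3 w₁ x₂ w₃ - det3 w₁ w₂ x₃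

theorem adaptedForm_eq_imForm (x₁ x₂ x₃ w₁ w₂ w₃ : Fin 3 → ℝ) :
    adaptedForm (1 / 2) (-(1 / 2 : ℝ) • 1) x₁ x₂ x₃ w₁ w₂ w₃ =
      1 / 2 * imForm x₁ x₂ x₃ w₁ w₂ w₃ := by
  simp [adaptedForm, imForm, det3, pair3, cross3, Fin.sum_univ_three, Matrix.one_apply]
  ring

/-- The structure equations turn the exterior derivative of the cubic form `imForm` into an
expression that is linear in the torsion `N`. Here `X i j` and `Y i j` are the derivatives of the
values `x j` and `w j` of the two forms in the direction of the `i`-th vector. -/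
theorem imForm_structure_eq (x w : Fin 4 → Fin 3 → ℝ) (X Y N : Fin 4 → Fin 4 → Fin 3 → ℝ)
    (hX : ∀ i j, N i j = X i j - X j i + (cross3 (w i) (x j) - cross3 (w j) (x i)))
    (hY : ∀ i j, cross3 (x i) (x j) = Y i j - Y j i + cross3 (w i) (w j)) :
    (imForm (X 0 1) (x 2) (x 3) (Y 0 1) (w 2) (w 3) + imForm (x 1) (X 0 2) (x 3) (w 1) (Y 0 2) (w 3)
      + imForm (x 1) (x 2) (X 0 3) (w 1) (w 2) (Y 0 3))
    - (imForm (X 1 0) (x 2) (x 3) (Y 1 0) (w 2) (w 3)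
      + imForm (x 0) (X 1 2) (x 3) (w 0) (Y 1 2) (w 3)
      + imForm (x 0) (x 2) (X 1 3) (w 0) (w 2) (Y 1 3))
    + (imForm (X 2 0) (x 1) (x 3) (Y 2 0) (w 1) (w 3)
      + imForm (x 0) (X 2 1) (x 3) (w 0) (Y 2 1) (w 3)
      + imForm (x 0) (x 1) (X 2 3) (w 0) (w 1) (Y 2 3))
    - (imForm (X 3 0) (x 1) (x 2) (Y 3 0) (w 1) (w 2)
      + imForm (x 0) (X 3 1) (x 2) (w 0) (Y 3 1) (w 2)
      + imForm (x 0) (x 1) (X 3 2) (w 0) (w 1) (Y 3 2)) =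
    (det3 (N 0 1) (x 2) (x 3) - det3 (N 0 1) (w 2) (w 3))
    - (det3 (N 0 2) (x 1) (x 3) - det3 (N 0 2) (w 1) (w 3))
    + (det3 (N 0 3) (x 1) (x 2) - det3 (N 0 3) (w 1) (w 2))
    + (det3 (N 1 2) (x 0) (x 3) - det3 (N 1 2) (w 0) (w 3))
    - (det3 (N 1 3) (x 0) (x 2) - det3 (N 1 3) (w 0) (w 2))
    + (det3 (N 2 3) (x 0) (x 1) - det3 (N 2 3) (w 0) (w 1)) := by
  have hX' : ∀ i j k, X i j k = N i j k + X j i k -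
      (cross3 (w i) (x j) k - cross3 (w j) (x i) k) := fun i j k => by
    have := congrFun (hX i j) k
    simp only [Pi.add_apply, Pi.sub_apply] at this
    linarith
  have hY' : ∀ i j k, Y i j k = cross3 (x i) (x j) k + Y j i k - cross3 (w i) (w j) k :=
    fun i j k => by
    have := congrFun (hY i j) k
    simp only [Pi.add_apply, Pi.sub_apply] at this
    linarith
  simp only [imForm, det3]
  rw [hX' 0 1 0, hX' 0 1 1, hX' 0 1 2, hX' 0 2 0, hX' 0 2 1, hX' 0 2 2, hX' 0 3 0, hX' 0 3 1,
    hX' 0 3 2, hX' 1 2 0, hX' 1 2 1, hX' 1 2 2, hX' 1 3 0, hX' 1 3 1, hX' 1 3 2, hX' 2 3 0,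
    hX' 2 3 1, hX' 2 3 2, hY' 0 1 0, hY' 0 1 1, hY' 0 1 2, hY' 0 2 0, hY' 0 2 1, hY' 0 2 2,
    hY' 0 3 0, hY' 0 3 1, hY' 0 3 2, hY' 1 2 0, hY' 1 2 1, hY' 1 2 2, hY' 1 3 0, hY' 1 3 1,
    hY' 1 3 2, hY' 2 3 0, hY' 2 3 1, hY' 2 3 2]
  simp only [cross3, Matrix.cons_val]
  ring

section Calculus

variable {E : Type*} [NormedAddCommGroup E] [NormedSpace ℝ E] {z : E}

theorem exists_hasFDerivAt_det3 {f g h : E → Fin 3 → ℝ} {f' g' h' : E →L[ℝ] Fin 3 → ℝ}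
    (hf : HasFDerivAt f f' z) (hg : HasFDerivAt g g' z) (hh : HasFDerivAt h h' z) :
    ∃ L : E →L[ℝ] ℝ, HasFDerivAt (fun y => det3 (f y) (g y) (h y)) L z ∧
      ∀ u, L u = det3 (f' u) (g z) (h z) + det3 (f z) (g' u) (h z) + det3 (f z) (g z) (h' u) := by
  have hf' := hasFDerivAt_pi'.1 hf
  have hg' := hasFDerivAt_pi'.1 hg
  have hh' := hasFDerivAt_pi'.1 hh
  refine ⟨_, (((hf' 0).mul (((hg' 1).mul (hh' 2)).sub ((hg' 2).mul (hh' 1)))).add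
    ((hf' 1).mul (((hg' 2).mul (hh' 0)).sub ((hg' 0).mul (hh' 2))))).add
    ((hf' 2).mul (((hg' 0).mul (hh' 1)).sub ((hg' 1).mul (hh' 0)))), fun u => ?_⟩
  simp [det3]
  ring

theorem exists_hasFDerivAt_imForm {x w : E → E →L[ℝ] Fin 3 → ℝ} (hx : DifferentiableAt ℝ x z)
    (hw : DifferentiableAt ℝ w z) (a b c : E) :
    ∃ L : E →L[ℝ] ℝ,
      HasFDerivAt (fun y => imForm (x y a) (x y b) (x y c) (w y a) (w y b) (w y c)) L z ∧
      ∀ u, L u =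
        imForm (fderiv ℝ x z u a) (x z b) (x z c) (fderiv ℝ w z u a) (w z b) (w z c) +
        imForm (x z a) (fderiv ℝ x z u b) (x z c) (w z a) (fderiv ℝ w z u b) (w z c) +
        imForm (x z a) (x z b) (fderiv ℝ x z u c) (w z a) (w z b) (fderiv ℝ w z u c) := by
  have hx' : ∀ a, HasFDerivAt (fun y => x y a) ((fderiv ℝ x z).flip a) z := fun a => by
    simpa using hx.hasFDerivAt.clm_apply (hasFDerivAt_const a z)
  have hw' : ∀ a, HasFDerivAt (fun y => w y a) ((fderiv ℝ w z).flip a) z := fun a => by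
    simpa using hw.hasFDerivAt.clm_apply (hasFDerivAt_const a z)
  obtain ⟨L₁, h1, h1'⟩ := exists_hasFDerivAt_det3 (hx' a) (hx' b) (hx' c)
  obtain ⟨L₂, h2, h2'⟩ := exists_hasFDerivAt_det3 (hx' a) (hw' b) (hw' c)
  obtain ⟨L₃, h3, h3'⟩ := exists_hasFDerivAt_det3 (hw' a) (hx' b) (hw' c)
  obtain ⟨L₄, h4, h4'⟩ := exists_hasFDerivAt_det3 (hw' a) (hw' b) (hx' c)
  refine ⟨_, ((h1.sub h2).sub h3).sub h4, fun u => ?_⟩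
  simp only [_root_.sub_apply, h1', h2', h3', h4', ContinuousLinearMap.flip_apply,
    imForm]
  ring

/-- A family of alternating forms is differentiable if its values are. -/
theorem differentiableAt_alternating {k : ℕ} {f : E → V6 [⋀^Fin k]→L[ℝ] ℝ}
    (hf : ∀ t, DifferentiableAt ℝ (fun y => f y t) z) : DifferentiableAt ℝ f z := by
  let L : (V6 [⋀^Fin k]→L[ℝ] ℝ) →ₗ[ℝ] ((Fin k → Fin 6) → ℝ) :=
    { toFun := fun η σ => η fun i => EuclideanSpace.basisFun (Fin 6) ℝ (σ i)
      map_add' := fun _ _ => rfl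
      map_smul' := fun _ _ => rfl }
  have hL : LinearMap.ker L = ⊥ := by
    rw [LinearMap.ker_eq_bot']
    intro η hη
    apply ContinuousAlternatingMap.toAlternatingMap_injective
    refine Module.Basis.ext_alternating (EuclideanSpace.basisFun (Fin 6) ℝ).toBasis ?_
    intro σ _
    have h0 : η (fun i => EuclideanSpace.basisFun (Fin 6) ℝ (σ i)) = 0 := congrFun hη σ
    simpa using h0
  obtain ⟨g, hg⟩ := L.exists_leftInverse_of_injective hL
  have h1 : f = fun y => LinearMap.toContinuousLinearMap g (L (f y)) :=
    funext fun y => (congrArg (fun l => l (f y)) hg).symm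
  rw [h1]
  refine (LinearMap.toContinuousLinearMap g).differentiableAt.comp z ?_
  rw [differentiableAt_pi]
  exact fun σ => hf _

end Calculus

theorem continuousAt_coframeDet {X : Type*} [TopologicalSpace X] {w x : X → V6 → Fin 3 → ℝ} {z : X}
    {t : Fin 6 → V6} (hw : ∀ j i, ContinuousAt (fun y => w y (t j) i) z)
    (hx : ∀ j i, ContinuousAt (fun y => x y (t j) i) z) :
    ContinuousAt (fun y => coframeDet (w y) (x y) t) z := by
  have h : ∀ k j, ContinuousAt (fun y => (![w y (t j) 0, w y (t j) 1, w y (t j) 2,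
      x y (t j) 0, x y (t j) 1, x y (t j) 2] : Fin 6 → ℝ) k) z := fun k j => by
    fin_cases k
    exacts [hw j 0, hw j 1, hw j 2, hx j 0, hx j 1, hx j 2]
  simp only [coframeDet, Matrix.det_apply, Matrix.of_apply]
  exact tendsto_finsetSum _ fun σ _ => (tendsto_finsetProd _ fun j _ => h _ _).const_smul _

section Bundle

variable {M : Type*} [TopologicalSpace M] [ChartedSpace (EuclideanSpace ℝ (Fin 3)) M]
variable {P : Type*} [TopologicalSpace P] [ChartedSpace (EuclideanSpace ℝ (Fin 6)) P]
variable [MulAction SU2ᵐᵒᵖ P] {π : P → M} {U : Set M} {s : M → P} {h : P → SU2}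
  {W E a : DForm 6 P 1 Mat2} {x₀ : M} {p q : P} {vM : DForm 3 M 3 ℝ} {vP : DForm 6 P 6 ℝ}
variable [IsManifold (𝓡 3) ∞ M] [IsManifold (𝓡 6) ∞ P]

theorem IsConnectionForm.det_baseFrameMatrix_ne_zero (hW : IsConnectionForm W)
    (hv : vM.IsVolumeForm) (hneg : DForm.IsNegativeType vP (chernSimons W))
    (hπ : IsPrincipalSU2Bundle π) (hT : IsChartTriv π x₀ U s h) (hq : π q ∈ U) :
    (baseFrameMatrix vM W x₀ s (coordProj π x₀ q)).det ≠ 0 := fun h0 => by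
  have : 0 < volCoeff vM x₀ (coordProj π x₀ q) * (frameMatrix _ _).det :=
    mul_det_frameMatrix_pos (volCoeff_ne_zero hv
      ((extChartAt (𝓡 3) x₀).map_source (hT.subset_source hq)))
      (hW.det_curvMatrix_pos hneg hπ hT hq)
  rw [baseFrameMatrix] at h0
  rw [h0, mul_zero] at this
  exact lt_irrefl _ this

/-- The kernel of the square root of the curvature is the vertical space. -/
theorem IsConnectionForm.val_eq_zero_iff (hW : IsConnectionForm W) (hv : vM.IsVolumeForm)
    (hneg : DForm.IsNegativeType vP (chernSimons W)) (hπ : IsPrincipalSU2Bundle π)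
    (hE : IsFrameOf π vM W E) (hT : IsChartTriv π x₀ U s h) (hq : π q ∈ U) (u : V6) :
    E.val q u = 0 ↔ tder 6 3 (coordProj π x₀) q u = 0 := by
  have hN := hW.det_baseFrameMatrix_ne_zero (vM := vM) hv hneg hπ hT hq
  rw [(hW.isFrameAt_iff hv hneg hπ hT hq _).1 (hE.isFrameAt q)]
  constructor
  · intro h0
    have h1 := congrArg (fun X => SU2.mat (h q) * X * SU2.mat (h q)⁻¹) h0
    simp only [mul_assoc, SU2.mat_mul_inv_mat, mul_one, mul_zero, zero_mul] at h1
    rw [← mul_assoc, SU2.mat_mul_inv_mat, one_mul, frameMap_apply] at h1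
    have h2 := congrArg su2Coord h1
    rw [su2Coord_su2Of, map_zero] at h2
    exact (EuclideanSpace.equiv (Fin 3) ℝ).injective (Matrix.eq_zero_of_mulVec_eq_zero hN h2)
  · intro h0
    rw [h0, map_zero, mul_zero, zero_mul]

theorem IsConnectionForm.eq_zero_of_val (hW : IsConnectionForm W) (hv : vM.IsVolumeForm)
    (hneg : DForm.IsNegativeType vP (chernSimons W)) (hπ : IsPrincipalSU2Bundle π)
    (hE : IsFrameOf π vM W E) (q : P) {u : V6} (h1 : W.val q u = 0) (h2 : E.val q u = 0) :
    u = 0 := by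
  obtain ⟨U, s, h, hq, hT⟩ := hπ.exists_chartTriv (π q) (mem_extChartAt_source (π q))
  exact hW.eq_zero hπ hT hq h1 ((hW.val_eq_zero_iff hv hneg hπ hE hT hq u).1 h2)

/-- The `su(2)` components of the pullback of a `1`-form to a chart of the bundle. -/
noncomputable def chartCoord (a : DForm 6 P 1 Mat2) (q : P) (z : V6) : V6 →L[ℝ] Fin 3 → ℝ :=
  su2Coord.comp (a.along (extChartAt (𝓡 6) q).symm z)

/-- The orientation of the coframe `(W, E)` with respect to the coordinates and to the orientation
of the bundle. -/
noncomputable def coframeOrientation (vP : DForm 6 P 6 ℝ) (W E : DForm 6 P 1 Mat2) (q : P)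
    (z : V6) : ℝ :=
  vP.inChart q z (EuclideanSpace.basisFun (Fin 6) ℝ) *
    coframeDet (chartCoord W q z) (chartCoord E q z) (EuclideanSpace.basisFun (Fin 6) ℝ)

/-- In a chart of the bundle, `Ω̂` is, up to sign, half the imaginary part of the cube of the coframe
`W + i E`. -/
theorem IsConnectionForm.hat_inChart (hW : IsConnectionForm W) (hv : vM.IsVolumeForm)
    (hvP : vP.IsVolumeForm)
    (hneg : DForm.IsNegativeType vP (chernSimons W)) (hπ : IsPrincipalSU2Bundle π)
    (hE : IsFrameOf π vM W E) {z : V6} (hz : z ∈ (extChartAt (𝓡 6) q).target) :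
    coframeOrientation vP W E q z ≠ 0 ∧
    ∀ t : Fin 3 → V6, (DForm.hat vP (chernSimons W)).inChart q z t =
      SignType.sign (coframeOrientation vP W E q z) * (1 / 2 *
        imForm (chartCoord E q z (t 0)) (chartCoord E q z (t 1)) (chartCoord E q z (t 2))
          (chartCoord W q z (t 0)) (chartCoord W q z (t 1)) (chartCoord W q z (t 2))) := by
  set c := (extChartAt (𝓡 6) q).symm with hc
  set r := c z with hr
  let w : V6 →ₗ[ℝ] Fin 3 → ℝ := (su2Coord.comp (W.val r)).toLinearMap
  let x : V6 →ₗ[ℝ] Fin 3 → ℝ := (su2Coord.comp (E.val r)).toLinearMap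
  have hwx : ∀ u, w u = 0 → x u = 0 → u = 0 := fun u hu1 hu2 =>
    hW.eq_zero_of_val hv hneg hπ hE r
      ((hW.mem_su2 r (fun _ => u)).eq_of_su2Coord isSu2_zero (by rw [map_zero]; exact hu1))
      ((hE.mem_su2 r (fun _ => u)).eq_of_su2Coord isSu2_zero (by rw [map_zero]; exact hu2))
  have hF : ∀ y z : V6, su2Coord ((curvature W r : V6 [⋀^Fin 2]→L[ℝ] Mat2) ![y, z]) =
      (1 : Matrix (Fin 3) (Fin 3) ℝ) *ᵥ cross3 (x y) (x z) := fun y z => by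
    rw [(hE.isFrameAt r).curvature_eq, ((hE.isFrameAt r).mem_su2 y).su2Coord_bracket
      ((hE.isFrameAt r).mem_su2 z), Matrix.one_mulVec]
    rfl
  have hΩ : ∀ t : Fin 3 → V6, (chernSimons W r : V6 [⋀^Fin 3]→L[ℝ] ℝ) t =
      adaptedForm (1 / 2) (-(1 / 2 : ℝ) • 1)
        (w (t 0)) (w (t 1)) (w (t 2)) (x (t 0)) (x (t 1)) (x (t 2)) := fun t =>
    reTrace_chernSimons (V := V6) (W r) (W.d r) (hW.mem_su2 r)
      (hW.toIsEquivariantSu2Form.isSu2_d hW.smooth r) x 1 hF t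
  let L : V6 ≃ₗ[ℝ] V6 := LinearEquiv.ofLinearMap (tder 6 6 c z).toLinearMap
    (tder 6 6 (extChartAt (𝓡 6) q) r).toLinearMap
    (LinearMap.ext fun u => congrArg (fun l => l u) (tder_symm_comp_extChartAt hz))
    (LinearMap.ext fun u => congrArg (fun l => l u) (tder_extChartAt_comp_symm hz))
  let e : Module.Basis (Fin 6) ℝ V6 := (EuclideanSpace.basisFun (Fin 6) ℝ).toBasis.map L
  have he : ∀ j, e j = tder 6 6 c z (EuclideanSpace.basisFun (Fin 6) ℝ j) := fun j => by
    simp only [e, Module.Basis.map_apply, OrthonormalBasis.coe_toBasis]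
    rfl
  have hvP0 : (vP r : V6 [⋀^Fin 6]→L[ℝ] ℝ) ≠ 0 := hvP.2 r
  have ho : coframeOrientation vP W E q z = (vP r : V6 [⋀^Fin 6]→L[ℝ] ℝ) e * coframeDet w x e := by
    have h1 : (e : Fin 6 → V6) = fun j => tder 6 6 c z (EuclideanSpace.basisFun (Fin 6) ℝ j) :=
      funext he
    rw [h1]
    rfl
  rw [ho]
  refine ⟨mul_ne_zero ?_ ?_, fun t => ?_⟩
  · exact ((vP r : V6 [⋀^Fin 6]→L[ℝ] ℝ).toAlternatingMap.map_basis_ne_zero_iff e).2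
      (fun h0 => hvP0 (ContinuousAlternatingMap.toAlternatingMap_injective h0))
  · obtain ⟨b, p, r, hb, hp, hr⟩ := exists_dual_basis w x hwx
    rw [coframeDet_eq_det hwx b p r hb hp hr]
    exact (b.isUnit_det e).ne_zero
  · rw [← adaptedForm_eq_imForm]
    exact hitchinHat_adapted hwx hΩ hvP0 e fun i => tder 6 6 c z (t i)

omit [MulAction SU2ᵐᵒᵖ P] in
theorem continuousAt_coframeOrientation (hvP : vP.IsVolumeForm) (hW : W.IsSmooth) (hE : E.IsSmooth)
    (q : P) : ContinuousAt (coframeOrientation vP W E q) (extChartAt (𝓡 6) q q) := by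
  have hy := mem_extChartAt_target (I := 𝓡 6) q
  have h1 := ((hvP.1 q).contDiffAt (extChartAt_target_mem_nhds' hy)).continuousAt
  have h2 : Continuous fun θ : V6 [⋀^Fin 6]→L[ℝ] ℝ => θ (EuclideanSpace.basisFun (Fin 6) ℝ) :=
    (ContinuousAlternatingMap.apply ℝ V6 ℝ (EuclideanSpace.basisFun (Fin 6) ℝ)).continuous
  refine (h2.continuousAt.comp h1).mul ?_
  have h3 : ∀ {a : DForm 6 P 1 Mat2}, a.IsSmooth → ∀ u i,
      ContinuousAt (fun z => chartCoord a q z u i) (extChartAt (𝓡 6) q q) := fun {a} ha u i => by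
    have h4 := (ha.along (contMDiffAt_extChartAt_symm' hy)).continuousAt
    have h5 : ContinuousAt (fun z => su2Coord (a.along (extChartAt (𝓡 6) q).symm z u))
        (extChartAt (𝓡 6) q q) :=
      su2Coord.continuous.continuousAt.comp (h4.clm_apply continuousAt_const)
    exact continuousAt_pi.1 h5 i
  exact continuousAt_coframeDet (fun _ _ => h3 hW _ _) (fun _ _ => h3 hE _ _)

omit [MulAction SU2ᵐᵒᵖ P] in
theorem chartCoord_differentiableAt (ha : a.IsSmooth) (q : P) :
    DifferentiableAt ℝ (chartCoord a q) (extChartAt (𝓡 6) q q) :=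
  (differentiableAt_const su2Coord).clm_comp
    ((ha.along (contMDiffAt_extChartAt_symm' (mem_extChartAt_target q))).differentiableAt (by simp))

omit [MulAction SU2ᵐᵒᵖ P] in
theorem chartCoord_fderiv (ha : a.IsSmooth) (q : P) (u v : V6) :
    fderiv ℝ (chartCoord a q) (extChartAt (𝓡 6) q q) u v =
      su2Coord (fderiv ℝ (a.along (extChartAt (𝓡 6) q).symm) (extChartAt (𝓡 6) q q) u v) := by
  have h1 := (ha.along (contMDiffAt_extChartAt_symm'
    (mem_extChartAt_target (I := 𝓡 6) q))).differentiableAt (by simp)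
  have h2 := (hasFDerivAt_const su2Coord (extChartAt (𝓡 6) q q)).clm_comp h1.hasFDerivAt
  refine (congrArg (fun l => l u v) h2.fderiv).trans ?_
  simp

omit [IsManifold (𝓡 6) ∞ P] in
theorem IsEquivariantSu2Form.isSu2_along (hE : IsEquivariantSu2Form E) {k : ℕ}
    (c : EuclideanSpace ℝ (Fin k) → P) (z u : EuclideanSpace ℝ (Fin k)) :
    IsSu2 (E.along c z u) :=
  hE.mem_su2 _ _

theorem su2Coord_curvature (hW : IsEquivariantSu2Form W) (hs : W.IsSmooth) (q : P) (u v : V6) :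
    su2Coord ((curvature W q : V6 [⋀^Fin 2]→L[ℝ] Mat2) ![u, v]) =
      fderiv ℝ (chartCoord W q) (extChartAt (𝓡 6) q q) u v -
      fderiv ℝ (chartCoord W q) (extChartAt (𝓡 6) q q) v u +
      cross3 (chartCoord W q (extChartAt (𝓡 6) q q) u)
        (chartCoord W q (extChartAt (𝓡 6) q q) v) := by
  rw [curvature_apply hs, curv, map_add, map_sub, chartCoord_fderiv hs, chartCoord_fderiv hs,
    (hW.isSu2_along _ _ u).su2Coord_bracket (hW.isSu2_along _ _ v)]
  rfl

theorem su2Coord_covExtDeriv (hW : IsEquivariantSu2Form W) (hE : IsEquivariantSu2Form E)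
    (hEs : E.IsSmooth) (q : P) (u v : V6) :
    su2Coord ((covExtDeriv W E q : V6 [⋀^Fin 2]→L[ℝ] Mat2) ![u, v]) =
      fderiv ℝ (chartCoord E q) (extChartAt (𝓡 6) q q) u v -
      fderiv ℝ (chartCoord E q) (extChartAt (𝓡 6) q q) v u +
      (cross3 (chartCoord W q (extChartAt (𝓡 6) q q) u)
        (chartCoord E q (extChartAt (𝓡 6) q q) v) -
      cross3 (chartCoord W q (extChartAt (𝓡 6) q q) v)
        (chartCoord E q (extChartAt (𝓡 6) q q) u)) := by
  have h1 : ∀ A B A' B' C : Mat2, C + (A * B - A' * B') + (B' * A' - B * A) =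
      C + ((A * B - B * A) - (A' * B' - B' * A')) := fun A B A' B' C => by abel
  rw [covExtDeriv_apply hEs, covD, h1, map_add, map_sub, map_sub, chartCoord_fderiv hEs,
    chartCoord_fderiv hEs, (hW.isSu2_along _ _ u).su2Coord_bracket (hE.isSu2_along _ _ v),
    (hW.isSu2_along _ _ v).su2Coord_bracket (hE.isSu2_along _ _ u)]
  rfl

theorem isSu2_covExtDeriv (hW : IsEquivariantSu2Form W) (hE : IsEquivariantSu2Form E)
    (hEs : E.IsSmooth) (q : P) (u v : V6) :
    IsSu2 ((covExtDeriv W E q : V6 [⋀^Fin 2]→L[ℝ] Mat2) ![u, v]) := by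
  have h1 : ∀ A B A' B' C : Mat2, C + (A * B - A' * B') + (B' * A' - B * A) =
      C + ((A * B - B * A) - (A' * B' - B' * A')) := fun A B A' B' C => by abel
  have hd : DifferentiableAt ℝ (E.along (extChartAt (𝓡 6) q).symm) (extChartAt (𝓡 6) q q) :=
    (hEs.along (contMDiffAt_extChartAt_symm' (mem_extChartAt_target q))).differentiableAt (by simp)
  have hb : ∀ᶠ z in 𝓝 (extChartAt (𝓡 6) q q), ∀ u,
      IsSu2 (E.along (extChartAt (𝓡 6) q).symm z u) :=
    Filter.Eventually.of_forall fun z u => hE.mem_su2 _ _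
  rw [covExtDeriv_apply hEs, covD, h1]
  exact ((isSu2_fderiv hb hd _ _).sub (isSu2_fderiv hb hd _ _)).add
    ((IsSu2.bracket (hW.mem_su2 _ _) (hE.mem_su2 _ _)).sub
      (IsSu2.bracket (hW.mem_su2 _ _) (hE.mem_su2 _ _)))

/-- The exterior derivative of the dual `3`-form in terms of the torsion `N`: up to a nonzero factor, it
is the signed sum over `(2, 2)`-shuffles of `det3 N x x - det3 N w w`, where `x` and `w` are the
components of `E` and `W`. -/
theorem IsConnectionForm.exists_hat_d_eq (hW : IsConnectionForm W) (hv : vM.IsVolumeForm)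
    (hvP : vP.IsVolumeForm)
    (hneg : DForm.IsNegativeType vP (chernSimons W)) (hπ : IsPrincipalSU2Bundle π)
    (hE : IsFrameOf π vM W E) (q : P) :
    ∃ σ : ℝ, σ ≠ 0 ∧ ∀ (t : Fin 4 → V6) (N : Fin 4 → Fin 4 → Fin 3 → ℝ) (x w : Fin 4 → Fin 3 → ℝ),
      (∀ i j, N i j = su2Coord ((covExtDeriv W E q : V6 [⋀^Fin 2]→L[ℝ] Mat2) ![t i, t j])) →
      (∀ i, x i = su2Coord (E.val q (t i))) → (∀ i, w i = su2Coord (W.val q (t i))) →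
      ((DForm.hat vP (chernSimons W)).d q : V6 [⋀^Fin 4]→L[ℝ] ℝ) t = σ * (
        (det3 (N 0 1) (x 2) (x 3) - det3 (N 0 1) (w 2) (w 3))
        - (det3 (N 0 2) (x 1) (x 3) - det3 (N 0 2) (w 1) (w 3))
        + (det3 (N 0 3) (x 1) (x 2) - det3 (N 0 3) (w 1) (w 2))
        + (det3 (N 1 2) (x 0) (x 3) - det3 (N 1 2) (w 0) (w 3))
        - (det3 (N 1 3) (x 0) (x 2) - det3 (N 1 3) (w 0) (w 2))
        + (det3 (N 2 3) (x 0) (x 1) - det3 (N 2 3) (w 0) (w 1))) := by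
  set y := extChartAt (𝓡 6) q q with hy_def
  have hy : y ∈ (extChartAt (𝓡 6) q).target := mem_extChartAt_target q
  have ho := (hW.hat_inChart (q := q) hv hvP hneg hπ hE hy).1
  have hoc := continuousAt_coframeOrientation hvP hW.smooth hE.smooth q
  -- the orientation of the coframe is locally constant, so it is not differentiated
  have hs : ∀ᶠ z in 𝓝 y, SignType.sign (coframeOrientation vP W E q z) =
      SignType.sign (coframeOrientation vP W E q y) := by
    rcases lt_or_gt_of_ne ho with h | h
    · filter_upwards [hoc.eventually_lt_const h] with z hz
      rw [sign_neg hz, sign_neg h]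
    · filter_upwards [hoc.eventually_const_lt h] with z hz
      rw [sign_pos hz, sign_pos h]
  set ε : ℝ := ((SignType.sign (coframeOrientation vP W E q y) : SignType) : ℝ) with hε
  have hε0 : ε ≠ 0 := fun h0 => by
    have := sign_mul_sign_self ho
    rw [← hε, h0] at this
    simp at this
  have hx := chartCoord_differentiableAt hE.smooth q
  have hw := chartCoord_differentiableAt hW.smooth q
  have hloc : ∀ a b c : V6,
      (fun z => (DForm.hat vP (chernSimons W)).inChart q z ![a, b, c]) =ᶠ[𝓝 y]
      fun z => ε * (1 / 2 * imForm (chartCoord E q z a) (chartCoord E q z b) (chartCoord E q z c)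
        (chartCoord W q z a) (chartCoord W q z b) (chartCoord W q z c)) := fun a b c => by
    filter_upwards [hs, extChartAt_target_mem_nhds' hy] with z hz hz'
    rw [(hW.hat_inChart hv hvP hneg hπ hE hz').2, hz]
    rfl
  have hder : ∀ a b c : V6, ∃ L : V6 →L[ℝ] ℝ,
      HasFDerivAt (fun z => (DForm.hat vP (chernSimons W)).inChart q z ![a, b, c]) L y ∧
      ∀ u, L u = ε * (1 / 2 * (
        imForm (fderiv ℝ (chartCoord E q) y u a) (chartCoord E q y b) (chartCoord E q y c)
          (fderiv ℝ (chartCoord W q) y u a) (chartCoord W q y b) (chartCoord W q y c) +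
        imForm (chartCoord E q y a) (fderiv ℝ (chartCoord E q) y u b) (chartCoord E q y c)
          (chartCoord W q y a) (fderiv ℝ (chartCoord W q) y u b) (chartCoord W q y c) +
        imForm (chartCoord E q y a) (chartCoord E q y b) (fderiv ℝ (chartCoord E q) y u c)
          (chartCoord W q y a) (chartCoord W q y b) (fderiv ℝ (chartCoord W q) y u c))) :=
    fun a b c => by
    obtain ⟨L, hL, hL'⟩ := exists_hasFDerivAt_imForm hx hw a b c
    refine ⟨_, ((hL.const_mul (1 / 2)).const_mul ε).congr_of_eventuallyEq (hloc a b c),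
      fun u => ?_⟩
    simp only [_root_.smul_apply, smul_eq_mul, hL']
    rfl
  have hdiff : DifferentiableAt ℝ ((DForm.hat vP (chernSimons W)).inChart q) y :=
    differentiableAt_alternating fun t => by
      obtain ⟨L, hL, -⟩ := hder (t 0) (t 1) (t 2)
      have ht : t = ![t 0, t 1, t 2] := by ext i; fin_cases i <;> rfl
      rw [ht]
      exact hL.differentiableAt
  refine ⟨ε * (1 / 2), mul_ne_zero hε0 (by norm_num), fun t N x w hN hx' hw' => ?_⟩
  have h1 : ((DForm.hat vP (chernSimons W)).d q : V6 [⋀^Fin 4]→L[ℝ] ℝ) t =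
      extDeriv ((DForm.hat vP (chernSimons W)).inChart q) y
        (fun i => tder 6 6 (extChartAt (𝓡 6) q) q (t i)) := rfl
  rw [h1, tder_extChartAt_self, extDeriv_apply hdiff]
  have hxy : ∀ i, x i = chartCoord E q y (t i) := fun i => by
    rw [hx', chartCoord, hy_def, DForm.along_symm_self]
    rfl
  have hwy : ∀ i, w i = chartCoord W q y (t i) := fun i => by
    rw [hw', chartCoord, hy_def, DForm.along_symm_self]
    rfl
  have key := imForm_structure_eq x w (fun i j => fderiv ℝ (chartCoord E q) y (t i) (t j))
    (fun i j => fderiv ℝ (chartCoord W q) y (t i) (t j)) N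
    (fun i j => by
      rw [hN, su2Coord_covExtDeriv hW.toIsEquivariantSu2Form hE.toIsEquivariantSu2Form hE.smooth]
      simp only [hxy, hwy]
      rfl)
    (fun i j => by
      have e1 := congrArg su2Coord ((hE.isFrameAt q).curvature_eq (t i) (t j))
      rw [su2Coord_curvature hW.toIsEquivariantSu2Form hW.smooth,
        ((hE.isFrameAt q).mem_su2 _).su2Coord_bracket ((hE.isFrameAt q).mem_su2 _)] at e1
      rw [hx', hx', ← e1]
      simp only [hwy]
      rfl)
  rw [mul_assoc, ← key]
  have hrem : ∀ i : Fin 4, (fun z => (DForm.hat vP (chernSimons W)).inChart q z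
      (i.removeNth fun j => ContinuousLinearMap.id ℝ V6 (t j))) =
      fun z => (DForm.hat vP (chernSimons W)).inChart q z
        ![t (i.succAbove 0), t (i.succAbove 1), t (i.succAbove 2)] := fun i => by
    funext z
    congr 1
    ext j
    fin_cases j <;> rfl
  simp only [hrem]
  refine (Fin.sum_univ_four _).trans ?_
  obtain ⟨L₀, h0, h0'⟩ := hder (t 1) (t 2) (t 3)
  obtain ⟨L₁, h1, h1'⟩ := hder (t 0) (t 2) (t 3)
  obtain ⟨L₂, h2, h2'⟩ := hder (t 0) (t 1) (t 3)
  obtain ⟨L₃, h3, h3'⟩ := hder (t 0) (t 1) (t 2)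
  have e0 := congrArg (fun l => l (t 0)) h0.fderiv
  have e1 := congrArg (fun l => l (t 1)) h1.fderiv
  have e2 := congrArg (fun l => l (t 2)) h2.fderiv
  have e3 := congrArg (fun l => l (t 3)) h3.fderiv
  refine (congrArg₂ (· + ·) (congrArg₂ (· + ·) (congrArg₂ (· + ·)
    (congrArg (fun r : ℝ => (-1 : ℤ) ^ 0 • r) (e0.trans (h0' (t 0))))
    (congrArg (fun r : ℝ => (-1 : ℤ) ^ 1 • r) (e1.trans (h1' (t 1)))))
    (congrArg (fun r : ℝ => (-1 : ℤ) ^ 2 • r) (e2.trans (h2' (t 2)))))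
    (congrArg (fun r : ℝ => (-1 : ℤ) ^ 3 • r) (e3.trans (h3' (t 3))))).trans ?_
  simp only [hxy, hwy]
  ring

/-- The dual `3`-form is closed if and only if the connection is torsion-free. -/
theorem IsConnectionForm.hat_d_eq_zero_iff (hW : IsConnectionForm W) (hv : vM.IsVolumeForm)
    (hvP : vP.IsVolumeForm)
    (hneg : DForm.IsNegativeType vP (chernSimons W)) (hπ : IsPrincipalSU2Bundle π)
    (hE : IsFrameOf π vM W E) :
    (DForm.hat vP (chernSimons W)).d = 0 ↔ covExtDeriv W E = 0 := by
  constructor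
  · intro hd
    have main : ∀ (q : P) (u v : V6),
        (covExtDeriv W E q : V6 [⋀^Fin 2]→L[ℝ] Mat2) ![u, v] = 0 := fun q u v => by
      obtain ⟨U, s, h, hq, hT⟩ := hπ.exists_chartTriv (π q) (mem_extChartAt_source (π q))
      obtain ⟨p, -, hp, -⟩ := hW.exists_adapted_basis hπ hT hq
      obtain ⟨σ, hσ, key⟩ := hW.exists_hat_d_eq hv hvP hneg hπ hE q
      have hvert : ∀ (u : V6) (a : Fin 3),
          (covExtDeriv W E q : V6 [⋀^Fin 2]→L[ℝ] Mat2) ![u, p a] = 0 := fun u a => by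
        rw [hW.covExtDeriv_eq hE.toIsEquivariantSu2Form hE.smooth hE.horizontal hπ hT hq, (hp a).2]
        simp [covD]
      have hEp : ∀ a, E.val q (p a) = 0 := fun a =>
        (hW.val_eq_zero_iff hv hneg hπ hE hT hq _).2 (hp a).2
      refine (isSu2_covExtDeriv hW.toIsEquivariantSu2Form hE.toIsEquivariantSu2Form hE.smooth q
        u v).eq_of_su2Coord isSu2_zero ?_
      rw [map_zero]
      -- contracting with two vertical vectors gives the components of the torsion
      have hcomp : ∀ a b : Fin 3, det3 (su2Coord ((covExtDeriv W E q : V6 [⋀^Fin 2]→L[ℝ] Mat2)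
          ![u, v])) (Pi.single a 1) (Pi.single b 1) = 0 := fun a b => by
        have h1 := key ![u, v, p a, p b]
          (fun i j => su2Coord ((covExtDeriv W E q : V6 [⋀^Fin 2]→L[ℝ] Mat2)
            ![(![u, v, p a, p b] : Fin 4 → V6) i, (![u, v, p a, p b] : Fin 4 → V6) j]))
          (fun i => su2Coord (E.val q ((![u, v, p a, p b] : Fin 4 → V6) i)))
          (fun i => su2Coord (W.val q ((![u, v, p a, p b] : Fin 4 → V6) i)))
          (fun i j => rfl) (fun i => rfl) (fun i => rfl)
        have h2 : ((DForm.hat vP (chernSimons W)).d q : V6 [⋀^Fin 4]→L[ℝ] ℝ)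
            ![u, v, p a, p b] = 0 := by
          rw [hd]
          rfl
        have h3 := (mul_eq_zero.1 (h2.symm.trans h1).symm).resolve_left hσ
        simp only [Matrix.cons_val, hvert, hEp, map_zero, (hp _).1] at h3
        have hz : ∀ f g : Fin 3 → ℝ, det3 0 f g = 0 := fun f g => by simp [det3]
        have hz' : ∀ f g : Fin 3 → ℝ, det3 f 0 g = 0 := fun f g => by simp [det3]
        simp only [hz, hz', sub_zero, add_zero, zero_sub] at h3
        exact neg_eq_zero.1 h3
      ext a
      fin_cases a
      · simpa [det3] using hcomp 1 2
      · simpa [det3] using hcomp 2 0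
      · simpa [det3] using hcomp 0 1
    funext q
    apply ContinuousAlternatingMap.ext
    intro t
    have ht : t = ![t 0, t 1] := by ext i; fin_cases i <;> rfl
    rw [ht]
    exact main q (t 0) (t 1)
  · intro hN
    funext q
    apply ContinuousAlternatingMap.ext
    intro t
    obtain ⟨σ, -, key⟩ := hW.exists_hat_d_eq hv hvP hneg hπ hE q
    have hz : ∀ f g : Fin 3 → ℝ, det3 0 f g = 0 := fun f g => by simp [det3]
    refine (key t (fun i j => 0) (fun i => su2Coord (E.val q (t i)))
      (fun i => su2Coord (W.val q (t i))) (fun i j => ?_) (fun i => rfl) (fun i => rfl)).trans ?_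
    · rw [hN]
      exact (map_zero su2Coord).symm
    · simp only [hz, sub_zero, add_zero, mul_zero]
      rfl

end Bundle

/-! ### The metric on the base -/

/-- The bilinear form on `ℝ³` with matrix `A`. -/
noncomputable def bilinMap (A : Matrix (Fin 3) (Fin 3) ℝ) : V3 →L[ℝ] V3 →L[ℝ] ℝ :=
  ∑ i, ∑ j, A i j • (EuclideanSpace.proj (𝕜 := ℝ) i : V3 →L[ℝ] ℝ).smulRight
    (EuclideanSpace.proj (𝕜 := ℝ) j : V3 →L[ℝ] ℝ)

theorem bilinMap_transpose_mul_self (N : Matrix (Fin 3) (Fin 3) ℝ) (u v : V3) :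
    bilinMap (Nᵀ * N) u v = (N *ᵥ u) ⬝ᵥ (N *ᵥ v) := by
  simp [bilinMap, Matrix.mulVec, dotProduct, Fin.sum_univ_three, Matrix.mul_apply]
  ring

theorem contDiffAt_sum_sum_smul {E F : Type*} [NormedAddCommGroup E] [NormedSpace ℝ E]
    [NormedAddCommGroup F] [NormedSpace ℝ F] {A : E → Matrix (Fin 3) (Fin 3) ℝ} {y : E}
    {n : WithTop ℕ∞} (hA : ∀ a i, ContDiffAt ℝ n (fun z => A z a i) y) (c : Fin 3 → Fin 3 → F) :
    ContDiffAt ℝ n (fun z => ∑ i, ∑ j, A z i j • c i j) y :=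
  ContDiffAt.sum fun a _ => ContDiffAt.sum fun i _ => (hA a i).smul contDiffAt_const

theorem contDiffAt_bilinMap {E : Type*} [NormedAddCommGroup E] [NormedSpace ℝ E]
    {A : E → Matrix (Fin 3) (Fin 3) ℝ} {y : E} {n : WithTop ℕ∞}
    (hA : ∀ a i, ContDiffAt ℝ n (fun z => A z a i) y) :
    ContDiffAt ℝ n (fun z => bilinMap (A z)) y :=
  contDiffAt_sum_sum_smul (F := V3 →L[ℝ] V3 →L[ℝ] ℝ) hA fun i j =>
    (EuclideanSpace.proj (𝕜 := ℝ) i : V3 →L[ℝ] ℝ).smulRight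
      (EuclideanSpace.proj (𝕜 := ℝ) j : V3 →L[ℝ] ℝ)

/-- The unit ball of a positive definite form on `ℝ³` is bounded. -/
theorem isVonNBounded_of_pos (G : V3 →L[ℝ] V3 →L[ℝ] ℝ) (hG : ∀ v, v ≠ 0 → 0 < G v v) :
    Bornology.IsVonNBounded ℝ {v : V3 | G v v < 1} := by
  have hcont : Continuous fun v : V3 => G v v := by fun_prop
  obtain ⟨w, hw, hmin⟩ := (isCompact_sphere (0 : V3) 1).exists_isMinOn
    (NormedSpace.sphere_nonempty.2 zero_le_one) hcont.continuousOn
  have hw0 : w ≠ 0 := fun h0 => by simp [h0] at hw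
  set m := G w w with hm
  have hm0 : 0 < m := hG w hw0
  have hle : ∀ v, m * ‖v‖ ^ 2 ≤ G v v := fun v => by
    rcases eq_or_ne v 0 with rfl | hv
    · simp
    have hn : 0 < ‖v‖ := norm_pos_iff.2 hv
    have h1 : m ≤ G (‖v‖⁻¹ • v) (‖v‖⁻¹ • v) := hmin (by simp [norm_smul, hn.ne'])
    simp only [map_smul, _root_.smul_apply, smul_eq_mul] at h1
    calc m * ‖v‖ ^ 2 ≤ (‖v‖⁻¹ * (‖v‖⁻¹ * G v v)) * ‖v‖ ^ 2 := by gcongr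
      _ = G v v := by field_simp
  apply NormedSpace.isVonNBounded_of_isBounded
  refine (Metric.isBounded_closedBall (x := (0 : V3)) (r := 1 + 1 / m)).subset fun v hv => ?_
  rw [mem_closedBall_zero_iff]
  by_contra! h
  have h1 : m * ‖v‖ ^ 2 < 1 := (hle v).trans_lt hv
  have h2 : 0 < 1 / m := by positivity
  have h3 : 1 / m < ‖v‖ := by linarith
  rw [div_lt_iff₀ hm0] at h3
  nlinarith [norm_nonneg v]

section Bundle

variable {M : Type*} [TopologicalSpace M] [ChartedSpace (EuclideanSpace ℝ (Fin 3)) M]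
variable {P : Type*} [TopologicalSpace P] [ChartedSpace (EuclideanSpace ℝ (Fin 6)) P]
variable [MulAction SU2ᵐᵒᵖ P] {π : P → M} {U : Set M} {s : M → P} {h : P → SU2}
  {W E : DForm 6 P 1 Mat2} {x₀ : M} {p q : P} {vM : DForm 3 M 3 ℝ} {vP : DForm 6 P 6 ℝ}
variable [IsManifold (𝓡 3) ∞ M] [IsManifold (𝓡 6) ∞ P]

omit [IsManifold (𝓡 6) ∞ P] in
theorem tder_coordProj (hπ : IsPrincipalSU2Bundle π) (hq : π q ∈ (extChartAt (𝓡 3) x₀).source)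
    (u : V6) : tder 6 3 (coordProj π x₀) q u =
      tder 3 3 (extChartAt (𝓡 3) x₀) (π q) (tder 6 3 π q u) := by
  have h1 : tder 6 3 (coordProj π x₀) q = (tder 3 3 (extChartAt (𝓡 3) x₀) (π q)).comp
      (tder 6 3 π q) := tder_comp (mdifferentiableAt_extChartAt' hq)
        ((hπ.smooth_proj q).mdifferentiableAt (by simp))
  rw [h1]
  rfl

theorem tder_extChartAt_injective {x : M} (hx : x ∈ (extChartAt (𝓡 3) x₀).source) :
    Function.Injective (tder 3 3 (extChartAt (𝓡 3) x₀) x) := by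
  have h2 := tder_symm_comp_extChartAt (n := 3) (p := x₀)
    ((extChartAt (𝓡 3) x₀).map_source hx)
  rw [(extChartAt (𝓡 3) x₀).left_inv hx] at h2
  exact Function.LeftInverse.injective fun u => congrArg (fun L => L u) h2

theorem tder_proj_surjective (hW : IsConnectionForm W) (hπ : IsPrincipalSU2Bundle π) (q : P) :
    Function.Surjective (tder 6 3 π q) := by
  obtain ⟨U, s, h, hq, hT⟩ := hπ.exists_chartTriv (π q) (mem_extChartAt_source (π q))
  obtain ⟨R, hR⟩ := hW.exists_lift hπ hT hq
  intro v
  refine ⟨R (tder 3 3 (extChartAt (𝓡 3) (π q)) (π q) v), ?_⟩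
  apply tder_extChartAt_injective (hT.subset_source hq)
  rw [← tder_coordProj hπ (hT.subset_source hq), hR]

/-- The invariant quadratic expression in a basic form descends to the base. -/
theorem IsConnectionForm.reTrace_mul_eq (hW : IsConnectionForm W) (hv : vM.IsVolumeForm)
    (hneg : DForm.IsNegativeType vP (chernSimons W)) (hπ : IsPrincipalSU2Bundle π)
    (hE : IsFrameOf π vM W E) (hT : IsChartTriv π x₀ U s h) (hq : π q ∈ U) (u w : V6) :
    -2 * reTrace (E.val q u * E.val q w) =
      (baseFrameMatrix vM W x₀ s (coordProj π x₀ q) *ᵥ tder 6 3 (coordProj π x₀) q u) ⬝ᵥ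
      (baseFrameMatrix vM W x₀ s (coordProj π x₀ q) *ᵥ tder 6 3 (coordProj π x₀) q w) := by
  have hf := (hW.isFrameAt_iff hv hneg hπ hT hq _).1 (hE.isFrameAt q)
  rw [hf, hf, conj_mul_conj, reTrace_conj, frameMap_apply, frameMap_apply, reTrace_su2Of_mul]
  ring

/-- The form `-2 Tr (E ⊗ E)` is the pullback of a field of bilinear forms on the base. -/
theorem IsConnectionForm.exists_baseMetric (hW : IsConnectionForm W) (hv : vM.IsVolumeForm)
    (hneg : DForm.IsNegativeType vP (chernSimons W)) (hπ : IsPrincipalSU2Bundle π)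
    (hE : IsFrameOf π vM W E) :
    ∃ G : M → V3 →L[ℝ] V3 →L[ℝ] ℝ, ∀ (q : P) (u w : V6),
      G (π q) (tder 6 3 π q u) (tder 6 3 π q w) = -2 * reTrace (E.val q u * E.val q w) := by
  have h1 : ∀ x : M, ∃ G : V3 →L[ℝ] V3 →L[ℝ] ℝ, ∀ (q : P), π q = x → ∀ u w : V6,
      G (tder 6 3 π q u) (tder 6 3 π q w) = -2 * reTrace (E.val q u * E.val q w) := fun x => by
    obtain ⟨U, s, h, hx, hT⟩ := hπ.exists_chartTriv x (mem_extChartAt_source x)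
    set N := baseFrameMatrix vM W x s (extChartAt (𝓡 3) x x)
    refine ⟨(bilinMap (Nᵀ * N)).bilinearComp (tder 3 3 (extChartAt (𝓡 3) x) x)
      (tder 3 3 (extChartAt (𝓡 3) x) x), fun q hq u w => ?_⟩
    have hqU : π q ∈ U := by rwa [hq]
    rw [hW.reTrace_mul_eq hv hneg hπ hE hT hqU, tder_coordProj hπ (hT.subset_source hqU),
      tder_coordProj hπ (hT.subset_source hqU), coordProj, hq, ← bilinMap_transpose_mul_self]
    rfl
  choose G hG using h1
  exact ⟨G, fun q => hG (π q) q rfl⟩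

theorem IsConnectionForm.baseMetric_eq (hW : IsConnectionForm W) (hv : vM.IsVolumeForm)
    (hneg : DForm.IsNegativeType vP (chernSimons W)) (hπ : IsPrincipalSU2Bundle π)
    (hE : IsFrameOf π vM W E) {G : M → V3 →L[ℝ] V3 →L[ℝ] ℝ} (hG : ∀ (q : P) (u w : V6),
      G (π q) (tder 6 3 π q u) (tder 6 3 π q w) = -2 * reTrace (E.val q u * E.val q w))
    (hT : IsChartTriv π x₀ U s h) {x : M} (hx : x ∈ U) (v w : V3) :
    G x v w = (baseFrameMatrix vM W x₀ s (extChartAt (𝓡 3) x₀ x) *ᵥ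
        tder 3 3 (extChartAt (𝓡 3) x₀) x v) ⬝ᵥ
      (baseFrameMatrix vM W x₀ s (extChartAt (𝓡 3) x₀ x) *ᵥ
        tder 3 3 (extChartAt (𝓡 3) x₀) x w) := by
  have hx' := hT.proj_s x hx
  have hqU : π (s x) ∈ U := by rwa [hx']
  obtain ⟨v, rfl⟩ := tder_proj_surjective hW hπ (s x) v
  obtain ⟨w, rfl⟩ := tder_proj_surjective hW hπ (s x) w
  have h1 := hG (s x) v w
  rw [hW.reTrace_mul_eq hv hneg hπ hE hT hqU, tder_coordProj hπ (hT.subset_source hqU),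
    tder_coordProj hπ (hT.subset_source hqU), coordProj, hx'] at h1
  exact h1

/-- In coordinates, the metric is `NᵀN`. -/
theorem IsConnectionForm.baseMetric_symm_eq (hW : IsConnectionForm W) (hv : vM.IsVolumeForm)
    (hneg : DForm.IsNegativeType vP (chernSimons W)) (hπ : IsPrincipalSU2Bundle π)
    (hE : IsFrameOf π vM W E) {G : M → V3 →L[ℝ] V3 →L[ℝ] ℝ} (hG : ∀ (q : P) (u w : V6),
      G (π q) (tder 6 3 π q u) (tder 6 3 π q w) = -2 * reTrace (E.val q u * E.val q w))
    (hT : IsChartTriv π x₀ U s h) {z : V3} (hz : z ∈ (extChartAt (𝓡 3) x₀).target)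
    (hzU : (extChartAt (𝓡 3) x₀).symm z ∈ U) (v w : V3) :
    G ((extChartAt (𝓡 3) x₀).symm z) (tder 3 3 (extChartAt (𝓡 3) x₀).symm z v)
      (tder 3 3 (extChartAt (𝓡 3) x₀).symm z w) =
      (baseFrameMatrix vM W x₀ s z *ᵥ v) ⬝ᵥ (baseFrameMatrix vM W x₀ s z *ᵥ w) := by
  have h1 : ∀ u, tder 3 3 (extChartAt (𝓡 3) x₀) ((extChartAt (𝓡 3) x₀).symm z)
      (tder 3 3 (extChartAt (𝓡 3) x₀).symm z u) = u := fun u =>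
    congrArg (fun L => L u) (tder_extChartAt_comp_symm hz)
  rw [hW.baseMetric_eq hv hneg hπ hE hG hT hzU, h1, h1, (extChartAt (𝓡 3) x₀).right_inv hz]

theorem IsConnectionForm.baseMetric_pos (hW : IsConnectionForm W) (hv : vM.IsVolumeForm)
    (hneg : DForm.IsNegativeType vP (chernSimons W)) (hπ : IsPrincipalSU2Bundle π)
    (hE : IsFrameOf π vM W E) {G : M → V3 →L[ℝ] V3 →L[ℝ] ℝ} (hG : ∀ (q : P) (u w : V6),
      G (π q) (tder 6 3 π q u) (tder 6 3 π q w) = -2 * reTrace (E.val q u * E.val q w))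
    (x : M) (v : V3) (hv0 : v ≠ 0) : 0 < G x v v := by
  obtain ⟨U, s, h, hx, hT⟩ := hπ.exists_chartTriv x (mem_extChartAt_source x)
  have hx' := hT.proj_s x hx
  have hqU : π (s x) ∈ U := by rwa [hx']
  have hN := hW.det_baseFrameMatrix_ne_zero (vM := vM) hv hneg hπ hT hqU
  rw [coordProj, hx'] at hN
  rw [hW.baseMetric_eq hv hneg hπ hE hG hT hx]
  set f := baseFrameMatrix vM W x s (extChartAt (𝓡 3) x x) *ᵥ tder 3 3 (extChartAt (𝓡 3) x) x v
    with hf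
  have hf0 : f ≠ 0 := fun h0 => hv0 (by
    have h1 := Matrix.eq_zero_of_mulVec_eq_zero hN h0
    apply tder_extChartAt_injective (mem_extChartAt_source (I := 𝓡 3) x)
    rw [map_zero]
    exact (EuclideanSpace.equiv (Fin 3) ℝ).injective h1)
  exact lt_of_le_of_ne (Finset.sum_nonneg fun i _ => mul_self_nonneg (f i)) (fun h1 => hf0 (dotProduct_self_eq_zero.1 h1.symm))

/-- The metric is smooth as a section of the bundle of bilinear forms on the tangent spaces. -/
theorem IsConnectionForm.baseMetric_smooth (hW : IsConnectionForm W) (hv : vM.IsVolumeForm)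
    (hneg : DForm.IsNegativeType vP (chernSimons W)) (hπ : IsPrincipalSU2Bundle π)
    (hE : IsFrameOf π vM W E) {G : M → V3 →L[ℝ] V3 →L[ℝ] ℝ} (hG : ∀ (q : P) (u w : V6),
      G (π q) (tder 6 3 π q u) (tder 6 3 π q w) = -2 * reTrace (E.val q u * E.val q w)) :
    ContMDiff (𝓡 3) ((𝓡 3).prod 𝓘(ℝ, V3 →L[ℝ] V3 →L[ℝ] ℝ)) ∞
      (fun x : M => Bundle.TotalSpace.mk' (V3 →L[ℝ] V3 →L[ℝ] ℝ)
        (E := fun x : M => TangentSpace (𝓡 3) x →L[ℝ] TangentSpace (𝓡 3) x →L[ℝ] ℝ) x (G x)) := by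
  have : IsManifold (𝓡 3) 1 M := IsManifold.of_le (n := ∞) (by norm_cast)
  intro x
  rw [contMDiffAt_hom_bundle]
  refine ⟨contMDiffAt_id, ?_⟩
  obtain ⟨U, s, h, hx, hT⟩ := hπ.exists_chartTriv x (mem_extChartAt_source x)
  have hx' := hT.proj_s x hx
  have hqU : π (s x) ∈ U := by rwa [hx']
  let N : V3 → Matrix (Fin 3) (Fin 3) ℝ := baseFrameMatrix vM W x s
  have hN : ∀ a i, ContDiffAt ℝ ∞ (fun z => N z a i) (extChartAt (𝓡 3) x x) := fun a i => by
    have := hW.contDiffAt_baseFrameMatrix (vM := vM) hv hneg hπ hT hqU a i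
    rwa [coordProj, hx'] at this
  have hA : ContDiffAt ℝ ∞ (fun z => bilinMap ((N z)ᵀ * N z)) (extChartAt (𝓡 3) x x) :=
    contDiffAt_bilinMap fun a i => by
      simp only [Matrix.mul_apply, Matrix.transpose_apply]
      exact ContDiffAt.sum fun j _ => (hN j a).mul (hN j i)
  have hA' : ContMDiffAt (𝓡 3) 𝓘(ℝ, V3 →L[ℝ] V3 →L[ℝ] ℝ) ∞
      (fun x' => bilinMap ((N (extChartAt (𝓡 3) x x'))ᵀ * N (extChartAt (𝓡 3) x x'))) x :=
    hA.contMDiffAt.comp x contMDiffAt_extChartAt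
  refine hA'.congr_of_eventuallyEq ?_
  filter_upwards [hT.isOpen.mem_nhds hx] with x' hx'U
  have hsrc := hT.subset_source hx'U
  have hch : x' ∈ (chartAt (EuclideanSpace ℝ (Fin 3)) x).source := by simpa using hsrc
  ext1 v
  ext1 w
  refine (inCoordinates_apply_eq₂ (F₃ := ℝ) (E₃ := Bundle.Trivial M ℝ) (by simpa using hch)
    (by simpa using hch) (Set.mem_univ _)).trans ?_
  have hsymm : ∀ u : V3, (trivializationAt V3 (TangentSpace (𝓡 3)) x).symm x' u =
      tder 3 3 (extChartAt (𝓡 3) x).symm (extChartAt (𝓡 3) x x') u := fun u => by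
    have h1 := TangentBundle.symmL_trivializationAt (I := 𝓡 3) hch
    rw [ModelWithCorners.range_eq_univ, mfderivWithin_univ] at h1
    exact (Bundle.Trivialization.symmL_apply _ (R := ℝ) (by simpa using hch) u).symm.trans (congrArg (fun L => L u) h1)
  rw [hsymm, hsymm]
  have h3 := hW.baseMetric_symm_eq hv hneg hπ hE hG hT ((extChartAt (𝓡 3) x).map_source hsrc)
    (by rwa [(extChartAt (𝓡 3) x).left_inv hsrc]) v w
  rw [(extChartAt (𝓡 3) x).left_inv hsrc] at h3
  rw [bilinMap_transpose_mul_self, ← h3]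
  simp only [Bundle.Trivial.fiberBundle_trivializationAt',
    Bundle.Trivial.linearMapAt_trivialization, LinearMap.id_coe, id_eq]
  rfl

end Bundle

/-! ### Curvature of a metric with a torsion-free moving coframe -/

section MovingFrame

variable {y : V3} {i j k : Fin 3}

theorem pderiv3_congr {f g : V3 → ℝ} (h : f =ᶠ[𝓝 y] g) : pderiv3 i f y = pderiv3 i g y := by
  rw [pderiv3, pderiv3, h.fderiv_eq]

theorem pderiv3_add {f g : V3 → ℝ} (hf : DifferentiableAt ℝ f y) (hg : DifferentiableAt ℝ g y) :
    pderiv3 i (fun z => f z + g z) y = pderiv3 i f y + pderiv3 i g y := by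
  rw [pderiv3, fderiv_fun_add hf hg]
  rfl

theorem pderiv3_sub {f g : V3 → ℝ} (hf : DifferentiableAt ℝ f y) (hg : DifferentiableAt ℝ g y) :
    pderiv3 i (fun z => f z - g z) y = pderiv3 i f y - pderiv3 i g y := by
  rw [pderiv3, fderiv_fun_sub hf hg]
  rfl

theorem pderiv3_mul {f g : V3 → ℝ} (hf : DifferentiableAt ℝ f y) (hg : DifferentiableAt ℝ g y) :
    pderiv3 i (fun z => f z * g z) y = pderiv3 i f y * g y + f y * pderiv3 i g y := by
  rw [pderiv3, fderiv_fun_mul hf hg]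
  simp only [_root_.add_apply, _root_.smul_apply, smul_eq_mul, pderiv3]
  ring

theorem pderiv3_sum {f : Fin 3 → V3 → ℝ} (hf : ∀ l, DifferentiableAt ℝ (f l) y) :
    pderiv3 i (fun z => ∑ l, f l z) y = ∑ l, pderiv3 i (f l) y := by
  rw [pderiv3, fderiv_fun_sum fun l _ => hf l]
  simp [pderiv3]

theorem pderiv3_comm {f : V3 → ℝ} (hf : ContDiffAt ℝ 2 f y) :
    pderiv3 i (pderiv3 j f) y = pderiv3 j (pderiv3 i f) y := by
  have hd : DifferentiableAt ℝ (fderiv ℝ f) y :=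
    (hf.fderiv_right (m := 1) (by norm_num)).differentiableAt (by simp)
  have h1 : ∀ a b : Fin 3, pderiv3 a (pderiv3 b f) y =
      fderiv ℝ (fderiv ℝ f) y (EuclideanSpace.basisFun (Fin 3) ℝ a)
        (EuclideanSpace.basisFun (Fin 3) ℝ b) := fun a b => by
    rw [fderiv_clm_apply_const hd]
    rfl
  rw [h1, h1]
  exact (hf.isSymmSndFDerivAt (by simp)).eq _ _

theorem differentiableAt_pderiv3 {f : V3 → ℝ} (hf : ContDiffAt ℝ 2 f y) :
    DifferentiableAt ℝ (pderiv3 i f) y :=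
  ((hf.fderiv_right (m := 1) (by norm_num)).differentiableAt (by simp)).clm_apply
    (differentiableAt_const _)

/-- The partial derivative of a vector-valued function. -/
noncomputable def vecDeriv (i : Fin 3) (f : V3 → Fin 3 → ℝ) (y : V3) : Fin 3 → ℝ :=
  fun a => pderiv3 i (fun z => f z a) y

theorem vecDeriv_cross3 {f g : V3 → Fin 3 → ℝ} (hf : ∀ a, DifferentiableAt ℝ (fun z => f z a) y)
    (hg : ∀ a, DifferentiableAt ℝ (fun z => g z a) y) :
    vecDeriv i (fun z => cross3 (f z) (g z)) y =
      cross3 (vecDeriv i f y) (g y) + cross3 (f y) (vecDeriv i g y) := by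
  have key : ∀ a b, pderiv3 i (fun z => f z a * g z b - f z b * g z a) y =
      pderiv3 i (fun z => f z a) y * g y b - pderiv3 i (fun z => f z b) y * g y a +
      (f y a * pderiv3 i (fun z => g z b) y - f y b * pderiv3 i (fun z => g z a) y) := fun a b => by
    rw [pderiv3_sub ((hf a).fun_mul (hg b)) ((hf b).fun_mul (hg a)), pderiv3_mul (hf a) (hg b),
      pderiv3_mul (hf b) (hg a)]
    ring
  ext a
  fin_cases a
  · exact key 1 2
  · exact key 2 0
  · exact key 0 1

theorem pderiv3_dotProduct {f g : V3 → Fin 3 → ℝ}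
    (hf : ∀ a, DifferentiableAt ℝ (fun z => f z a) y)
    (hg : ∀ a, DifferentiableAt ℝ (fun z => g z a) y) :
    pderiv3 i (fun z => f z ⬝ᵥ g z) y = vecDeriv i f y ⬝ᵥ g y + f y ⬝ᵥ vecDeriv i g y := by
  simp only [dotProduct]
  rw [pderiv3_sum fun a => (hf a).fun_mul (hg a), ← Finset.sum_add_distrib]
  exact Finset.sum_congr rfl fun a _ => pderiv3_mul (hf a) (hg a)

theorem cross3_dotProduct_add (a u v : Fin 3 → ℝ) :
    cross3 a u ⬝ᵥ v + u ⬝ᵥ cross3 a v = 0 := by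
  simp [cross3, dotProduct, Fin.sum_univ_three]
  ring

/-- The curvature operator `w ↦ (u × v) × w` is that of a space of constant curvature `-1`. -/
theorem cross3_cross3_dotProduct (u v w x : Fin 3 → ℝ) :
    cross3 (cross3 u v) w ⬝ᵥ x = (u ⬝ᵥ w) * (v ⬝ᵥ x) - (v ⬝ᵥ w) * (u ⬝ᵥ x) := by
  simp [cross3, dotProduct, Fin.sum_univ_three]
  ring

/-- The covariant derivative `∂ᵢ eⱼ + aᵢ × eⱼ` of the coframe `e` with respect to the `so(3)`
connection `a`. -/
noncomputable def frameDeriv (a e : Fin 3 → V3 → Fin 3 → ℝ) (i j : Fin 3) (z : V3) : Fin 3 → ℝ :=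
  vecDeriv i (e j) z + cross3 (a i z) (e j z)

/-- The matrix with columns `e₀, e₁, e₂`. -/
def columns (e : Fin 3 → V3 → Fin 3 → ℝ) (z : V3) : Matrix (Fin 3) (Fin 3) ℝ :=
  Matrix.of fun b j => e j z b

variable {a e : Fin 3 → V3 → Fin 3 → ℝ} {G : V3 → Matrix (Fin 3) (Fin 3) ℝ}

/-- If the torsion vanishes near a point, the Levi-Civita connection is the connection `a` read in
the frame: `∑ₗ Γˡᵢⱼ eₗ = ∂ᵢ eⱼ + aᵢ × eⱼ`. -/
theorem christoffel_eq (he : ∀ j b, DifferentiableAt ℝ (fun z => e j z b) y)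
    (htors : ∀ i j, frameDeriv a e i j y = frameDeriv a e j i y)
    (hG : ∀ᶠ z in 𝓝 y, ∀ i j, G z i j = e i z ⬝ᵥ e j z) (hdet : (columns e y).det ≠ 0)
    (l i j : Fin 3) :
    christoffel G l i j y = ((columns e y)⁻¹ *ᵥ frameDeriv a e i j y) l := by
  have hdG : ∀ k i j, pderiv3 k (fun z => G z i j) y =
      frameDeriv a e k i y ⬝ᵥ e j y + e i y ⬝ᵥ frameDeriv a e k j y := fun k i j => by
    have h1 : (fun z => G z i j) =ᶠ[𝓝 y] fun z => e i z ⬝ᵥ e j z := by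
      filter_upwards [hG] with z hz using hz i j
    rw [pderiv3_congr h1, pderiv3_dotProduct (he i) (he j), frameDeriv, frameDeriv,
      add_dotProduct, dotProduct_add]
    linarith [cross3_dotProduct_add (a k y) (e i y) (e j y)]
  have hGm : G y = (columns e y)ᵀ * columns e y := by
    ext i j
    rw [hG.self_of_nhds, Matrix.mul_apply]
    rfl
  have hsum : ∀ m, pderiv3 i (fun z => G z m j) y + pderiv3 j (fun z => G z m i) y
      - pderiv3 m (fun z => G z i j) y = 2 * ((columns e y)ᵀ *ᵥ frameDeriv a e i j y) m :=
    fun m => by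
      have h2 : ((columns e y)ᵀ *ᵥ frameDeriv a e i j y) m = e m y ⬝ᵥ frameDeriv a e i j y := rfl
      rw [h2, hdG, hdG, hdG, htors j m, htors j i, htors i m,
        dotProduct_comm (e i y) (frameDeriv a e m j y)]
      ring
  have hinv : (columns e y)⁻¹ = (G y)⁻¹ * (columns e y)ᵀ := by
    rw [hGm, Matrix.mul_inv_rev, mul_assoc, Matrix.nonsing_inv_mul, mul_one]
    rw [Matrix.det_transpose]
    exact isUnit_iff_ne_zero.2 hdet
  rw [christoffel, hinv, ← Matrix.mulVec_mulVec]
  simp only [hsum, Matrix.mulVec, dotProduct, Finset.mul_sum]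
  refine Finset.sum_congr rfl fun m _ => Finset.sum_congr rfl fun b _ => by ring

theorem differentiableAt_inv_columns (he : ∀ j b, DifferentiableAt ℝ (fun z => e j z b) y)
    (hdet : (columns e y).det ≠ 0) (l b : Fin 3) :
    DifferentiableAt ℝ (fun z => (columns e z)⁻¹ l b) y := by
  have h1 : DifferentiableAt ℝ (fun z => (columns e z).det) y := by
    simp only [Matrix.det_fin_three, columns, Matrix.of_apply]
    fun_prop
  have h2 : DifferentiableAt ℝ (fun z => (columns e z).adjugate l b) y := by
    simp only [Matrix.adjugate_fin_three, columns, Matrix.of_apply]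
    fin_cases l <;> fin_cases b <;> simp <;> fun_prop
  have h3 : (fun z => (columns e z)⁻¹ l b) =
      fun z => ((columns e z).det)⁻¹ * (columns e z).adjugate l b := by
    funext z
    rw [Matrix.inv_def, Ring.inverse_eq_inv', Matrix.smul_apply, smul_eq_mul]
  rw [h3]
  exact (h1.inv hdet).mul h2

theorem differentiableAt_frameDeriv (he : ∀ j b, ContDiffAt ℝ 2 (fun z => e j z b) y)
    (ha : ∀ j b, DifferentiableAt ℝ (fun z => a j z b) y) (i j b : Fin 3) :
    DifferentiableAt ℝ (fun z => frameDeriv a e i j z b) y := by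
  have he' : ∀ j b, DifferentiableAt ℝ (fun z => e j z b) y := fun j b =>
    (he j b).differentiableAt (by simp)
  refine (differentiableAt_pderiv3 (he j b)).add ?_
  fin_cases b
  · exact ((ha i 1).mul (he' j 2)).sub ((ha i 2).mul (he' j 1))
  · exact ((ha i 2).mul (he' j 0)).sub ((ha i 0).mul (he' j 2))
  · exact ((ha i 0).mul (he' j 1)).sub ((ha i 1).mul (he' j 0))

/-- The curvature of the metric is the curvature of the connection `a` acting on the frame. -/
theorem sum_riemannTensor_smul (he : ∀ j b, ContDiffAt ℝ 2 (fun z => e j z b) y)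
    (ha : ∀ j b, ContDiffAt ℝ 1 (fun z => a j z b) y)
    (htors : ∀ᶠ z in 𝓝 y, ∀ i j, frameDeriv a e i j z = frameDeriv a e j i z)
    (hG : ∀ᶠ z in 𝓝 y, ∀ i j, G z i j = e i z ⬝ᵥ e j z)
    (hdet : ∀ᶠ z in 𝓝 y, (columns e z).det ≠ 0) (k i j : Fin 3) :
    ∑ l, riemannTensor G l k i j y • e l y =
      cross3 (vecDeriv i (a j) y - vecDeriv j (a i) y + cross3 (a i y) (a j y)) (e k y) := by
  have he' : ∀ j b, DifferentiableAt ℝ (fun z => e j z b) y := fun j b =>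
    (he j b).differentiableAt (by simp)
  have ha' : ∀ j b, DifferentiableAt ℝ (fun z => a j z b) y := fun j b =>
    (ha j b).differentiableAt (by simp)
  have hΓ : ∀ᶠ z in 𝓝 y, ∀ l i j,
      christoffel G l i j z = ((columns e z)⁻¹ *ᵥ frameDeriv a e i j z) l := by
    have hev : ∀ᶠ z in 𝓝 y, ∀ j b, ContDiffAt ℝ 2 (fun z => e j z b) z :=
      Filter.eventually_all.2 fun j => Filter.eventually_all.2 fun b =>
        (he j b).eventually (by simp)
    filter_upwards [hev, htors, hG.eventually_nhds, hdet] with z hz1 hz2 hz3 hz4 l i j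
    exact christoffel_eq (fun j b => (hz1 j b).differentiableAt (by simp)) hz2 hz3 hz4 l i j
  have hΓd : ∀ l i j, DifferentiableAt ℝ (christoffel G l i j) y := fun l i j => by
    have h1 : (fun z => ((columns e z)⁻¹ *ᵥ frameDeriv a e i j z) l) =ᶠ[𝓝 y]
        christoffel G l i j := by
      filter_upwards [hΓ] with z hz using (hz l i j).symm
    refine DifferentiableAt.congr_of_eventuallyEq ?_ h1.symm
    simp only [Matrix.mulVec, dotProduct]
    exact DifferentiableAt.fun_sum fun b _ =>
      (differentiableAt_inv_columns he' hdet.self_of_nhds l b).mul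
        (differentiableAt_frameDeriv he ha' i j b)
  -- the frame components of the Christoffel symbols
  have hS : ∀ᶠ z in 𝓝 y, ∀ i j b,
      ∑ l, christoffel G l i j z * e l z b = frameDeriv a e i j z b := by
    filter_upwards [hΓ, hdet] with z hz hz' i j b
    have h1 : ∑ l, christoffel G l i j z * e l z b =
        (columns e z *ᵥ ((columns e z)⁻¹ *ᵥ frameDeriv a e i j z)) b := by
      simp only [hz]
      exact Finset.sum_congr rfl fun l _ => mul_comm _ _
    rw [h1, Matrix.mulVec_mulVec, Matrix.mul_nonsing_inv _ (isUnit_iff_ne_zero.2 hz'),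
      Matrix.one_mulVec]
  have hS0 := hS.self_of_nhds
  -- the derivative of the previous identity
  have hdS : ∀ i j k b, ∑ l, (pderiv3 i (christoffel G l j k) y * e l y b +
        christoffel G l j k y * vecDeriv i (e l) y b) =
      pderiv3 i (pderiv3 j fun z => e k z b) y +
        (cross3 (vecDeriv i (a j) y) (e k y) + cross3 (a j y) (vecDeriv i (e k) y)) b :=
    fun i j k b => by
      have h1 : (fun z => ∑ l, christoffel G l j k z * e l z b) =ᶠ[𝓝 y]
          fun z => frameDeriv a e j k z b := by
        filter_upwards [hS] with z hz using hz j k b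
      have h2 := pderiv3_congr (i := i) h1
      rw [pderiv3_sum fun l => (hΓd l j k).fun_mul (he' l b)] at h2
      have h3 : ∀ l, pderiv3 i (fun z => christoffel G l j k z * e l z b) y =
          pderiv3 i (christoffel G l j k) y * e l y b +
            christoffel G l j k y * vecDeriv i (e l) y b := fun l =>
        pderiv3_mul (hΓd l j k) (he' l b)
      have h4 : DifferentiableAt ℝ (fun z => cross3 (a j z) (e k z) b) y := by
        have h5 := (differentiableAt_frameDeriv he ha' j k b).sub
          (differentiableAt_pderiv3 (i := j) (he k b))
        refine h5.congr_of_eventuallyEq (Filter.Eventually.of_forall fun z => ?_)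
        simp [frameDeriv, vecDeriv]
      simp only [h3] at h2
      rw [h2, ← vecDeriv_cross3 (ha' j) (he' k)]
      exact pderiv3_add (differentiableAt_pderiv3 (he k b)) h4
  -- the terms quadratic in the Christoffel symbols
  have hquad : ∀ i j k b, ∑ l, christoffel G l j k y * vecDeriv i (e l) y b =
      ∑ l, (∑ m, christoffel G l i m y * christoffel G m j k y) * e l y b -
        cross3 (a i y) (frameDeriv a e j k y) b := fun i j k b => by
    have h1 : ∀ l, vecDeriv i (e l) y b =
        ∑ m, christoffel G m i l y * e m y b - cross3 (a i y) (e l y) b := fun l => by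
      rw [hS0, frameDeriv, Pi.add_apply, add_sub_cancel_right]
    have h2 : cross3 (a i y) (frameDeriv a e j k y) b =
        ∑ l, christoffel G l j k y * cross3 (a i y) (e l y) b := by
      have h3 : frameDeriv a e j k y = fun b => ∑ l, christoffel G l j k y * e l y b :=
        funext fun b => (hS0 j k b).symm
      rw [h3]
      fin_cases b <;> simp [cross3, Fin.sum_univ_three] <;> ring
    rw [h2]
    simp only [h1, mul_sub, Finset.sum_sub_distrib, Finset.mul_sum, Finset.sum_mul]
    rw [Finset.sum_comm]
    congr 1
    exact Finset.sum_congr rfl fun l _ => Finset.sum_congr rfl fun m _ => by ring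
  ext b
  have hR : (∑ l, riemannTensor G l k i j y • e l y) b =
      (∑ l, pderiv3 i (christoffel G l j k) y * e l y b +
        ∑ l, (∑ m, christoffel G l i m y * christoffel G m j k y) * e l y b) -
      (∑ l, pderiv3 j (christoffel G l i k) y * e l y b +
        ∑ l, (∑ m, christoffel G l j m y * christoffel G m i k y) * e l y b) := by
    rw [← Finset.sum_add_distrib, ← Finset.sum_add_distrib, ← Finset.sum_sub_distrib,
      Finset.sum_apply]
    refine Finset.sum_congr rfl fun l _ => ?_
    rw [Pi.smul_apply, smul_eq_mul, riemannTensor, Finset.sum_sub_distrib]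
    ring
  have h1 := hdS i j k b
  have h2 := hdS j i k b
  rw [Finset.sum_add_distrib, hquad] at h1 h2
  rw [hR, ← sub_eq_zero]
  have h3 := pderiv3_comm (i := i) (j := j) (he k b)
  have h4 : cross3 (vecDeriv i (a j) y - vecDeriv j (a i) y + cross3 (a i y) (a j y)) (e k y) b =
      (cross3 (vecDeriv i (a j) y) (e k y) + cross3 (a j y) (vecDeriv i (e k) y)) b +
      cross3 (a i y) (frameDeriv a e j k y) b -
      ((cross3 (vecDeriv j (a i) y) (e k y) + cross3 (a i y) (vecDeriv j (e k) y)) b +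
      cross3 (a j y) (frameDeriv a e i k y) b) := by
    simp only [frameDeriv]
    fin_cases b <;> simp [cross3] <;> ring
  rw [h4]
  linarith

/-- The algebra behind constant curvature: the curvature tensor `Rₙₖᵢⱼ = gᵢₖ gⱼₙ - gⱼₖ gᵢₙ` has
all sectional curvatures `-1`. -/
theorem sectional_eq_of_curvature_eq {g : Matrix (Fin 3) (Fin 3) ℝ} (hg : ∀ i j, g i j = g j i)
    {R : Fin 3 → Fin 3 → Fin 3 → Fin 3 → ℝ}
    (hR : ∀ n k i j, ∑ l, g l n * R l k i j = g i k * g j n - g j k * g i n) (a b : Fin 3 → ℝ) :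
    ∑ l, ∑ k, ∑ i, ∑ j, ∑ n, g l n * R l k i j * b k * a i * b j * a n =
      -1 * ((a ⬝ᵥ g *ᵥ a) * (b ⬝ᵥ g *ᵥ b) - (a ⬝ᵥ g *ᵥ b) ^ 2) := by
  have h1 : ∑ l, ∑ k, ∑ i, ∑ j, ∑ n, g l n * R l k i j * b k * a i * b j * a n =
      ∑ k, ∑ i, ∑ j, ∑ n, (∑ l, g l n * R l k i j) * (b k * a i * b j * a n) := by
    simp only [Finset.sum_mul]
    rw [Finset.sum_comm]
    refine Finset.sum_congr rfl fun k _ => ?_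
    rw [Finset.sum_comm]
    refine Finset.sum_congr rfl fun i _ => ?_
    rw [Finset.sum_comm]
    refine Finset.sum_congr rfl fun j _ => ?_
    rw [Finset.sum_comm]
    exact Finset.sum_congr rfl fun n _ => Finset.sum_congr rfl fun l _ => by ring
  rw [h1]
  simp only [hR]
  have h01 := hg 1 0
  have h02 := hg 2 0
  have h12 := hg 2 1
  simp only [Fin.sum_univ_three, dotProduct, Matrix.mulVec, h01, h02, h12]
  ring

end MovingFrame

/-! ### Constant curvature -/

theorem vecDeriv_su2Coord {b : V3 → V3 →L[ℝ] Mat2} {z : V3} (hb : DifferentiableAt ℝ b z)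
    (i : Fin 3) (v : V3) : vecDeriv i (fun y => su2Coord (b y v)) z =
      su2Coord (fderiv ℝ b z (EuclideanSpace.basisFun (Fin 3) ℝ i) v) := by
  have hd : DifferentiableAt ℝ (fun y => b y v) z := hb.clm_apply (differentiableAt_const v)
  ext a
  have h1 : HasFDerivAt (fun y => su2Coord (b y v) a)
      (((ContinuousLinearMap.proj a : (Fin 3 → ℝ) →L[ℝ] ℝ).comp su2Coord).comp
        (fderiv ℝ (fun y => b y v) z)) z :=
    (((ContinuousLinearMap.proj a : (Fin 3 → ℝ) →L[ℝ] ℝ).comp su2Coord).hasFDerivAt).comp z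
      hd.hasFDerivAt
  rw [vecDeriv, pderiv3, h1.fderiv, fderiv_clm_apply_const hb]
  rfl

section Bundle

variable {M : Type*} [TopologicalSpace M] [ChartedSpace (EuclideanSpace ℝ (Fin 3)) M]
variable {P : Type*} [TopologicalSpace P] [ChartedSpace (EuclideanSpace ℝ (Fin 6)) P]
variable [MulAction SU2ᵐᵒᵖ P] {π : P → M} {U : Set M} {s : M → P} {h : P → SU2}
  {W E : DForm 6 P 1 Mat2} {x₀ : M} {p q : P} {vM : DForm 3 M 3 ℝ} {vP : DForm 6 P 6 ℝ}
variable [IsManifold (𝓡 3) ∞ M] [IsManifold (𝓡 6) ∞ P]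

omit [MulAction SU2ᵐᵒᵖ P] [ChartedSpace (EuclideanSpace ℝ (Fin 6)) P]
  [TopologicalSpace P] [IsManifold (𝓡 6) ∞ P] in
theorem eventually_symm_mem (hU : IsOpen U) {z : V3} (hz : z ∈ (extChartAt (𝓡 3) x₀).target)
    (hzU : (extChartAt (𝓡 3) x₀).symm z ∈ U) : ∀ᶠ y in 𝓝 z,
      y ∈ (extChartAt (𝓡 3) x₀).target ∧ (extChartAt (𝓡 3) x₀).symm y ∈ U :=
  Filter.Eventually.and ((isOpen_extChartAt_target x₀).mem_nhds hz)
    ((contMDiffAt_extChartAt_symm' hz).continuousAt.eventually (hU.mem_nhds hzU))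

omit [IsManifold (𝓡 3) ∞ M] [IsManifold (𝓡 6) ∞ P] in
theorem IsChartTriv.coordProj_coordSection (hT : IsChartTriv π x₀ U s h) {z : V3}
    (hz : z ∈ (extChartAt (𝓡 3) x₀).target) (hzU : (extChartAt (𝓡 3) x₀).symm z ∈ U) :
    coordProj π x₀ (coordSection x₀ s z) = z := by
  rw [coordProj, coordSection, hT.proj_s _ hzU, (extChartAt (𝓡 3) x₀).right_inv hz]

omit [IsManifold (𝓡 6) ∞ P] in
theorem IsChartTriv.tder_coordProj_coordSection (hT : IsChartTriv π x₀ U s h)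
    (hπ : IsPrincipalSU2Bundle π) {z : V3} (hz : z ∈ (extChartAt (𝓡 3) x₀).target)
    (hzU : (extChartAt (𝓡 3) x₀).symm z ∈ U) (u : V3) :
    tder 6 3 (coordProj π x₀) (coordSection x₀ s z) (tder 3 6 (coordSection x₀ s) z u) = u := by
  have hq : π (coordSection x₀ s z) ∈ U := by rwa [coordSection, hT.proj_s _ hzU]
  have h1 : (fun y => coordProj π x₀ (coordSection x₀ s y)) =ᶠ[𝓝 z] fun y => y := by
    filter_upwards [eventually_symm_mem hT.isOpen hz hzU] with y hy using
      hT.coordProj_coordSection hy.1 hy.2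
  have h2 := tder_comp ((hT.coordProj_smooth hπ hq).mdifferentiableAt (by simp))
    ((hT.section_smooth hz hzU).mdifferentiableAt (by simp))
  rw [tder_congr h1, tder_id] at h2
  exact (congrArg (fun L => L u) h2).symm

/-- In the trivialization, the basic form is the square root of the curvature on the base. -/
theorem IsConnectionForm.along_coordSection (hW : IsConnectionForm W) (hv : vM.IsVolumeForm)
    (hneg : DForm.IsNegativeType vP (chernSimons W)) (hπ : IsPrincipalSU2Bundle π)
    (hE : IsFrameOf π vM W E) (hT : IsChartTriv π x₀ U s h) {z : V3}
    (hz : z ∈ (extChartAt (𝓡 3) x₀).target) (hzU : (extChartAt (𝓡 3) x₀).symm z ∈ U) (u : V3) :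
    E.along (coordSection x₀ s) z u = su2Of (baseFrameMatrix vM W x₀ s z *ᵥ u) := by
  have hq : π (coordSection x₀ s z) ∈ U := by rwa [coordSection, hT.proj_s _ hzU]
  have h1 := (hW.isFrameAt_iff hv hneg hπ hT hq _).1 (hE.isFrameAt _)
    (tder 3 6 (coordSection x₀ s) z u)
  have hh : h (coordSection x₀ s z) = 1 := hT.fibre_section hzU
  rw [hh, inv_one, SU2.mat_one, one_mul, mul_one, hT.coordProj_coordSection hz hzU,
    hT.tder_coordProj_coordSection hπ hz hzU, frameMap_apply] at h1
  exact h1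

/-- If the torsion vanishes, the metric on the base is hyperbolic. -/
theorem IsConnectionForm.hasConstantCurvature (hW : IsConnectionForm W) (hv : vM.IsVolumeForm)
    (hneg : DForm.IsNegativeType vP (chernSimons W)) (hπ : IsPrincipalSU2Bundle π)
    (hE : IsFrameOf π vM W E) (htor : covExtDeriv W E = 0) (g : RMetric M)
    (hg : ∀ (q : P) (u w : V6), (show V3 →L[ℝ] V3 →L[ℝ] ℝ from g.inner (π q)) (tder 6 3 π q u)
      (tder 6 3 π q w) = -2 * reTrace (E.val q u * E.val q w)) :
    g.HasConstantCurvature (-1) := by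
  intro x y hy
  obtain ⟨U, s, h, hyU, hT⟩ := hπ.exists_chartTriv x ((extChartAt (𝓡 3) x).map_target hy)
  have hO := eventually_symm_mem hT.isOpen hy hyU
  set σ := coordSection x s with hσ
  set N := baseFrameMatrix vM W x s with hN
  let B : Fin 3 → V3 := fun i => EuclideanSpace.basisFun (Fin 3) ℝ i
  let e : Fin 3 → V3 → Fin 3 → ℝ := fun j z => N z *ᵥ B j
  let a : Fin 3 → V3 → Fin 3 → ℝ := fun i z => su2Coord (W.along σ z (B i))
  have heN : ∀ j z b, e j z b = N z b j := fun j z b => by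
    simp [e, B]
  have hcol : ∀ z, columns e z = N z := fun z => by
    ext b j
    exact heN j z b
  -- the trivialization along the section
  have hmem : ∀ z, (extChartAt (𝓡 3) x).symm z ∈ U → π (σ z) ∈ U := fun z hzU => by
    rwa [hσ, coordSection, hT.proj_s _ hzU]
  have hyq := hmem y hyU
  have hcy := hT.coordProj_coordSection hy hyU
  have he : ∀ j b, ContDiffAt ℝ 2 (fun z => e j z b) y := fun j b => by
    simp only [heN]
    have h1 := hW.contDiffAt_baseFrameMatrix (vM := vM) hv hneg hπ hT hyq b j
    rw [hcy] at h1
    exact h1.of_le (WithTop.coe_le_coe.2 (le_top : (2 : ℕ∞) ≤ ⊤))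
  have hWd : ∀ z, z ∈ (extChartAt (𝓡 3) x).target → (extChartAt (𝓡 3) x).symm z ∈ U →
      ContDiffAt ℝ ∞ (W.along σ) z := fun z hz hzU => hW.smooth.along (hT.section_smooth hz hzU)
  have hEd : ∀ z, z ∈ (extChartAt (𝓡 3) x).target → (extChartAt (𝓡 3) x).symm z ∈ U →
      DifferentiableAt ℝ (E.along σ) z := fun z hz hzU =>
    (hE.smooth.along (hT.section_smooth hz hzU)).differentiableAt (by simp)
  have ha : ∀ j b, ContDiffAt ℝ 1 (fun z => a j z b) y := fun j b => by
    have h1 : ContDiffAt ℝ 1 (fun z => W.along σ z (B j)) y :=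
      ((hWd y hy hyU).of_le (by exact_mod_cast le_top)).clm_apply contDiffAt_const
    exact ((ContinuousLinearMap.proj b : (Fin 3 → ℝ) →L[ℝ] ℝ).comp su2Coord).contDiff.contDiffAt.comp
      y h1
  have heE : ∀ z, z ∈ (extChartAt (𝓡 3) x).target → (extChartAt (𝓡 3) x).symm z ∈ U →
      ∀ j, su2Coord (E.along σ z (B j)) = e j z := fun z hz hzU j => by
    rw [hW.along_coordSection hv hneg hπ hE hT hz hzU, su2Coord_su2Of]
  have hEsu : ∀ z u, IsSu2 (E.along σ z u) := fun z u => hE.isSu2_along σ z u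
  have hWsu : ∀ z u, IsSu2 (W.along σ z u) := fun z u => hW.isSu2_along σ z u
  -- the torsion vanishes in the trivialization
  have htors : ∀ᶠ z in 𝓝 y, ∀ i j, frameDeriv a e i j z = frameDeriv a e j i z := by
    filter_upwards [hO.eventually_nhds] with z hz i j
    obtain ⟨hzt, hzU⟩ := hz.self_of_nhds
    have h1 := hW.covExtDeriv_eq hE.toIsEquivariantSu2Form hE.smooth hE.horizontal hπ hT
      (hmem z hzU) (tder 3 6 σ z (B i)) (tder 3 6 σ z (B j))
    have hh : h (σ z) = 1 := hT.fibre_section hzU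
    rw [hh, inv_one, SU2.mat_one, one_mul, mul_one, hT.coordProj_coordSection hzt hzU,
      hT.tder_coordProj_coordSection hπ hzt hzU, hT.tder_coordProj_coordSection hπ hzt hzU,
      htor] at h1
    have h2 : covD (W.along σ) (E.along σ) z (B i) (B j) = 0 := h1.symm
    have hvd : ∀ i j, su2Coord (fderiv ℝ (E.along σ) z (B i) (B j)) = vecDeriv i (e j) z :=
      fun i j => by
        rw [← vecDeriv_su2Coord (hEd z hzt hzU)]
        funext b
        refine pderiv3_congr ?_
        filter_upwards [hz] with w hw
        rw [heE w hw.1 hw.2]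
    have h3 : ∀ A B A' B' C : Mat2, C + (A * B - A' * B') + (B' * A' - B * A) =
      C + ((A * B - B * A) - (A' * B' - B' * A')) := fun A B A' B' C => by abel
    rw [covD, h3] at h2
    have h4 := congrArg su2Coord h2
    rw [map_add, map_sub, map_sub, hvd, hvd, (hWsu z _).su2Coord_bracket (hEsu z _),
      (hWsu z _).su2Coord_bracket (hEsu z _), heE z hzt hzU, heE z hzt hzU, map_zero] at h4
    rw [frameDeriv, frameDeriv, ← sub_eq_zero, ← h4]
    simp only [a]
    abel
  have hG : ∀ᶠ z in 𝓝 y, ∀ i j, g.gram x z i j = e i z ⬝ᵥ e j z := by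
    filter_upwards [hO] with z hz i j
    exact hW.baseMetric_symm_eq hv hneg hπ hE (G := fun x => g.inner x) hg hT hz.1 hz.2 _ _
  have hdet : ∀ᶠ z in 𝓝 y, (columns e z).det ≠ 0 := by
    filter_upwards [hO] with z hz
    have h1 := hW.det_baseFrameMatrix_ne_zero (vM := vM) hv hneg hπ hT (hmem z hz.2)
    rwa [hT.coordProj_coordSection hz.1 hz.2, ← hN, ← hcol] at h1
  -- the curvature equation in the trivialization
  have hcurv : ∀ i j, vecDeriv i (a j) y - vecDeriv j (a i) y + cross3 (a i y) (a j y) =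
      cross3 (e i y) (e j y) := fun i j => by
    have hd := (hWd y hy hyU).differentiableAt (by simp)
    rw [vecDeriv_su2Coord hd, vecDeriv_su2Coord hd,
      ← (hWsu y _).su2Coord_bracket (hWsu y _), ← map_sub, ← map_add]
    have h1 : 0 < (curvMatrix (W.along σ) y).det := by
      have h2 := hW.det_curvMatrix_pos hneg hπ hT hyq
      rwa [hcy] at h2
    have h3 : volCoeff vM x y ≠ 0 := volCoeff_ne_zero hv hy
    simp only [e]
    rw [cross3_mulVec, hN, baseFrameMatrix, adjugate_frameMatrix h3 h1]
    exact su2Coord_curv (W.along σ) y (B i) (B j)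
  have hG0 := hG.self_of_nhds
  refine sectional_eq_of_curvature_eq (fun i j => ?_) fun n k i j => ?_
  · rw [hG0, hG0, dotProduct_comm]
  · have h1 := sum_riemannTensor_smul he ha htors hG hdet k i j
    rw [hcurv] at h1
    have h2 := congrArg (fun v => v ⬝ᵥ e n y) h1
    simp only [cross3_cross3_dotProduct, sum_dotProduct, smul_dotProduct, smul_eq_mul] at h2
    simp only [hG0]
    rw [← h2]
    exact Finset.sum_congr rfl fun l _ => mul_comm _ _

/-- The form `-2 Tr (E ⊗ E)` is the pullback of a Riemannian metric on the base. -/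
theorem IsConnectionForm.exists_metric (hW : IsConnectionForm W) (hv : vM.IsVolumeForm)
    (hneg : DForm.IsNegativeType vP (chernSimons W)) (hπ : IsPrincipalSU2Bundle π)
    (hE : IsFrameOf π vM W E) : ∃ g : RMetric M, ∀ (q : P) (u w : V6),
      (show V3 →L[ℝ] V3 →L[ℝ] ℝ from g.inner (π q)) (tder 6 3 π q u) (tder 6 3 π q w) =
        -2 * reTrace (E.val q u * E.val q w) := by
  obtain ⟨G, hG⟩ := hW.exists_baseMetric hv hneg hπ hE
  refine ⟨{ inner := G, symm := fun x v w => ?_, pos := ?_, isVonNBounded := ?_, contMDiff := ?_ },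
    hG⟩
  · obtain ⟨U, s, h, hx, hT⟩ := hπ.exists_chartTriv x (mem_extChartAt_source x)
    exact (hW.baseMetric_eq hv hneg hπ hE hG hT hx v w).trans
      ((dotProduct_comm _ _).trans (hW.baseMetric_eq hv hneg hπ hE hG hT hx w v).symm)
  · exact hW.baseMetric_pos hv hneg hπ hE hG
  · exact fun x => isVonNBounded_of_pos (G x) (hW.baseMetric_pos hv hneg hπ hE hG x)
  · exact hW.baseMetric_smooth hv hneg hπ hE hG

end Bundle

theorem proposition2 {M P : Type*}
    [TopologicalSpace M] [ChartedSpace (EuclideanSpace ℝ (Fin 3)) M] [IsManifold (𝓡 3) ∞ M]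
    [TopologicalSpace P] [ChartedSpace (EuclideanSpace ℝ (Fin 6)) P] [IsManifold (𝓡 6) ∞ P]
    [MulAction SU2ᵐᵒᵖ P] (π : P → M) (hπ : IsPrincipalSU2Bundle π)
    (vM : DForm 3 M 3 ℝ) (hvM : vM.IsVolumeForm)
    (vP : DForm 6 P 6 ℝ) (hvP : vP.IsVolumeForm)
    (W : DForm 6 P 1 Mat2) (hW : IsConnectionForm W)
    (hneg : DForm.IsNegativeType vP (chernSimons W)) :
    (∃! E : DForm 6 P 1 Mat2, IsFrameOf π vM W E) ∧
    ∀ E : DForm 6 P 1 Mat2, IsFrameOf π vM W E →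
      ((DForm.hat vP (chernSimons W)).d = 0 ↔ covExtDeriv W E = 0) ∧
      ∃ g : RMetric M,
        (∀ (p : P) (u w : TangentSpace (𝓡 6) p),
          g.inner (π p) (mfderiv (𝓡 6) (𝓡 3) π p u) (mfderiv (𝓡 6) (𝓡 3) π p w) =
            -2 * reTrace (E p (fun _ => u) * E p (fun _ => w))) ∧
        (covExtDeriv W E = 0 → g.HasConstantCurvature (-1)) := by
  refine ⟨hW.existsUnique_isFrameOf hvM hneg hπ, fun E hE =>
    ⟨hW.hat_d_eq_zero_iff hvM hvP hneg hπ hE, ?_⟩⟩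
  obtain ⟨g, hg⟩ := hW.exists_metric hvM hneg hπ hE
  exact ⟨g, hg, fun htor => hW.hasConstantCurvature hvM hneg hπ hE htor g hg⟩
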